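/- Let $X$ be a complex manifold (Hausdorff, finite-dimensional) with almost complex structure $j$, and let $T_X\otimes\mathbb C=T^{1,0}_X\oplus T^{0,1}_X$ be the decomposition into the $\pm i$-eigenbundles of $j$, with projections $\mathrm{pr}^{1,0}$, $\mathrm{pr}^{0,1}$. We also write $\mathrm{pr}^{1,0}$, $\mathrm{pr}^{0,1}$ for the projections of complex one-forms onto their $(1,0)$- and $(0,1)$-parts, and identify $(T^{1,0}_X)^*$ and $(T^{0,1}_X)^*$ with the bundles of $(1,0)$- and $(0,1)$-forms. A complex Courant algebroid over $X$ is a smooth complex vector bundle $E$ with a smooth symmetric nondegenerate $\mathbb C$-bilinear fibre pairing $\langle\,,\rangle$, a complex bundle map $\rho:E\to T_X\otimes\mathbb C$ and a $\mathbb C$-bilinear bracket $\diamond$ on smooth sections such that, for all smooth sections $\phi,\phi_1,\phi_2,\psi$ and all $f\in C^\infty(X;\mathbb C)$, $\phi\diamond(\phi_1\diamond\phi_2)=\phi_1\diamond(\phi\diamond\phi_2)+(\phi\diamond\phi_1)\diamond\phi_2$, $\phi\diamond(f\psi)=(\rho(\phi)f)\psi+f(\phi\diamond\psi)$, $\phi\diamond\phi=\tfrac12\mathcal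 D\langle\phi,\phi\rangle$ and $\rho(\phi)\langle\psi,\psi\rangle=2\langle\phi\diamond\psi,\psi\rangle$, where $\langle\mathcal Df,\phi\rangle=\rho(\phi)f$. An isomorphism of two of them is an isomorphism of smooth complex vector bundles over $\mathrm{id}_X$ that preserves pairing, anchor and bracket. For $A=T_X\otimes\mathbb C$, $T^{1,0}_X$ or $T^{0,1}_X$, and a smooth section $h$ of $\wedge^3A^*$, let $(A\oplus A^*)_h$ be the bundle $A\oplus A^*$ with $\langle X\oplus\alpha,Y\oplus\beta\rangle=\alpha(Y)+\beta(X)$, $\rho(X\oplus\alpha)=X$ and $$(X\oplus\alpha)\diamond(Y\oplus\beta)=[X,Y]\oplus\big(\mathcal L_X\beta-\iota_Y d_A\alpha+h(X,Y,\cdot)\big),$$ where $\mathcal L$ and $d_A$ are the Lie derivative and the differential of the Lie algebroid $A$. Put $(C^{1,0}_X)_h=(T^{1,0}_X\oplus(T^{1,0}_X)^*)_h$ and $(C^{0,1}_X)_h=(T^{0,1}_X\oplus(T^{0,1}_X)^*)_h$. Let $E_1,E_2$ be complex Courant algebroids over $X$ with a $\mathbb C$-bilinear $E_1$-connection $\overrightarrow\nabla$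 on $E_2$ and a $\mathbb C$-bilinear $E_2$-connection $\overleftarrow\nabla$ on $E_1$ (tensorial in the direction, with the Leibniz rule with respect to the anchor in the other argument). Define $\Omega:\Gamma(E_1)^2\to\Gamma(E_2)$ and $\mho:\Gamma(E_2)^2\to\Gamma(E_1)$ by $$\langle\gamma,\Omega(a,b)\rangle_2=\tfrac12\big(\langle\overleftarrow\nabla_\gamma a,b\rangle_1-\langle a,\overleftarrow\nabla_\gamma b\rangle_1\big),\qquad \langle c,\mho(\alpha,\beta)\rangle_1=\tfrac12\big(\langle\overrightarrow\nabla_c\alpha,\beta\rangle_2-\langle\alpha,\overrightarrow\nabla_c\beta\rangle_2\big).$$ They form a matched pair if both connections preserve the pairings, $\overrightarrow\nabla_{\mathcal D_1f}\beta=0$ and $\overleftarrow\nabla_{\mathcal D_2f}b=0$ for all $f$, $\beta$, $b$, and, for all smooth sections $a,a_i,b$ of $E_1$ and $\alpha,\alpha_i,\beta$ of $E_2$: 1. $\overleftarrow\nabla_\alpha(a_1\diamond_1a_2)-(\overleftarrow\nabla_\alpha a_1)\diamond_1a_2-a_1\diamond_1(\overleftarrow\nabla_\alpha a_2)-\overleftarrow\nabla_{\overrightarrow\nabla_{a_2}\alpha}a_1+\overleftarrow\nabla_{\overrightarrow\nabla_{a_1}\alpha}a_2=-\mho(\alpha,w)-\tfrac12\mathcal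 D_1\langle\alpha,w\rangle_2$ with $w=\Omega(a_1,a_2)+\tfrac12\mathcal D_2\langle a_1,a_2\rangle_1$; 2. $\overrightarrow\nabla_a(\alpha_1\diamond_2\alpha_2)-(\overrightarrow\nabla_a\alpha_1)\diamond_2\alpha_2-\alpha_1\diamond_2(\overrightarrow\nabla_a\alpha_2)-\overrightarrow\nabla_{\overleftarrow\nabla_{\alpha_2}a}\alpha_1+\overrightarrow\nabla_{\overleftarrow\nabla_{\alpha_1}a}\alpha_2=-\Omega(a,u)-\tfrac12\mathcal D_2\langle a,u\rangle_1$ with $u=\mho(\alpha_1,\alpha_2)+\tfrac12\mathcal D_1\langle\alpha_1,\alpha_2\rangle_2$; 3. $\langle\overrightarrow R(a,b)\alpha,\beta\rangle_2+\langle\overleftarrow R(\alpha,\beta)a,b\rangle_1=0$, where $\overrightarrow R(a,b)=[\overrightarrow\nabla_a,\overrightarrow\nabla_b]-\overrightarrow\nabla_{a\diamond_1b}$ and $\overleftarrow R(\alpha,\beta)=[\overleftarrow\nabla_\alpha,\overleftarrow\nabla_\beta]-\overleftarrow\nabla_{\alpha\diamond_2\beta}$; 4. $\overleftarrow\nabla_{\Omega(a_1,a_2)}a_3+\text{cyclic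 permutations}=0$ and $\overrightarrow\nabla_{\mho(\alpha_1,\alpha_2)}\alpha_3+\text{cyclic permutations}=0$. Their matched sum is then $E_1\oplus E_2$ with the sum of the pairings, the sum of the anchors, and the bracket $$(a\oplus\alpha)\diamond(b\oplus\beta)=\big(a\diamond_1b+\overleftarrow\nabla_\alpha b-\overleftarrow\nabla_\beta a+\mho(\alpha,\beta)+\tfrac12\mathcal D_1\langle\alpha,\beta\rangle_2\big)\oplus\big(\alpha\diamond_2\beta+\overrightarrow\nabla_a\beta-\overrightarrow\nabla_b\alpha+\Omega(a,b)+\tfrac12\mathcal D_2\langle a,b\rangle_1\big).$$ **Proposition.** Let $H=H^{3,0}+H^{2,1}+H^{1,2}+H^{0,3}$ be a closed smooth complex 3-form on $X$, with $H^{i,j}$ a smooth form of type $(i,j)$. Then $(C^{1,0}_X)_{H^{3,0}}$ and $(C^{0,1}_X)_{H^{0,3}}$ are complex Courant algebroids, and they form a matched pair with the connections $$\overrightarrow\nabla_{X\oplus\alpha}(Y\oplus\beta)=\nabla^o_XY\oplus\big(\nabla^o_X\beta+H^{1,2}(X,Y,\cdot)\big),\qquad \overleftarrow\nabla_{Y\oplus\beta}(X\oplus\alpha)=\nabla^o_YX\oplus\big(\nabla^o_Y\alpha+H^{2,1}(Y,X,\cdot)\big)$$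 for smooth sections $X\oplus\alpha$ of $C^{1,0}_X$ and $Y\oplus\beta$ of $C^{0,1}_X$, where $\nabla^o_XY=\mathrm{pr}^{0,1}[X,Y]$, $\nabla^o_YX=\mathrm{pr}^{1,0}[Y,X]$, $\nabla^o_X\beta=\mathrm{pr}^{0,1}(\mathcal L_X\beta)$ and $\nabla^o_Y\alpha=\mathrm{pr}^{1,0}(\mathcal L_Y\alpha)$. Their matched sum is a complex Courant algebroid, and it is isomorphic to the complex Courant algebroid $(T_X\oplus T_X^*)\otimes\mathbb C$ with the standard structure twisted by $H$. -/

import Mathlib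

open scoped Manifold ContDiff TensorProduct

noncomputable section

namespace CourantPair

/-! ## Smooth complex functions, complexified tangent bundle, Lie bracket -/

section Manifold

variable (F : Type*) [NormedAddCommGroup F] [NormedSpace ℝ F]
  {M : Type*} [TopologicalSpace M] [ChartedSpace F M]

/-- The smooth functions `M → ℂ` on the real manifold `M`. -/
def SmoothFun (f : M → ℂ) : Prop := ContMDiff 𝓘(ℝ, F) 𝓘(ℝ, ℂ) ∞ f

/-- The fibre `T_x M ⊗ ℂ` of the complexified tangent bundle. -/
abbrev CTangent (x : M) : Type _ := ℂ ⊗[ℝ] TangentSpace 𝓘(ℝ, F) x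

variable {F}

/-- The real part of a complex tangent vector. -/
def rePart {x : M} : CTangent F x →ₗ[ℝ] TangentSpace 𝓘(ℝ, F) x :=
  (TensorProduct.lid ℝ (TangentSpace 𝓘(ℝ, F) x)).toLinearMap ∘ₗ
    Complex.reLm.rTensor (TangentSpace 𝓘(ℝ, F) x)

/-- The imaginary part of a complex tangent vector. -/
def imPart {x : M} : CTangent F x →ₗ[ℝ] TangentSpace 𝓘(ℝ, F) x :=
  (TensorProduct.lid ℝ (TangentSpace 𝓘(ℝ, F) x)).toLinearMap ∘ₗ
    Complex.imLm.rTensor (TangentSpace 𝓘(ℝ, F) x)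

/-- The derivative `v f` of a complex function `f` along a complex tangent vector `v`, that is, the
complex-linear extension of the differential of `f`, evaluated at `v`. -/
def cDeriv (f : M → ℂ) (x : M) : CTangent F x →ₗ[ℂ] ℂ :=
  LinearMap.liftBaseChange ℂ (mvfderiv 𝓘(ℝ, F) f x).toLinearMap

/-- The complex-bilinear extension of the Lie bracket of vector fields to complex vector fields. -/
def cBracket (V W : ∀ x : M, CTangent F x) (x : M) : CTangent F x :=
  (1 : ℂ) ⊗ₜ[ℝ]
      (VectorField.mlieBracket 𝓘(ℝ, F) (fun y => rePart (V y)) (fun y => rePart (W y)) x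
        - VectorField.mlieBracket 𝓘(ℝ, F) (fun y => imPart (V y)) (fun y => imPart (W y)) x)
    + Complex.I ⊗ₜ[ℝ]
      (VectorField.mlieBracket 𝓘(ℝ, F) (fun y => rePart (V y)) (fun y => imPart (W y)) x
        + VectorField.mlieBracket 𝓘(ℝ, F) (fun y => imPart (V y)) (fun y => rePart (W y)) x)

/-- Smooth complex vector fields: the real and the imaginary part are smooth vector fields. -/
def SmoothField [IsManifold 𝓘(ℝ, F) ∞ M] (V : ∀ x : M, CTangent F x) : Prop :=
  ContMDiff 𝓘(ℝ, F) 𝓘(ℝ, F).tangent ∞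
      (fun x => (⟨x, rePart (V x)⟩ : TangentBundle 𝓘(ℝ, F) M)) ∧
    ContMDiff 𝓘(ℝ, F) 𝓘(ℝ, F).tangent ∞
      (fun x => (⟨x, imPart (V x)⟩ : TangentBundle 𝓘(ℝ, F) M))

/-! ## Complex three-forms -/

variable (F M) in
/-- Not necessarily smooth complex-valued three-forms on `M`, as complex-multilinear alternating
forms on the complexified tangent spaces. -/
abbrev ThreeForm : Type _ := ∀ x : M, (CTangent F x) [⋀^Fin 3]→ₗ[ℂ] ℂ

/-- A three-form is smooth if its values on smooth complex vector fields are smooth. -/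
def SmoothThreeForm [IsManifold 𝓘(ℝ, F) ∞ M] (H : ThreeForm F M) : Prop :=
  ∀ V₀ V₁ V₂ : ∀ x : M, CTangent F x, SmoothField V₀ → SmoothField V₁ → SmoothField V₂ →
    SmoothFun F (fun x => H x ![V₀ x, V₁ x, V₂ x])

/-- `d H = 0`, where `d H (V₀, V₁, V₂, V₃)` is given by the invariant formula
`∑ i, (-1)^i V_i (H (..)) + ∑ i < j, (-1)^(i+j) H ([V_i, V_j], ..)`. -/
def ClosedThreeForm [IsManifold 𝓘(ℝ, F) ∞ M] (H : ThreeForm F M) : Prop :=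
  ∀ V₀ V₁ V₂ V₃ : ∀ x : M, CTangent F x,
    SmoothField V₀ → SmoothField V₁ → SmoothField V₂ → SmoothField V₃ → ∀ x : M,
      cDeriv (fun y => H y ![V₁ y, V₂ y, V₃ y]) x (V₀ x)
        - cDeriv (fun y => H y ![V₀ y, V₂ y, V₃ y]) x (V₁ x)
        + cDeriv (fun y => H y ![V₀ y, V₁ y, V₃ y]) x (V₂ x)
        - cDeriv (fun y => H y ![V₀ y, V₁ y, V₂ y]) x (V₃ x)
        - H x ![cBracket V₀ V₁ x, V₂ x, V₃ x]
        + H x ![cBracket V₀ V₂ x, V₁ x, V₃ x]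
        - H x ![cBracket V₀ V₃ x, V₁ x, V₂ x]
        - H x ![cBracket V₁ V₂ x, V₀ x, V₃ x]
        + H x ![cBracket V₁ V₃ x, V₀ x, V₂ x]
        - H x ![cBracket V₂ V₃ x, V₀ x, V₁ x] = 0

/-- The contraction `h (u, v, ·)` of an alternating three-form with two vectors. -/
def contract {V : Type*} [AddCommGroup V] [Module ℂ V] (h : V [⋀^Fin 3]→ₗ[ℂ] ℂ) (u v : V) :
    V →ₗ[ℂ] ℂ :=
  h.toMultilinearMap.toLinearMap ![u, v, 0] 2

theorem contract_apply {V : Type*} [AddCommGroup V] [Module ℂ V] (h : V [⋀^Fin 3]→ₗ[ℂ] ℂ)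
    (u v w : V) : contract h u v w = h ![u, v, w] := by
  have e : Function.update ![u, v, 0] 2 w = ![u, v, w] := by
    ext i; fin_cases i <;> rfl
  change h (Function.update ![u, v, 0] 2 w) = _
  rw [e]

/-! ## Smooth complex vector bundles and complex Courant algebroids -/

variable {E E' : M → Type*} [∀ x, AddCommGroup (E x)] [∀ x, Module ℂ (E x)]
  [∀ x, AddCommGroup (E' x)] [∀ x, Module ℂ (E' x)]

variable (F) in
/-- `Γ` is the space of smooth sections of a smooth complex vector bundle of finite rank over `M`
with fibres `E x`: it is a module over the smooth complex functions, it is determined by a local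
condition, and near every point it is freely generated by finitely many sections that restrict to
bases of the fibres. -/
structure IsVectorBundle (Γ : Set (∀ x, E x)) : Prop where
  zero_mem : (fun _ => 0) ∈ Γ
  add_mem : ∀ s ∈ Γ, ∀ t ∈ Γ, (fun x => s x + t x) ∈ Γ
  smul_mem : ∀ f : M → ℂ, SmoothFun F f → ∀ s ∈ Γ, (fun x => f x • s x) ∈ Γ
  of_local : ∀ s : ∀ x, E x,
    (∀ x₀ : M, ∃ t ∈ Γ, ∃ U ∈ nhds x₀, ∀ x ∈ U, s x = t x) → s ∈ Γ
  exists_frame : ∀ x₀ : M, ∃ (r : ℕ) (e : Fin r → ∀ x, E x), ∃ U ∈ nhds x₀,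
    (∀ i, e i ∈ Γ) ∧
    (∀ x ∈ U, LinearIndependent ℂ (fun i => e i x) ∧
      Submodule.span ℂ (Set.range (fun i => e i x)) = ⊤) ∧
    (∀ s ∈ Γ, ∃ f : Fin r → M → ℂ, (∀ i, SmoothFun F (f i)) ∧
      ∀ x ∈ U, s x = ∑ i, f i x • e i x)

variable (F E) in
/-- The data underlying a complex Courant algebroid: a space of smooth sections, a fibrewise
bilinear form, an anchor map and a Dorfman bracket (only its values on smooth sections matter).
The axioms are collected in `IsCourantAlgebroid`. -/
structure CourantData where
  Γ : Set (∀ x, E x)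
  pairing : ∀ x, E x →ₗ[ℂ] E x →ₗ[ℂ] ℂ
  anchor : ∀ x, E x →ₗ[ℂ] CTangent F x
  bracket : (∀ x, E x) → (∀ x, E x) → (∀ x, E x)

namespace CourantData

/-- The function `⟨φ, ψ⟩`. -/
def ip (C : CourantData F E) (φ ψ : ∀ x, E x) (x : M) : ℂ := C.pairing x (φ x) (ψ x)

/-- The function `ρ(φ) f`. -/
def act (C : CourantData F E) (φ : ∀ x, E x) (f : M → ℂ) (x : M) : ℂ :=
  cDeriv f x (C.anchor x (φ x))

/-- The section `s` determined by `⟨s, ψ⟩ = L ψ` for all smooth sections `ψ`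
(for a functional `L` that is linear over the smooth functions). -/
def represent (C : CourantData F E) (L : (∀ x, E x) → M → ℂ) (x : M) : E x :=
  Classical.epsilon (fun v : E x => ∀ ψ ∈ C.Γ, C.pairing x v (ψ x) = L ψ x)

/-- The section `𝒟 f`, determined by `⟨𝒟 f, φ⟩ = ρ(φ) f`. -/
def D (C : CourantData F E) (f : M → ℂ) : ∀ x, E x := C.represent (fun φ => C.act φ f)

end CourantData

/-- The axioms of a complex Courant algebroid over `M`. -/
structure IsCourantAlgebroid [IsManifold 𝓘(ℝ, F) ∞ M] (C : CourantData F E) : Prop where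
  bundle : IsVectorBundle F C.Γ
  pairing_symm : ∀ x (u v : E x), C.pairing x u v = C.pairing x v u
  pairing_nondegenerate : ∀ x (u : E x), (∀ v, C.pairing x u v = 0) → u = 0
  pairing_smooth : ∀ φ ∈ C.Γ, ∀ ψ ∈ C.Γ, SmoothFun F (C.ip φ ψ)
  anchor_smooth : ∀ φ ∈ C.Γ, SmoothField (fun x => C.anchor x (φ x))
  bracket_mem : ∀ φ ∈ C.Γ, ∀ ψ ∈ C.Γ, C.bracket φ ψ ∈ C.Γ
  bracket_add_left : ∀ φ₁ ∈ C.Γ, ∀ φ₂ ∈ C.Γ, ∀ ψ ∈ C.Γ, ∀ x,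
    C.bracket (fun y => φ₁ y + φ₂ y) ψ x = C.bracket φ₁ ψ x + C.bracket φ₂ ψ x
  bracket_smul_left : ∀ c : ℂ, ∀ φ ∈ C.Γ, ∀ ψ ∈ C.Γ, ∀ x,
    C.bracket (fun y => c • φ y) ψ x = c • C.bracket φ ψ x
  bracket_add_right : ∀ φ ∈ C.Γ, ∀ ψ₁ ∈ C.Γ, ∀ ψ₂ ∈ C.Γ, ∀ x,
    C.bracket φ (fun y => ψ₁ y + ψ₂ y) x = C.bracket φ ψ₁ x + C.bracket φ ψ₂ x
  bracket_smul_right : ∀ c : ℂ, ∀ φ ∈ C.Γ, ∀ ψ ∈ C.Γ, ∀ x,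
    C.bracket φ (fun y => c • ψ y) x = c • C.bracket φ ψ x
  jacobi : ∀ φ ∈ C.Γ, ∀ φ₁ ∈ C.Γ, ∀ φ₂ ∈ C.Γ, ∀ x,
    C.bracket φ (C.bracket φ₁ φ₂) x
      = C.bracket φ₁ (C.bracket φ φ₂) x + C.bracket (C.bracket φ φ₁) φ₂ x
  leibniz : ∀ φ ∈ C.Γ, ∀ ψ ∈ C.Γ, ∀ f : M → ℂ, SmoothFun F f → ∀ x,
    C.bracket φ (fun y => f y • ψ y) x = C.act φ f x • ψ x + f x • C.bracket φ ψ x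
  bracket_self : ∀ φ ∈ C.Γ, ∀ x, C.bracket φ φ x = (1 / 2 : ℂ) • C.D (C.ip φ φ) x
  ad_invariant : ∀ φ ∈ C.Γ, ∀ ψ ∈ C.Γ, ∀ x,
    C.act φ (C.ip ψ ψ) x = 2 * C.ip (C.bracket φ ψ) ψ x

/-- Isomorphism of complex Courant algebroids over the identity of `M`: an isomorphism of smooth
complex vector bundles that preserves the pairing, the anchor and the Dorfman bracket. -/
def CourantIsomorphic (C : CourantData F E) (C' : CourantData F E') : Prop :=
  ∃ Φ : ∀ x, E x ≃ₗ[ℂ] E' x,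
    (∀ φ : ∀ x, E x, φ ∈ C.Γ ↔ (fun x => Φ x (φ x)) ∈ C'.Γ) ∧
    (∀ x (u v : E x), C'.pairing x (Φ x u) (Φ x v) = C.pairing x u v) ∧
    (∀ x (u : E x), C'.anchor x (Φ x u) = C.anchor x u) ∧
    (∀ φ ∈ C.Γ, ∀ ψ ∈ C.Γ, ∀ x,
      C'.bracket (fun y => Φ y (φ y)) (fun y => Φ y (ψ y)) x = Φ x (C.bracket φ ψ x))

/-! ## Connections and matched pairs -/

/-- `n` is a connection on the bundle of `C'` along the anchored bundle of `C`; here `n a v` is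
`∇_a v`. -/
structure IsConnection (C : CourantData F E) (C' : CourantData F E')
    (n : (∀ x, E x) → (∀ x, E' x) → (∀ x, E' x)) : Prop where
  mem : ∀ a ∈ C.Γ, ∀ v ∈ C'.Γ, n a v ∈ C'.Γ
  add_left : ∀ a ∈ C.Γ, ∀ b ∈ C.Γ, ∀ v ∈ C'.Γ, ∀ x, n (fun y => a y + b y) v x = n a v x + n b v x
  add_right : ∀ a ∈ C.Γ, ∀ v ∈ C'.Γ, ∀ w ∈ C'.Γ, ∀ x,
    n a (fun y => v y + w y) x = n a v x + n a w x
  smul_left : ∀ f : M → ℂ, SmoothFun F f → ∀ a ∈ C.Γ, ∀ v ∈ C'.Γ, ∀ x,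
    n (fun y => f y • a y) v x = f x • n a v x
  leibniz : ∀ f : M → ℂ, SmoothFun F f → ∀ a ∈ C.Γ, ∀ v ∈ C'.Γ, ∀ x,
    n a (fun y => f y • v y) x = C.act a f x • v x + f x • n a v x

/-- The connection `n` on the bundle of `C'` preserves the metric of `C'`. -/
def IsMetric (C : CourantData F E) (C' : CourantData F E')
    (n : (∀ x, E x) → (∀ x, E' x) → (∀ x, E' x)) : Prop :=
  ∀ a ∈ C.Γ, ∀ v ∈ C'.Γ, ∀ w ∈ C'.Γ, ∀ x,
    C.act a (C'.ip v w) x = C'.ip (n a v) w x + C'.ip v (n a w) x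

/-- For a connection `n` along `C` on the bundle of `C'`, the section `Ω(v, w)` of the bundle of
`C`, determined by `⟨c, Ω(v, w)⟩ = (⟨∇_c v, w⟩ - ⟨v, ∇_c w⟩) / 2`. -/
def skewPart (C : CourantData F E) (C' : CourantData F E')
    (n : (∀ x, E x) → (∀ x, E' x) → (∀ x, E' x)) (v w : ∀ x, E' x) : ∀ x, E x :=
  C.represent (fun c x => (1 / 2 : ℂ) * (C'.ip (n c v) w x - C'.ip v (n c w) x))

/-- The curvature `∇_a ∇_b v - ∇_b ∇_a v - ∇_{a ⋄ b} v`. -/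
def curvature (C : CourantData F E)
    (n : (∀ x, E x) → (∀ x, E' x) → (∀ x, E' x)) (a b : ∀ x, E x) (v : ∀ x, E' x) :
    ∀ x, E' x :=
  fun x => n a (n b v) x - n b (n a v) x - n (C.bracket a b) v x

/-- The compatibility of the connections `n` (along `C` on the bundle of `C'`) and `m` (along `C'`
on the bundle of `C`) with the bracket of `C'`:
`∇_a (α₁ ⋄ α₂) - (∇_a α₁) ⋄ α₂ - α₁ ⋄ (∇_a α₂) - ∇_{∇_{α₂} a} α₁ + ∇_{∇_{α₁} a} α₂`
`= - Ω(a, B) - 𝒟 ⟨a, B⟩ / 2`, where `B = ℧(α₁, α₂) + 𝒟 ⟨α₁, α₂⟩ / 2`. -/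
def BracketCompatible (C : CourantData F E) (C' : CourantData F E')
    (n : (∀ x, E x) → (∀ x, E' x) → (∀ x, E' x))
    (m : (∀ x, E' x) → (∀ x, E x) → (∀ x, E x)) : Prop :=
  ∀ a ∈ C.Γ, ∀ α₁ ∈ C'.Γ, ∀ α₂ ∈ C'.Γ, ∀ B : ∀ x, E x,
    (∀ x, B x = skewPart C C' n α₁ α₂ x + (1 / 2 : ℂ) • C.D (C'.ip α₁ α₂) x) → ∀ x,
    n a (C'.bracket α₁ α₂) x - C'.bracket (n a α₁) α₂ x - C'.bracket α₁ (n a α₂) x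
        - n (m α₂ a) α₁ x + n (m α₁ a) α₂ x
      = - skewPart C' C m a B x - (1 / 2 : ℂ) • C'.D (C.ip a B) x

/-- `C₁` and `C₂` are complex Courant algebroids that form a matched pair with respect to the
connections `r` (along `C₁` on the bundle of `C₂`) and `l` (along `C₂` on the bundle of `C₁`). -/
structure IsMatchedPair [IsManifold 𝓘(ℝ, F) ∞ M] (C₁ : CourantData F E) (C₂ : CourantData F E')
    (r : (∀ x, E x) → (∀ x, E' x) → (∀ x, E' x))
    (l : (∀ x, E' x) → (∀ x, E x) → (∀ x, E x)) : Prop where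
  courant₁ : IsCourantAlgebroid C₁
  courant₂ : IsCourantAlgebroid C₂
  connection_r : IsConnection C₁ C₂ r
  connection_l : IsConnection C₂ C₁ l
  metric_r : IsMetric C₁ C₂ r
  metric_l : IsMetric C₂ C₁ l
  r_D : ∀ f : M → ℂ, SmoothFun F f → ∀ β ∈ C₂.Γ, ∀ x, r (C₁.D f) β x = 0
  l_D : ∀ f : M → ℂ, SmoothFun F f → ∀ b ∈ C₁.Γ, ∀ x, l (C₂.D f) b x = 0
  bracket_l : BracketCompatible C₂ C₁ l r
  bracket_r : BracketCompatible C₁ C₂ r l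
  /-- The sum of the two curvatures, as sections of `∧² E₁* ⊗ ∧² E₂*`, vanishes. -/
  curvature : ∀ a ∈ C₁.Γ, ∀ b ∈ C₁.Γ, ∀ α ∈ C₂.Γ, ∀ β ∈ C₂.Γ, ∀ x,
    C₂.ip (curvature C₁ r a b α) β x + C₁.ip (curvature C₂ l α β a) b x = 0
  cyclic_l : ∀ a₁ ∈ C₁.Γ, ∀ a₂ ∈ C₁.Γ, ∀ a₃ ∈ C₁.Γ, ∀ x,
    l (skewPart C₂ C₁ l a₁ a₂) a₃ x + l (skewPart C₂ C₁ l a₂ a₃) a₁ x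
      + l (skewPart C₂ C₁ l a₃ a₁) a₂ x = 0
  cyclic_r : ∀ α₁ ∈ C₂.Γ, ∀ α₂ ∈ C₂.Γ, ∀ α₃ ∈ C₂.Γ, ∀ x,
    r (skewPart C₁ C₂ r α₁ α₂) α₃ x + r (skewPart C₁ C₂ r α₂ α₃) α₁ x
      + r (skewPart C₁ C₂ r α₃ α₁) α₂ x = 0

/-- The matched sum: the direct sum bundle with the sum pairing, the sum anchor and the bracket
`(a ⊕ α) ⋄ (b ⊕ β) = (a ⋄ b + ∇_α b - ∇_β a + ℧(α, β) + 𝒟₁ ⟨α, β⟩ / 2)`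
`⊕ (α ⋄ β + ∇_a β - ∇_b α + Ω(a, b) + 𝒟₂ ⟨a, b⟩ / 2)`. -/
def matchedSum (C₁ : CourantData F E) (C₂ : CourantData F E')
    (r : (∀ x, E x) → (∀ x, E' x) → (∀ x, E' x))
    (l : (∀ x, E' x) → (∀ x, E x) → (∀ x, E x)) :
    CourantData F (fun x => E x × E' x) where
  Γ := {φ | (fun x => (φ x).1) ∈ C₁.Γ ∧ (fun x => (φ x).2) ∈ C₂.Γ}
  pairing x :=
    (C₁.pairing x).compl₁₂ (LinearMap.fst ℂ (E x) (E' x)) (LinearMap.fst ℂ (E x) (E' x))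
      + (C₂.pairing x).compl₁₂ (LinearMap.snd ℂ (E x) (E' x)) (LinearMap.snd ℂ (E x) (E' x))
  anchor x := (C₁.anchor x).coprod (C₂.anchor x)
  bracket φ ψ :=
    let a := fun x => (φ x).1
    let α := fun x => (φ x).2
    let b := fun x => (ψ x).1
    let β := fun x => (ψ x).2
    fun x =>
      (C₁.bracket a b x + l α b x - l β a x + skewPart C₁ C₂ r α β x
          + (1 / 2 : ℂ) • C₁.D (C₂.ip α β) x,
        C₂.bracket α β x + r a β x - r b α x + skewPart C₂ C₁ l a b x
          + (1 / 2 : ℂ) • C₂.D (C₁.ip a b) x)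

/-! ## Twisted Courant structures on `A ⊕ A*` -/

variable {A B : M → Type*} [∀ x, AddCommGroup (A x)] [∀ x, Module ℂ (A x)]
  [∀ x, AddCommGroup (B x)] [∀ x, Module ℂ (B x)]

variable (F A) in
/-- A direct summand of the complexified tangent bundle, given by its inclusion and projection. -/
structure TangentSummand where
  incl : ∀ x, A x →ₗ[ℂ] CTangent F x
  proj : ∀ x, CTangent F x →ₗ[ℂ] A x
  proj_incl : ∀ x (v : A x), proj x (incl x v) = v

namespace TangentSummand

/-- The complex vector field underlying a section. -/
def toField (S : TangentSummand F A) (V : ∀ x, A x) : ∀ x : M, CTangent F x := fun x => S.incl x (V x)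

/-- Smooth sections of `A`. -/
def SmoothSection [IsManifold 𝓘(ℝ, F) ∞ M] (S : TangentSummand F A) (V : ∀ x, A x) : Prop :=
  SmoothField (S.toField V)

/-- Smooth sections of `A*`: those with smooth values on the smooth sections of `A`. -/
def SmoothDual [IsManifold 𝓘(ℝ, F) ∞ M] (S : TangentSummand F A)
    (α : ∀ x, Module.Dual ℂ (A x)) : Prop :=
  ∀ V : ∀ x, A x, S.SmoothSection V → SmoothFun F (fun x => α x (V x))

/-- The Lie bracket of sections of `A`. If `A` is involutive, the projection does nothing. -/
def lie (S : TangentSummand F A) (V W : ∀ x, A x) (x : M) : A x :=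
  S.proj x (cBracket (S.toField V) (S.toField W) x)

/-- The section `η` of `A*` determined by `η(W) = L W` for all smooth sections `W` of `A`
(for a functional `L` that is linear over the smooth functions). -/
def formOf [IsManifold 𝓘(ℝ, F) ∞ M] (S : TangentSummand F A) (L : (∀ x, A x) → M → ℂ) (x : M) :
    Module.Dual ℂ (A x) :=
  Classical.epsilon (fun η : Module.Dual ℂ (A x) =>
    ∀ W : ∀ x, A x, S.SmoothSection W → η (W x) = L W x)

/-- The Lie derivative `ℒ_V β`, determined by `(ℒ_V β)(W) = V (β(W)) - β([V, W])`. -/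
def lieDeriv [IsManifold 𝓘(ℝ, F) ∞ M] (S : TangentSummand F A) (V : ∀ x, A x)
    (β : ∀ x, Module.Dual ℂ (A x)) : ∀ x, Module.Dual ℂ (A x) :=
  S.formOf (fun W x => cDeriv (fun y => β y (W y)) x (S.incl x (V x)) - β x (S.lie V W x))

/-- The contraction `ι_V d α`, determined by
`(dα)(V, W) = V (α(W)) - W (α(V)) - α([V, W])`. -/
def contrD [IsManifold 𝓘(ℝ, F) ∞ M] (S : TangentSummand F A) (V : ∀ x, A x)
    (α : ∀ x, Module.Dual ℂ (A x)) : ∀ x, Module.Dual ℂ (A x) :=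
  S.formOf (fun W x => cDeriv (fun y => α y (W y)) x (S.incl x (V x))
    - cDeriv (fun y => α y (V y)) x (S.incl x (W x)) - α x (S.lie V W x))

end TangentSummand

/-- The Courant structure on `A ⊕ A*` twisted by the three-form `h` on `A`:
pairing `⟨X ⊕ α, Y ⊕ β⟩ = α(Y) + β(X)`, anchor `X ⊕ α ↦ X`, and bracket
`(X ⊕ α) ⋄ (Y ⊕ β) = [X, Y] ⊕ (ℒ_X β - ι_Y d α + h(X, Y, ·))`. -/
def twistedCourant [IsManifold 𝓘(ℝ, F) ∞ M] (S : TangentSummand F A)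
    (h : ∀ x, (A x) [⋀^Fin 3]→ₗ[ℂ] ℂ) :
    CourantData F (fun x => A x × Module.Dual ℂ (A x)) where
  Γ := {φ | S.SmoothSection (fun x => (φ x).1) ∧ S.SmoothDual (fun x => (φ x).2)}
  pairing x := LinearMap.mk₂ ℂ (fun u v => u.2 v.1 + v.2 u.1)
    (fun u u' v => by simp; ring) (fun c u v => by simp; ring)
    (fun u v v' => by simp; ring) (fun c u v => by simp; ring)
  anchor x := S.incl x ∘ₗ LinearMap.fst ℂ (A x) (Module.Dual ℂ (A x))
  bracket φ ψ :=
    let X := fun x => (φ x).1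
    let α := fun x => (φ x).2
    let Y := fun x => (ψ x).1
    let β := fun x => (ψ x).2
    fun x => (S.lie X Y x, S.lieDeriv X β x - S.contrD Y α x + contract (h x) (X x) (Y x))

variable (F M) in
/-- The complexified tangent bundle as a summand of itself. -/
def wholeTangent : TangentSummand F (fun x : M => CTangent F x) where
  incl _ := LinearMap.id
  proj _ := LinearMap.id
  proj_incl _ _ := rfl

/-- The operator `∇_{X ⊕ α} (Y ⊕ β) = ∇ᵒ_X Y ⊕ (∇ᵒ_X β + η(X, Y, ·))`, for `X ⊕ α` in `A ⊕ A*` and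
`Y ⊕ β` in `B ⊕ B*`, where `∇ᵒ_X Y = pr_B [X, Y]` and `∇ᵒ_X β = pr_{B*} (ℒ_X β)`. Sections of `B*`
are regarded as one-forms by composing them with the projection to `B`, and `pr_{B*}` is the
restriction of one-forms to `B`. -/
def pairConnection [IsManifold 𝓘(ℝ, F) ∞ M] (S : TangentSummand F A) (T : TangentSummand F B)
    (η : ThreeForm F M) (a : ∀ x, A x × Module.Dual ℂ (A x))
    (b : ∀ x, B x × Module.Dual ℂ (B x)) : ∀ x, B x × Module.Dual ℂ (B x) :=
  let X := S.toField (fun x => (a x).1)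
  let Y := T.toField (fun x => (b x).1)
  fun x =>
    (T.proj x (cBracket X Y x),
      ((wholeTangent F M).lieDeriv X (fun y => (b y).2 ∘ₗ T.proj y) x
        + contract (η x) (X x) (Y x)) ∘ₗ T.incl x)

end Manifold

/-! ## Complex manifolds -/

section Complex

variable (V : Type*) [NormedAddCommGroup V] [NormedSpace ℂ V]
  {X : Type*} [TopologicalSpace X] [ChartedSpace V X]

/-- A complex manifold is in particular a smooth real manifold. -/
instance isManifold_real [IsManifold 𝓘(ℂ, V) ω X] : IsManifold 𝓘(ℝ, V) ∞ X := by
  apply isManifold_of_contDiffOn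
  intro e e' he he'
  have h := (contDiffGroupoid ω 𝓘(ℂ, V)).compatible he he'
  rw [contDiffGroupoid, mem_groupoid_of_pregroupoid] at h
  exact (ContDiffOn.restrict_scalars ℝ h.1).of_le le_top

/-- The almost complex structure of `X` on a tangent space. The tangent space is identified with the
model space `V` by the preferred chart at `x`; since the changes of charts are holomorphic, any other
chart around `x` gives the same operator. -/
def almostComplex (x : X) : TangentSpace 𝓘(ℝ, V) x →ₗ[ℝ] TangentSpace 𝓘(ℝ, V) x :=
  (LinearMap.lsmul ℂ V Complex.I).restrictScalars ℝ

/-- The complex-linear extension of the almost complex structure. -/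
def almostComplexC (x : X) : CTangent V x →ₗ[ℂ] CTangent V x :=
  (almostComplex V x).baseChange ℂ

variable {V} in
theorem almostComplexC_sq (x : X) (v : CTangent V x) :
    almostComplexC V x (almostComplexC V x v) = -v := by
  have h : almostComplex V x ∘ₗ almostComplex V x = -LinearMap.id := by
    ext w
    change Complex.I • Complex.I • (show V from w) = -(show V from w)
    rw [smul_smul, Complex.I_mul_I, neg_one_smul]
  have h2 : almostComplexC V x ∘ₗ almostComplexC V x = -LinearMap.id := by
    rw [almostComplexC, ← LinearMap.baseChange_comp, h, LinearMap.baseChange_neg,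
      LinearMap.baseChange_id]
  exact LinearMap.congr_fun h2 v

/-- `T^{1,0}`, the eigenspace of the almost complex structure for `i`. -/
def T10 (x : X) : Submodule ℂ (CTangent V x) :=
  LinearMap.ker (almostComplexC V x - Complex.I • LinearMap.id)

/-- `T^{0,1}`, the eigenspace of the almost complex structure for `-i`. -/
def T01 (x : X) : Submodule ℂ (CTangent V x) :=
  LinearMap.ker (almostComplexC V x + Complex.I • LinearMap.id)

variable (X) in
/-- `T^{1,0}` with its canonical projection `v ↦ (v - i j v) / 2`. -/
def tangent10 : TangentSummand V (fun x : X => T10 V x) where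
  incl x := (T10 V x).subtype
  proj x := LinearMap.codRestrict (T10 V x)
    ((1 / 2 : ℂ) • (LinearMap.id - Complex.I • almostComplexC V x)) (fun v => by
      simp only [T10, LinearMap.mem_ker, LinearMap.sub_apply, LinearMap.smul_apply,
        LinearMap.id_apply, map_smul, map_sub, almostComplexC_sq]
      match_scalars <;> (ring_nf; try simp))
  proj_incl x v := by
    obtain ⟨v, hv⟩ := v
    have h : almostComplexC V x v = Complex.I • v := by
      simpa [T10, sub_eq_zero] using hv
    ext
    simp only [LinearMap.codRestrict_apply, Submodule.subtype_apply, LinearMap.sub_apply,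
      LinearMap.smul_apply, LinearMap.id_apply, h]
    match_scalars
    linear_combination (-1 / 2 : ℂ) * Complex.I_mul_I

variable (X) in
/-- `T^{0,1}` with its canonical projection `v ↦ (v + i j v) / 2`. -/
def tangent01 : TangentSummand V (fun x : X => T01 V x) where
  incl x := (T01 V x).subtype
  proj x := LinearMap.codRestrict (T01 V x)
    ((1 / 2 : ℂ) • (LinearMap.id + Complex.I • almostComplexC V x)) (fun v => by
      simp only [T01, LinearMap.mem_ker, LinearMap.add_apply, LinearMap.smul_apply,
        LinearMap.id_apply, map_smul, map_add, almostComplexC_sq]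
      match_scalars <;> (ring_nf; try simp))
  proj_incl x v := by
    obtain ⟨v, hv⟩ := v
    have h : almostComplexC V x v = -(Complex.I • v) := by
      simpa [T01, add_eq_zero_iff_eq_neg] using hv
    ext
    simp only [LinearMap.codRestrict_apply, Submodule.subtype_apply, LinearMap.add_apply,
      LinearMap.smul_apply, LinearMap.id_apply, h]
    match_scalars
    linear_combination (-1 / 2 : ℂ) * Complex.I_mul_I

variable {V} in
/-- A three-form is of type `(p, q)` if it vanishes on all triples of vectors from `T^{1,0}` and
`T^{0,1}` that do not consist of `p` vectors from `T^{1,0}` and `q` vectors from `T^{0,1}`. -/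
def IsOfType (p q : ℕ) (η : ThreeForm V X) : Prop :=
  ∀ (x : X) (s : Finset (Fin 3)) (v : Fin 3 → CTangent V x),
    (∀ i ∈ s, v i ∈ T10 V x) → (∀ i ∉ s, v i ∈ T01 V x) →
    ¬ (s.card = p ∧ sᶜ.card = q) → η x v = 0

variable {V} in
/-- `(C^{1,0}_X)_h`: the bundle `T^{1,0} ⊕ (T^{1,0})*` with the Courant structure twisted by the
restriction of `h` to `T^{1,0}`. -/
def courant10 [IsManifold 𝓘(ℂ, V) ω X] (h : ThreeForm V X) :
    CourantData V (fun x : X => T10 V x × Module.Dual ℂ (T10 V x)) :=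
  twistedCourant (tangent10 V X) (fun x => (h x).compLinearMap ((tangent10 V X).incl x))

variable {V} in
/-- `(C^{0,1}_X)_h`: the bundle `T^{0,1} ⊕ (T^{0,1})*` with the Courant structure twisted by the
restriction of `h` to `T^{0,1}`. -/
def courant01 [IsManifold 𝓘(ℂ, V) ω X] (h : ThreeForm V X) :
    CourantData V (fun x : X => T01 V x × Module.Dual ℂ (T01 V x)) :=
  twistedCourant (tangent01 V X) (fun x => (h x).compLinearMap ((tangent01 V X).incl x))

variable {V} in
/-- The standard complex Courant algebroid `(T_X ⊕ T_X*) ⊗ ℂ` twisted by `H`; the bundle `T_X* ⊗ ℂ`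
is identified with the complex dual of `T_X ⊗ ℂ`. -/
def standardCourant [IsManifold 𝓘(ℂ, V) ω X] (H : ThreeForm V X) :
    CourantData V (fun x : X => CTangent V x × Module.Dual ℂ (CTangent V x)) :=
  twistedCourant (wholeTangent V X) H

variable {V} in
/-- `∇_{X ⊕ α} (Y ⊕ β) = ∇ᵒ_X Y ⊕ (∇ᵒ_X β + η(X, Y, ·))` for `X ⊕ α` in `C^{1,0}_X` and `Y ⊕ β` in
`C^{0,1}_X`. -/
def rightConnection [IsManifold 𝓘(ℂ, V) ω X] (η : ThreeForm V X) :
    (∀ x : X, T10 V x × Module.Dual ℂ (T10 V x)) →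
    (∀ x : X, T01 V x × Module.Dual ℂ (T01 V x)) →
    (∀ x : X, T01 V x × Module.Dual ℂ (T01 V x)) :=
  pairConnection (tangent10 V X) (tangent01 V X) η

variable {V} in
/-- `∇_{Y ⊕ β} (X ⊕ α) = ∇ᵒ_Y X ⊕ (∇ᵒ_Y α + η(Y, X, ·))` for `Y ⊕ β` in `C^{0,1}_X` and `X ⊕ α` in
`C^{1,0}_X`. -/
def leftConnection [IsManifold 𝓘(ℂ, V) ω X] (η : ThreeForm V X) :
    (∀ x : X, T01 V x × Module.Dual ℂ (T01 V x)) →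
    (∀ x : X, T10 V x × Module.Dual ℂ (T10 V x)) →
    (∀ x : X, T10 V x × Module.Dual ℂ (T10 V x)) :=
  pairConnection (tangent01 V X) (tangent10 V X) η

end Complex

end CourantPair

end

namespace CourantPair

/-! The matched pair is not verified identity by identity. It is found inside the standard algebroid
`(T ⊕ T*) ⊗ ℂ` twisted by `H`, whose axioms are comparatively easy to check. Since `T ⊗ ℂ = T10 ⊕
T01` and forms of type (1,0) annihilate `T01`, the bundle is an orthogonal sum of `T10 ⊕ T10*` and
`T01 ⊕ T01*`. Projecting the twisted Dorfman bracket to these summands gives the brackets of the two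
smaller algebroids and, for sections of different summands, the two connections; each projection
sees exactly one of the components of `H` (`IsComplementary.isSplitting`). The remaining components
of the bracket, those of two sections of one summand in the other summand, are forced by duality:
for `α, β` in one summand and `c` in the other, `⟨α ⋄ β, c⟩ = -⟨β, α ⋄ c⟩ = ⟨β, c ⋄ α⟩ = ⟨∇_c α,
β⟩`. For metric connections this is also what `℧ + 𝒟⟨ , ⟩/2` pairs to (`pairing_mixedPart`), so the
whole bracket is that of the matched sum (`IsSplitting.isomorphic`).

The matched sum inherits its axioms through this isomorphism (`IsCourantAlgebroid.of_isomorphic`),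
and the matched pair identities are components of its Jacobi identity: the triple `α, a₁, a₂` gives
the bracket compatibility, `a₁, a₂, a₃` the cyclic identity, and `a, b, α` paired with `β` the
curvature identity (`IsMatchedPair.of_matchedSum`). The conditions on `𝒟 f` hold because `𝒟 f` has
no tangent part and the connections see only that part of the direction.

That `A ⊕ A*` with a twist is a Courant algebroid is Cartan calculus for an involutive subbundle
`A`, and closedness of the twist is what the Jacobi identity needs (`formBracket_jacobi`). The
restrictions of `H30` and `H03` are closed because they are restrictions of `H` and the eigenbundles
are involutive. For involutivity, and for the existence of smooth frames, the almost complex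
structure is constant in holomorphic charts (`continuousLinearMapAt_smul_I`). Identities between
complex vector fields are checked by letting both sides act on smooth functions, which separate
tangent vectors (`cTangent_ext_cDeriv`). -/

theorem two_le_infty : (2 : WithTop ℕ∞) ≤ ∞ :=
  WithTop.coe_le_coe.2 (le_top : (2 : ℕ∞) ≤ ⊤)

/-! ### Derivatives and Lie brackets of real vector fields in charts -/

section RealCalculus

variable {F : Type*} [NormedAddCommGroup F] [NormedSpace ℝ F]
  {M : Type*} [TopologicalSpace M] [ChartedSpace F M] [IsManifold 𝓘(ℝ, F) ∞ M]
  {G : Type*} [NormedAddCommGroup G] [NormedSpace ℝ G]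

theorem isManifold_of_le_infty {n : WithTop ℕ∞} (h : n ≤ ∞) : IsManifold 𝓘(ℝ, F) n M :=
  IsManifold.of_le h

instance isManifold_one : IsManifold 𝓘(ℝ, F) 1 M := isManifold_of_le_infty (by simp)

instance isManifold_minSmoothness_two : IsManifold 𝓘(ℝ, F) (minSmoothness ℝ 2) M :=
  isManifold_of_le_infty (by simpa using two_le_infty)

omit [IsManifold 𝓘(ℝ, F) ∞ M] in
-- No differential of the chart enters: the tangent space at `x` is the model space by means of the
-- preferred chart at `x` itself.
theorem mvfderiv_eq_fderiv {f : M → G} {x : M} (hf : MDifferentiableAt 𝓘(ℝ, F) 𝓘(ℝ, G) f x)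
    (v : TangentSpace 𝓘(ℝ, F) x) :
    mvfderiv 𝓘(ℝ, F) f x v
      = fderiv ℝ (f ∘ (extChartAt 𝓘(ℝ, F) x).symm) (extChartAt 𝓘(ℝ, F) x x) v := by
  rw [hf.mvfderiv]
  simp [fderivWithin_univ]
  rfl

/-- The chart formula for the derivative of a function along a tangent vector. -/
theorem mvfderiv_eq_fderiv_chart {f : M → G} {x y : M}
    (hf : ContMDiffAt 𝓘(ℝ, F) 𝓘(ℝ, G) 1 f y) (hy : y ∈ (extChartAt 𝓘(ℝ, F) x).source)
    (v : TangentSpace 𝓘(ℝ, F) y) :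
    mvfderiv 𝓘(ℝ, F) f y v
      = fderiv ℝ (f ∘ (extChartAt 𝓘(ℝ, F) x).symm) (extChartAt 𝓘(ℝ, F) x y)
          (mfderiv 𝓘(ℝ, F) 𝓘(ℝ, F) (extChartAt 𝓘(ℝ, F) x) y v) := by
  set φ := extChartAt 𝓘(ℝ, F) x
  have hy' : y ∈ (chartAt F x).source := by simpa [φ] using hy
  have e : f =ᶠ[nhds y] (f ∘ φ.symm) ∘ φ := by
    filter_upwards [(isOpen_extChartAt_source (I := 𝓘(ℝ, F)) x).mem_nhds hy] with z hz
    simp only [Function.comp_apply, φ, (extChartAt 𝓘(ℝ, F) x).left_inv hz]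
  have hsymm : ContMDiffAt 𝓘(ℝ, F) 𝓘(ℝ, F) 1 φ.symm (φ y) := by
    have := contMDiffOn_extChartAt_symm (I := 𝓘(ℝ, F)) (n := 1) x
    exact this.contMDiffAt ((isOpen_extChartAt_target (I := 𝓘(ℝ, F)) x).mem_nhds (φ.map_source hy))
  have hg : ContMDiffAt 𝓘(ℝ, F) 𝓘(ℝ, G) 1 (f ∘ φ.symm) (φ y) := by
    apply ContMDiffAt.comp _ _ hsymm
    rw [φ.left_inv hy]; exact hf
  have hgd : DifferentiableAt ℝ (f ∘ φ.symm) (φ y) :=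
    (contMDiffAt_iff_contDiffAt.1 hg).differentiableAt one_ne_zero
  have h1 : mfderiv 𝓘(ℝ, F) 𝓘(ℝ, G) f y
      = (mfderiv 𝓘(ℝ, F) 𝓘(ℝ, G) (f ∘ φ.symm) (φ y)).comp
        (mfderiv 𝓘(ℝ, F) 𝓘(ℝ, F) φ y) := by
    rw [← mfderiv_comp y hgd.mdifferentiableAt (mdifferentiableAt_extChartAt hy')]
    exact e.mfderiv_eq
  change mfderiv 𝓘(ℝ, F) 𝓘(ℝ, G) f y v = _
  rw [h1, mfderiv_eq_fderiv]
  rfl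

/-- The function is the fibre coordinate of the tangent map of `f` composed with the section `V`. -/
theorem contMDiff_mvfderiv_apply {f : M → G} (hf : ContMDiff 𝓘(ℝ, F) 𝓘(ℝ, G) ∞ f)
    {V : ∀ x : M, TangentSpace 𝓘(ℝ, F) x}
    (hV : ContMDiff 𝓘(ℝ, F) 𝓘(ℝ, F).tangent ∞ (fun x => (⟨x, V x⟩ : TangentBundle 𝓘(ℝ, F) M))) :
    ContMDiff 𝓘(ℝ, F) 𝓘(ℝ, G) ∞ (fun x => mvfderiv 𝓘(ℝ, F) f x (V x)) := by
  have h := (hf.contMDiff_tangentMap (m := ∞) (by simp)).comp hV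
  exact (contMDiff_snd_tangentBundle_modelSpace G 𝓘(ℝ, G)).comp h

theorem contMDiff_mlieBracket [CompleteSpace F] {V W : ∀ x : M, TangentSpace 𝓘(ℝ, F) x}
    (hV : ContMDiff 𝓘(ℝ, F) 𝓘(ℝ, F).tangent ∞ (fun x => (⟨x, V x⟩ : TangentBundle 𝓘(ℝ, F) M)))
    (hW : ContMDiff 𝓘(ℝ, F) 𝓘(ℝ, F).tangent ∞ (fun x => (⟨x, W x⟩ : TangentBundle 𝓘(ℝ, F) M))) :
    ContMDiff 𝓘(ℝ, F) 𝓘(ℝ, F).tangent ∞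
      (fun x => (⟨x, VectorField.mlieBracket 𝓘(ℝ, F) V W x⟩ : TangentBundle 𝓘(ℝ, F) M)) := by
  have : IsManifold 𝓘(ℝ, F) (((⊤ : ℕ∞) : WithTop ℕ∞) + 1) M := by simpa
  exact ContDiff.mlieBracket_vectorField (m := ⊤) (n := ⊤) hV hW (by simp)

/-- A vector field read in a chart. -/
noncomputable def chartField (V : ∀ x : M, TangentSpace 𝓘(ℝ, F) x) (x : M) : F → F :=
  VectorField.mpullbackWithin 𝓘(ℝ, F) 𝓘(ℝ, F) (extChartAt 𝓘(ℝ, F) x).symm V Set.univ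

/-- The pullback uses the inverse of the derivative of the inverse chart, and this is the derivative
of the chart. -/
theorem chartField_apply (V : ∀ x : M, TangentSpace 𝓘(ℝ, F) x) {x y : M}
    (hy : y ∈ (extChartAt 𝓘(ℝ, F) x).source) :
    chartField V x (extChartAt 𝓘(ℝ, F) x y)
      = mfderiv 𝓘(ℝ, F) 𝓘(ℝ, F) (extChartAt 𝓘(ℝ, F) x) y (V y) := by
  have hr : Set.range 𝓘(ℝ, F) = Set.univ := by simp
  have h := mfderivWithin_extChartAt_symm_comp_mfderiv_extChartAt' (I := 𝓘(ℝ, F)) hy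
  have h' := mfderiv_extChartAt_comp_mfderivWithin_extChartAt_symm' (I := 𝓘(ℝ, F)) hy
  rw [hr] at h h'
  have e : (extChartAt 𝓘(ℝ, F) x).symm (extChartAt 𝓘(ℝ, F) x y) = y :=
    (extChartAt 𝓘(ℝ, F) x).left_inv hy
  -- The base point `symm (φ y)` equals `y` only propositionally, so the value of `V` is transported
  -- along `e`.
  exact (congrArg (fun L : F →L[ℝ] F => L (V ((extChartAt 𝓘(ℝ, F) x).symm
    (extChartAt 𝓘(ℝ, F) x y)))) (ContinuousLinearMap.inverse_eq h h')).trans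
    (congrArg (fun p => (mfderiv 𝓘(ℝ, F) 𝓘(ℝ, F) (extChartAt 𝓘(ℝ, F) x) y : F →L[ℝ] F)
      (V p)) e)

/-- Read in the chart at `x`, this is the formula for vector fields on a vector space, which rests
on the symmetry of the second derivative. -/
theorem mvfderiv_mlieBracket [CompleteSpace F] {V W : ∀ x : M, TangentSpace 𝓘(ℝ, F) x}
    (hV : ContMDiff 𝓘(ℝ, F) 𝓘(ℝ, F).tangent ∞ (fun x => (⟨x, V x⟩ : TangentBundle 𝓘(ℝ, F) M)))
    (hW : ContMDiff 𝓘(ℝ, F) 𝓘(ℝ, F).tangent ∞ (fun x => (⟨x, W x⟩ : TangentBundle 𝓘(ℝ, F) M)))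
    {f : M → G} (hf : ContMDiff 𝓘(ℝ, F) 𝓘(ℝ, G) ∞ f) (x : M) :
    mvfderiv 𝓘(ℝ, F) f x (VectorField.mlieBracket 𝓘(ℝ, F) V W x)
      = mvfderiv 𝓘(ℝ, F) (fun y => mvfderiv 𝓘(ℝ, F) f y (W y)) x (V x)
        - mvfderiv 𝓘(ℝ, F) (fun y => mvfderiv 𝓘(ℝ, F) f y (V y)) x (W x) := by
  set φ := extChartAt 𝓘(ℝ, F) x with hφ
  have hx : x ∈ φ.source := mem_extChartAt_source x
  have hbr : VectorField.mlieBracket 𝓘(ℝ, F) V W x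
      = VectorField.lieBracket ℝ (chartField V x) (chartField W x) (φ x) := by
    rw [← VectorField.mlieBracketWithin_univ, VectorField.mlieBracketWithin_apply,
      mfderiv_extChartAt_self]
    have hid : (ContinuousLinearMap.id ℝ F).inverse = ContinuousLinearMap.id ℝ F :=
      ContinuousLinearMap.inverse_id
    refine (congrArg (fun L : F →L[ℝ] F => L _) hid).trans ?_
    have hr : (extChartAt 𝓘(ℝ, F) x).symm ⁻¹' Set.univ ∩ Set.range 𝓘(ℝ, F) = Set.univ := by simp
    have hr' : Set.range 𝓘(ℝ, F) = Set.univ := by simp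
    rw [hr, hr']
    exact congrFun VectorField.lieBracketWithin_univ _
  have hT : ∀ᶠ z in nhds (φ x), z ∈ φ.target :=
    (isOpen_extChartAt_target (I := 𝓘(ℝ, F)) x).mem_nhds (φ.map_source hx)
  have hsymm : ContMDiffAt 𝓘(ℝ, F) 𝓘(ℝ, F) ∞ φ.symm (φ x) :=
    (contMDiffOn_extChartAt_symm (I := 𝓘(ℝ, F)) (n := ∞) x).contMDiffAt hT
  -- The chart formula has to hold on a neighbourhood and not only at `φ x`, because it is
  -- differentiated once more.
  have key : ∀ U : ∀ x : M, TangentSpace 𝓘(ℝ, F) x,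
      (fun y => mvfderiv 𝓘(ℝ, F) f y (U y)) ∘ φ.symm
        =ᶠ[nhds (φ x)] fun z => fderiv ℝ (f ∘ φ.symm) z (chartField U x z) := by
    intro U
    filter_upwards [hT] with z hz
    have hs := φ.map_target hz
    have := chartField_apply U (x := x) hs
    rw [← hφ, φ.right_inv hz] at this
    rw [Function.comp_apply, this,
      mvfderiv_eq_fderiv_chart (hf.contMDiffAt.of_le (by simp)) (x := x) hs, ← hφ, φ.right_inv hz]
  have hdiff : ∀ U : ∀ x : M, TangentSpace 𝓘(ℝ, F) x,
      ContMDiff 𝓘(ℝ, F) 𝓘(ℝ, F).tangent ∞ (fun x => (⟨x, U x⟩ : TangentBundle 𝓘(ℝ, F) M)) →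
      DifferentiableAt ℝ (chartField U x) (φ x) := by
    intro U hU
    have h := VectorField.contMDiffWithinAt_mpullbackWithin_extChartAt_symm (m := 1) (n := ∞)
      (x := x) (s := Set.univ) (hU.contMDiffAt.of_le (by simp)) uniqueMDiffOn_univ (Set.mem_univ _)
      (by simpa [one_add_one_eq_two] using two_le_infty)
    have hr' : Set.range 𝓘(ℝ, F) = Set.univ := by simp
    rw [hr', Set.preimage_univ, Set.inter_univ] at h
    exact ((contMDiffWithinAt_vectorSpace_iff_contDiffWithinAt.1 h).contDiffAt
      hT).differentiableAt one_ne_zero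
  have hmd : ∀ U : ∀ x : M, TangentSpace 𝓘(ℝ, F) x,
      ContMDiff 𝓘(ℝ, F) 𝓘(ℝ, F).tangent ∞ (fun x => (⟨x, U x⟩ : TangentBundle 𝓘(ℝ, F) M)) →
      MDifferentiableAt 𝓘(ℝ, F) 𝓘(ℝ, G) (fun y => mvfderiv 𝓘(ℝ, F) f y (U y)) x :=
    fun U hU => (contMDiff_mvfderiv_apply hf hU).mdifferentiable (by simp) x
  have hfc : ContDiffAt ℝ ∞ (f ∘ φ.symm) (φ x) := by
    rw [← contMDiffAt_iff_contDiffAt]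
    exact ContMDiffAt.comp _ hf.contMDiffAt hsymm
  have hself : ∀ U : ∀ x : M, TangentSpace 𝓘(ℝ, F) x, chartField U x (φ x) = U x := by
    intro U
    rw [hφ, chartField_apply U hx, mfderiv_extChartAt_self]
    rfl
  rw [mvfderiv_eq_fderiv (hf.mdifferentiable (by simp) x), mvfderiv_eq_fderiv (hmd W hW),
    mvfderiv_eq_fderiv (hmd V hV), ← hφ, (key W).fderiv_eq, (key V).fderiv_eq, hbr,
    VectorField.fderiv_apply_lieBracket hfc (by simpa using two_le_infty) (hdiff W hW)
      (hdiff V hV), hself, hself]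

end RealCalculus

/-! ### Complex vector fields and their action on complex functions -/

section Complexified

variable {F : Type*} [NormedAddCommGroup F] [NormedSpace ℝ F]
  {M : Type*} [TopologicalSpace M] [ChartedSpace F M]

/-! ### Real and imaginary parts -/

@[simp] theorem rePart_tmul {x : M} (z : ℂ) (v : TangentSpace 𝓘(ℝ, F) x) :
    rePart (z ⊗ₜ[ℝ] v : CTangent F x) = z.re • v := by
  simp [rePart]

@[simp] theorem imPart_tmul {x : M} (z : ℂ) (v : TangentSpace 𝓘(ℝ, F) x) :
    imPart (z ⊗ₜ[ℝ] v : CTangent F x) = z.im • v := by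
  simp [imPart]

theorem eq_rePart_add_imPart {x : M} (v : CTangent F x) :
    v = (1 : ℂ) ⊗ₜ[ℝ] rePart v + Complex.I ⊗ₜ[ℝ] imPart v := by
  induction v using TensorProduct.induction_on with
  | zero => simp
  | tmul z v =>
    rw [rePart_tmul, imPart_tmul, ← TensorProduct.smul_tmul, ← TensorProduct.smul_tmul,
      ← TensorProduct.add_tmul]
    congr 1
    simp only [Complex.real_smul, mul_one]
    exact (Complex.re_add_im z).symm
  | add v w hv hw =>
    rw [map_add, map_add, TensorProduct.tmul_add, TensorProduct.tmul_add]
    nth_rewrite 1 [hv, hw]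
    abel

theorem rePart_smul {x : M} (c : ℂ) (v : CTangent F x) :
    rePart (c • v) = c.re • rePart v - c.im • imPart v := by
  induction v using TensorProduct.induction_on with
  | zero => simp
  | tmul z v =>
    rw [TensorProduct.smul_tmul', rePart_tmul, rePart_tmul, imPart_tmul]
    simp only [smul_eq_mul, Complex.mul_re, sub_smul, mul_smul]
  | add v w hv hw => simp only [smul_add, map_add, hv, hw]; abel

theorem imPart_smul {x : M} (c : ℂ) (v : CTangent F x) :
    imPart (c • v) = c.re • imPart v + c.im • rePart v := by
  induction v using TensorProduct.induction_on with
  | zero => simp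
  | tmul z v =>
    rw [TensorProduct.smul_tmul', imPart_tmul, rePart_tmul, imPart_tmul]
    simp only [smul_eq_mul, Complex.mul_im, add_smul, mul_smul]
  | add v w hv hw => simp only [smul_add, map_add, hv, hw]; abel

theorem rePart_cBracket (V W : ∀ x : M, CTangent F x) (x : M) :
    rePart (cBracket V W x)
      = VectorField.mlieBracket 𝓘(ℝ, F) (fun y => rePart (V y)) (fun y => rePart (W y)) x
        - VectorField.mlieBracket 𝓘(ℝ, F) (fun y => imPart (V y)) (fun y => imPart (W y)) x := by
  rw [cBracket, map_add, rePart_tmul, rePart_tmul]; simp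

theorem imPart_cBracket (V W : ∀ x : M, CTangent F x) (x : M) :
    imPart (cBracket V W x)
      = VectorField.mlieBracket 𝓘(ℝ, F) (fun y => rePart (V y)) (fun y => imPart (W y)) x
        + VectorField.mlieBracket 𝓘(ℝ, F) (fun y => imPart (V y)) (fun y => rePart (W y)) x := by
  rw [cBracket, map_add, imPart_tmul, imPart_tmul]; simp

theorem liftBaseChange_eq {x : M} (L : TangentSpace 𝓘(ℝ, F) x →ₗ[ℝ] ℂ) (v : CTangent F x) :
    LinearMap.liftBaseChange ℂ L v = L (rePart v) + Complex.I * L (imPart v) := by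
  conv_lhs => rw [eq_rePart_add_imPart v]
  rw [map_add, LinearMap.liftBaseChange_tmul, LinearMap.liftBaseChange_tmul]
  simp

theorem cDeriv_apply (f : M → ℂ) (x : M) (v : CTangent F x) :
    cDeriv f x v = mvfderiv 𝓘(ℝ, F) f x (rePart v)
      + Complex.I * mvfderiv 𝓘(ℝ, F) f x (imPart v) :=
  liftBaseChange_eq _ v

/-! ### Smooth functions -/

theorem smoothFun_const (c : ℂ) : SmoothFun F (fun _ : M => c) := contMDiff_const

theorem SmoothFun.add {f g : M → ℂ} (hf : SmoothFun F f) (hg : SmoothFun F g) :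
    SmoothFun F (fun x => f x + g x) := ContMDiff.add hf hg

theorem SmoothFun.sub {f g : M → ℂ} (hf : SmoothFun F f) (hg : SmoothFun F g) :
    SmoothFun F (fun x => f x - g x) := ContMDiff.sub hf hg

theorem SmoothFun.neg {f : M → ℂ} (hf : SmoothFun F f) :
    SmoothFun F (fun x => - f x) := ContMDiff.neg hf

theorem SmoothFun.mul {f g : M → ℂ} (hf : SmoothFun F f) (hg : SmoothFun F g) :
    SmoothFun F (fun x => f x * g x) :=
  (contDiff_mul (𝕜 := ℝ) (𝔸 := ℂ)).contMDiff.comp (hf.prodMk_space hg)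

theorem SmoothFun.re {f : M → ℂ} (hf : SmoothFun F f) :
    ContMDiff 𝓘(ℝ, F) 𝓘(ℝ, ℝ) ∞ (fun x => (f x).re) :=
  Complex.reCLM.contMDiff.comp hf

theorem SmoothFun.im {f : M → ℂ} (hf : SmoothFun F f) :
    ContMDiff 𝓘(ℝ, F) 𝓘(ℝ, ℝ) ∞ (fun x => (f x).im) :=
  Complex.imCLM.contMDiff.comp hf

theorem smoothFun_of_local {f : M → ℂ}
    (h : ∀ x₀, ∃ g, SmoothFun F g ∧ ∀ᶠ x in nhds x₀, f x = g x) : SmoothFun F f := by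
  intro x₀
  obtain ⟨g, hg, e⟩ := h x₀
  exact (hg x₀).congr_of_eventuallyEq e

/-! ### Smooth complex vector fields -/

section Fields

variable [IsManifold 𝓘(ℝ, F) ∞ M]

theorem smoothField_of_local {V : ∀ x : M, CTangent F x}
    (h : ∀ x₀, ∃ W, SmoothField W ∧ ∀ᶠ x in nhds x₀, V x = W x) : SmoothField V := by
  constructor <;> intro x₀ <;> obtain ⟨W, hW, e⟩ := h x₀
  · refine (hW.1 x₀).congr_of_eventuallyEq ?_
    filter_upwards [e] with x hx
    rw [hx]
  · refine (hW.2 x₀).congr_of_eventuallyEq ?_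
    filter_upwards [e] with x hx
    rw [hx]

theorem SmoothField.add {V W : ∀ x : M, CTangent F x} (hV : SmoothField V) (hW : SmoothField W) :
    SmoothField (fun x => V x + W x) := by
  refine ⟨?_, ?_⟩
  · simp only [map_add]; exact hV.1.add_section hW.1
  · simp only [map_add]; exact hV.2.add_section hW.2

theorem SmoothField.smul {f : M → ℂ} (hf : SmoothFun F f) {V : ∀ x : M, CTangent F x}
    (hV : SmoothField V) : SmoothField (fun x => f x • V x) := by
  refine ⟨?_, ?_⟩
  · simp only [rePart_smul]
    exact (hf.re.smul_section hV.1).sub_section (hf.im.smul_section hV.2)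
  · simp only [imPart_smul]
    exact (hf.re.smul_section hV.2).add_section (hf.im.smul_section hV.1)

theorem smoothField_zero : SmoothField (fun x : M => (0 : CTangent F x)) := by
  have h : ContMDiff 𝓘(ℝ, F) 𝓘(ℝ, F).tangent ∞
      (fun x => (⟨x, 0⟩ : TangentBundle 𝓘(ℝ, F) M)) :=
    Bundle.contMDiff_zeroSection ℝ (TangentSpace 𝓘(ℝ, F))
  refine ⟨?_, ?_⟩ <;> simpa only [map_zero] using h

theorem SmoothField.cBracket [CompleteSpace F] {V W : ∀ x : M, CTangent F x} (hV : SmoothField V)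
    (hW : SmoothField W) : SmoothField (cBracket V W) := by
  refine ⟨?_, ?_⟩
  · simp only [rePart_cBracket]
    exact (contMDiff_mlieBracket hV.1 hW.1).sub_section (contMDiff_mlieBracket hV.2 hW.2)
  · simp only [imPart_cBracket]
    exact (contMDiff_mlieBracket hV.1 hW.2).add_section (contMDiff_mlieBracket hV.2 hW.1)

theorem SmoothFun.cDeriv {f : M → ℂ} (hf : SmoothFun F f) {V : ∀ x : M, CTangent F x}
    (hV : SmoothField V) : SmoothFun F (fun x => cDeriv f x (V x)) := by
  simp only [cDeriv_apply]
  exact SmoothFun.add (contMDiff_mvfderiv_apply hf hV.1)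
    ((smoothFun_const _).mul (contMDiff_mvfderiv_apply hf hV.2))

end Fields

/-! ### Rules for the derivative -/

theorem SmoothFun.mdifferentiableAt {f : M → ℂ} (hf : SmoothFun F f) (x : M) :
    MDifferentiableAt 𝓘(ℝ, F) 𝓘(ℝ, ℂ) f x := ContMDiff.mdifferentiable hf (by simp) x

theorem cDeriv_congr {f g : M → ℂ} {x : M} (h : ∀ᶠ y in nhds x, f y = g y) (v : CTangent F x) :
    cDeriv f x v = cDeriv g x v := by
  have : mvfderiv 𝓘(ℝ, F) f x = mvfderiv 𝓘(ℝ, F) g x := by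
    ext w
    exact congrArg (fun L : F →L[ℝ] ℂ => L w) (Filter.EventuallyEq.mfderiv_eq h)
  rw [cDeriv, this, cDeriv]

theorem cDeriv_const (c : ℂ) (x : M) (v : CTangent F x) : cDeriv (fun _ => c) x v = 0 := by
  have h : mvfderiv 𝓘(ℝ, F) (fun _ : M => c) x = 0 := mvfderiv_const c
  rw [cDeriv_apply, h]
  simp

theorem cDeriv_add {f g : M → ℂ} (hf : SmoothFun F f) (hg : SmoothFun F g) (x : M)
    (v : CTangent F x) : cDeriv (fun y => f y + g y) x v = cDeriv f x v + cDeriv g x v := by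
  have := mvfderiv_add (hf.mdifferentiableAt x) (hg.mdifferentiableAt x)
  rw [show (fun y => f y + g y) = f + g from rfl, cDeriv_apply, cDeriv_apply, cDeriv_apply, this]
  simp only [add_apply]
  ring

theorem mvfderiv_fun_mul_complex {f g : M → ℂ} (hf : SmoothFun F f) (hg : SmoothFun F g) (x : M)
    (v : TangentSpace 𝓘(ℝ, F) x) :
    mvfderiv 𝓘(ℝ, F) (fun y => f y * g y) x v
      = mvfderiv 𝓘(ℝ, F) f x v * g x + f x * mvfderiv 𝓘(ℝ, F) g x v := by
  rw [mvfderiv_eq_fderiv ((hf.mul hg).mdifferentiableAt x),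
    mvfderiv_eq_fderiv (hf.mdifferentiableAt x), mvfderiv_eq_fderiv (hg.mdifferentiableAt x)]
  have d : ∀ {f : M → ℂ}, SmoothFun F f → DifferentiableAt ℝ
      (f ∘ (extChartAt 𝓘(ℝ, F) x).symm) (extChartAt 𝓘(ℝ, F) x x) := by
    intro f hf
    have h := (mdifferentiableWithinAt_univ.2
      (hf.mdifferentiableAt x)).differentiableWithinAt_comp_extChartAt_symm
    rw [Set.preimage_univ, Set.univ_inter, modelWithCornersSelf_coe, Set.range_id] at h
    exact differentiableWithinAt_univ.1 h
  have e : (extChartAt 𝓘(ℝ, F) x).symm (extChartAt 𝓘(ℝ, F) x x) = x := extChartAt_to_inv x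
  refine (congrArg (fun L : F →L[ℝ] ℂ => L v) (fderiv_mul (d hf) (d hg))).trans ?_
  change f ((extChartAt 𝓘(ℝ, F) x).symm (extChartAt 𝓘(ℝ, F) x x)) * _
    + g ((extChartAt 𝓘(ℝ, F) x).symm (extChartAt 𝓘(ℝ, F) x x)) * _ = _
  rw [e]
  exact (add_comm _ _).trans (congrArg₂ (· + ·) (mul_comm _ _) rfl)

theorem cDeriv_mul {f g : M → ℂ} (hf : SmoothFun F f) (hg : SmoothFun F g) (x : M)
    (v : CTangent F x) :
    cDeriv (fun y => f y * g y) x v = cDeriv f x v * g x + f x * cDeriv g x v := by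
  simp only [cDeriv_apply, mvfderiv_fun_mul_complex hf hg]
  ring

theorem cDeriv_const_mul (c : ℂ) {g : M → ℂ} (hg : SmoothFun F g) (x : M)
    (v : CTangent F x) : cDeriv (fun y => c * g y) x v = c * cDeriv g x v := by
  rw [cDeriv_mul (smoothFun_const c) hg, cDeriv_const]; ring

theorem cDeriv_neg {f : M → ℂ} (hf : SmoothFun F f) (x : M)
    (v : CTangent F x) : cDeriv (fun y => - f y) x v = - cDeriv f x v := by
  have := cDeriv_const_mul (-1) hf x v
  simpa using this

theorem cDeriv_sub {f g : M → ℂ} (hf : SmoothFun F f) (hg : SmoothFun F g) (x : M)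
    (v : CTangent F x) : cDeriv (fun y => f y - g y) x v = cDeriv f x v - cDeriv g x v := by
  simp only [sub_eq_add_neg]
  rw [cDeriv_add hf hg.neg, cDeriv_neg hg]

/-- The four real brackets in the definition reassemble by `I² = -1`. The formula characterises the
complex bracket by its action on functions, and every later rule for the bracket is deduced from it.
-/
theorem cDeriv_cBracket [IsManifold 𝓘(ℝ, F) ∞ M] [CompleteSpace F] {V W : ∀ x : M, CTangent F x}
    (hV : SmoothField V) (hW : SmoothField W) {f : M → ℂ} (hf : SmoothFun F f) (x : M) :
    cDeriv f x (cBracket V W x)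
      = cDeriv (fun y => cDeriv f y (W y)) x (V x) - cDeriv (fun y => cDeriv f y (V y)) x (W x) := by
  have s : ∀ {U : ∀ x : M, TangentSpace 𝓘(ℝ, F) x},
      ContMDiff 𝓘(ℝ, F) 𝓘(ℝ, F).tangent ∞ (fun x => (⟨x, U x⟩ : TangentBundle 𝓘(ℝ, F) M)) →
      SmoothFun F (fun y => mvfderiv 𝓘(ℝ, F) f y (U y)) := fun hU => contMDiff_mvfderiv_apply hf hU
  have e : ∀ {U : ∀ x : M, CTangent F x}, SmoothField U → ∀ v : CTangent F x,
      cDeriv (fun y => cDeriv f y (U y)) x v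
        = cDeriv (fun y => mvfderiv 𝓘(ℝ, F) f y (rePart (U y))) x v
          + Complex.I * cDeriv (fun y => mvfderiv 𝓘(ℝ, F) f y (imPart (U y))) x v := by
    intro U hU v
    simp only [cDeriv_apply f]
    rw [cDeriv_add (s hU.1) ((smoothFun_const _).mul (s hU.2)), cDeriv_const_mul _ (s hU.2)]
  rw [e hV, e hW, cDeriv_apply f, rePart_cBracket, imPart_cBracket]
  simp only [map_add, map_sub, cDeriv_apply]
  rw [mvfderiv_mlieBracket hV.1 hW.1 hf, mvfderiv_mlieBracket hV.2 hW.2 hf,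
    mvfderiv_mlieBracket hV.1 hW.2 hf, mvfderiv_mlieBracket hV.2 hW.1 hf]
  ring_nf
  simp only [Complex.I_sq]
  ring

end Complexified

/-! ### Cut-off functions, separation of tangent vectors, and local frames -/

section Local

variable {F : Type*} [NormedAddCommGroup F] [NormedSpace ℝ F]
  {M : Type*} [TopologicalSpace M] [ChartedSpace F M] [IsManifold 𝓘(ℝ, F) ∞ M]

/-! ### Bump functions and chart functions -/

/-- Sections and functions are global throughout, so local constructions are cut off. The value is 1
on a whole neighbourhood, so derivatives at `x₀` are not affected. -/
theorem exists_bump [FiniteDimensional ℝ F] [T2Space M] (x₀ : M) {U : Set M} (hU : U ∈ nhds x₀) :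
    ∃ χ : M → ℂ, SmoothFun F χ ∧ (∀ᶠ x in nhds x₀, χ x = 1) ∧ tsupport χ ⊆ U := by
  obtain ⟨f, -, hf⟩ := (SmoothBumpFunction.nhds_basis_tsupport (I := 𝓘(ℝ, F)) x₀).mem_iff.1 hU
  refine ⟨fun x => (f x : ℂ), Complex.ofRealCLM.contMDiff.comp f.contMDiff, ?_, ?_⟩
  · filter_upwards [f.eventuallyEq_one] with x hx
    simp [hx]
  · refine subset_trans (closure_mono fun x hx => ?_) hf
    simpa using hx

omit [IsManifold 𝓘(ℝ, F) ∞ M] in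
theorem smoothFun_mul_of_tsupport {χ g : M → ℂ} (hχ : SmoothFun F χ)
    (hg : ∀ x ∈ tsupport χ, ContMDiffAt 𝓘(ℝ, F) 𝓘(ℝ, ℂ) ∞ g x) :
    SmoothFun F (fun x => χ x * g x) := by
  intro x
  by_cases hx : x ∈ tsupport χ
  · exact (contDiff_mul (𝕜 := ℝ) (𝔸 := ℂ)).contMDiff.contMDiffAt.comp x
      ((hχ x).prodMk_space (hg x hx))
  · refine (contMDiffAt_const (c := (0 : ℂ))).congr_of_eventuallyEq ?_
    filter_upwards [(isClosed_tsupport χ).isOpen_compl.mem_nhds hx] with y hy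
    rw [image_eq_zero_of_notMem_tsupport hy, zero_mul]

/-- The complexified differential at `y` of the chart centered at `x₀`. -/
noncomputable def cChart (x₀ y : M) : CTangent F y →ₗ[ℂ] ℂ ⊗[ℝ] F :=
  LinearMap.baseChange ℂ
    ((trivializationAt F (TangentSpace 𝓘(ℝ, F)) x₀).continuousLinearMapAt ℝ y).toLinearMap

/-- The complexified differential of the inverse of the chart centered at `x₀`. -/
noncomputable def cChartSymm (x₀ y : M) : ℂ ⊗[ℝ] F →ₗ[ℂ] CTangent F y :=
  LinearMap.baseChange ℂ
    ((trivializationAt F (TangentSpace 𝓘(ℝ, F)) x₀).symmL ℝ y).toLinearMap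

theorem cChart_cChartSymm {x₀ y : M} (hy : y ∈ (chartAt F x₀).source) (c : ℂ ⊗[ℝ] F) :
    cChart x₀ y (cChartSymm x₀ y c) = c := by
  induction c using TensorProduct.induction_on with
  | zero => simp
  | add a b ha hb => rw [map_add, map_add, ha, hb]
  | tmul z v =>
    exact congrArg (fun w => z ⊗ₜ[ℝ] w)
      ((trivializationAt F (TangentSpace 𝓘(ℝ, F)) x₀).continuousLinearMapAt_symmL hy v)

theorem cChartSymm_cChart {x₀ y : M} (hy : y ∈ (chartAt F x₀).source) (v : CTangent F y) :
    cChartSymm x₀ y (cChart x₀ y v) = v := by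
  induction v using TensorProduct.induction_on with
  | zero => simp
  | add a b ha hb => rw [map_add, map_add, ha, hb]
  | tmul z v =>
    exact congrArg (fun w => z ⊗ₜ[ℝ] w)
      ((trivializationAt F (TangentSpace 𝓘(ℝ, F)) x₀).symmL_continuousLinearMapAt hy v)

/-- A linear coordinate of the chart, cut off. The last clause says that its differential is a
constant covector in the chart throughout a neighbourhood; frames and involutivity depend on this.
-/
theorem exists_chartFun [FiniteDimensional ℝ F] [T2Space M] (x₀ : M) (L : F →L[ℝ] ℂ) :
    ∃ f : M → ℂ, SmoothFun F f ∧ (∀ᶠ y in nhds x₀, f y = L (extChartAt 𝓘(ℝ, F) x₀ y)) ∧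
      ∀ᶠ y in nhds x₀, ∀ v : CTangent F y,
        cDeriv f y v = LinearMap.liftBaseChange ℂ L.toLinearMap (cChart x₀ y v) := by
  have hs := extChartAt_source_mem_nhds (I := 𝓘(ℝ, F)) x₀
  obtain ⟨χ, hχ, h1, hsupp⟩ := exists_bump (F := F) x₀ hs
  have hsm : ∀ y ∈ (extChartAt 𝓘(ℝ, F) x₀).source,
      ContMDiffAt 𝓘(ℝ, F) 𝓘(ℝ, F) ∞ (extChartAt 𝓘(ℝ, F) x₀) y := fun y hy =>
    contMDiffAt_extChartAt' (by simpa using hy)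
  have he : ∀ᶠ y in nhds x₀, χ y * L (extChartAt 𝓘(ℝ, F) x₀ y) = L (extChartAt 𝓘(ℝ, F) x₀ y) := by
    filter_upwards [h1] with y hy
    rw [hy, one_mul]
  refine ⟨fun y => χ y * L (extChartAt 𝓘(ℝ, F) x₀ y), smoothFun_mul_of_tsupport hχ fun y hy =>
    L.contMDiff.contMDiffAt.comp y (hsm y (hsupp hy)), he, ?_⟩
  filter_upwards [he.eventually_nhds, hs] with y hy hys v
  rw [cDeriv_congr hy]
  have key : ∀ w : TangentSpace 𝓘(ℝ, F) y,
      mvfderiv 𝓘(ℝ, F) (fun y => L (extChartAt 𝓘(ℝ, F) x₀ y)) y w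
        = L ((trivializationAt F (TangentSpace 𝓘(ℝ, F)) x₀).continuousLinearMapAt ℝ y w) := by
    intro w
    rw [TangentBundle.continuousLinearMapAt_trivializationAt (by simpa using hys)]
    have := mfderiv_comp y (L.differentiableAt (x := extChartAt 𝓘(ℝ, F) x₀ y)).mdifferentiableAt
      ((hsm y hys).mdifferentiableAt (by simp))
    rw [mfderiv_eq_fderiv, L.fderiv] at this
    exact congrArg (fun T : F →L[ℝ] ℂ => T w) this
  induction v using TensorProduct.induction_on with
  | zero => simp
  | add a b ha hb => rw [map_add, map_add, map_add, ha, hb]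
  | tmul z v => exact congrArg (fun c => z • c) (key v)

theorem tensor_eq_zero [FiniteDimensional ℝ F] {c : ℂ ⊗[ℝ] F}
    (h : ∀ L : F →ₗ[ℝ] ℂ, LinearMap.liftBaseChange ℂ L c = 0) : c = 0 := by
  let b := Module.finBasis ℝ F
  refine (b.baseChange ℂ).ext_elem fun i => ?_
  -- A real coordinate viewed as a complex functional extends complex-linearly to the corresponding
  -- coordinate of the base-changed basis.
  have := h (Complex.ofRealLI.toLinearMap ∘ₗ b.coord i)
  rw [map_zero, Finsupp.zero_apply, ← this]
  clear h this
  induction c using TensorProduct.induction_on with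
  | zero => simp
  | add a b ha hb => rw [map_add, map_add, Finsupp.add_apply, ha, hb]
  | tmul z v => simp [mul_comm]

/-- Chart functions realise every real-linear functional on the model space as a differential at
`x`, and the complex-linear extensions of these functionals have no common kernel. -/
theorem cTangent_eq_zero [FiniteDimensional ℝ F] [T2Space M] {x : M} {v : CTangent F x}
    (h : ∀ f : M → ℂ, SmoothFun F f → cDeriv f x v = 0) : v = 0 := by
  have hx : x ∈ (chartAt F x).source := mem_chart_source F x
  suffices cChart x x v = 0 by rw [← cChartSymm_cChart hx v, this, map_zero]
  refine tensor_eq_zero fun L => ?_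
  obtain ⟨f, hf, -, hd⟩ := exists_chartFun (F := F) x L.toContinuousLinearMap
  exact (hd.self_of_nhds v).symm.trans (h f hf)

theorem cTangent_ext_cDeriv [FiniteDimensional ℝ F] [T2Space M] {x : M} {v w : CTangent F x}
    (h : ∀ f : M → ℂ, SmoothFun F f → cDeriv f x v = cDeriv f x w) : v = w :=
  sub_eq_zero.1 <| cTangent_eq_zero fun f hf => by rw [map_sub, h f hf, sub_self]

/-! ### The Lie bracket of complex vector fields -/

section Bracket

variable [FiniteDimensional ℝ F] [T2Space M] {U V W : ∀ x : M, CTangent F x}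

/-- On functions the bracket acts as the commutator of two derivations. Additivity, skew-symmetry,
the Leibniz rule and the Jacobi identity below are the formal identities for commutators. -/
theorem cBracket_add_left (hU : SmoothField U) (hV : SmoothField V) (hW : SmoothField W) (x : M) :
    cBracket (fun y => U y + V y) W x = cBracket U W x + cBracket V W x := by
  have := FiniteDimensional.complete ℝ F
  refine cTangent_ext_cDeriv fun f hf => ?_
  rw [map_add, cDeriv_cBracket (hU.add hV) hW hf, cDeriv_cBracket hU hW hf,
    cDeriv_cBracket hV hW hf]
  simp only [map_add]
  rw [cDeriv_add (hf.cDeriv hU) (hf.cDeriv hV)]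
  ring

theorem cBracket_add_right (hU : SmoothField U) (hV : SmoothField V) (hW : SmoothField W) (x : M) :
    cBracket U (fun y => V y + W y) x = cBracket U V x + cBracket U W x := by
  have := FiniteDimensional.complete ℝ F
  refine cTangent_ext_cDeriv fun f hf => ?_
  rw [map_add, cDeriv_cBracket hU (hV.add hW) hf, cDeriv_cBracket hU hW hf,
    cDeriv_cBracket hU hV hf]
  simp only [map_add]
  rw [cDeriv_add (hf.cDeriv hV) (hf.cDeriv hW)]
  ring

theorem cBracket_swap (hU : SmoothField U) (hV : SmoothField V) (x : M) :
    cBracket U V x = - cBracket V U x := by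
  have := FiniteDimensional.complete ℝ F
  refine cTangent_ext_cDeriv fun f hf => ?_
  rw [map_neg, cDeriv_cBracket hU hV hf, cDeriv_cBracket hV hU hf]
  ring

theorem cBracket_smul_right {g : M → ℂ} (hg : SmoothFun F g) (hU : SmoothField U)
    (hV : SmoothField V) (x : M) :
    cBracket U (fun y => g y • V y) x = cDeriv g x (U x) • V x + g x • cBracket U V x := by
  have := FiniteDimensional.complete ℝ F
  refine cTangent_ext_cDeriv fun f hf => ?_
  rw [map_add, map_smul, map_smul, cDeriv_cBracket hU (hV.smul hg) hf, cDeriv_cBracket hU hV hf]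
  simp only [map_smul, smul_eq_mul]
  rw [cDeriv_mul hg (hf.cDeriv hV)]
  ring

theorem cBracket_jacobi (hU : SmoothField U) (hV : SmoothField V) (hW : SmoothField W) (x : M) :
    cBracket U (cBracket V W) x = cBracket V (cBracket U W) x + cBracket (cBracket U V) W x := by
  have := FiniteDimensional.complete ℝ F
  refine cTangent_ext_cDeriv fun f hf => ?_
  rw [map_add, cDeriv_cBracket hU (hV.cBracket hW) hf, cDeriv_cBracket hV (hU.cBracket hW) hf,
    cDeriv_cBracket (hU.cBracket hV) hW hf, cDeriv_cBracket hU hV (hf.cDeriv hW),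
    cDeriv_cBracket hV hW (hf.cDeriv hU), cDeriv_cBracket hU hW (hf.cDeriv hV)]
  simp only [cDeriv_cBracket hU hV hf, cDeriv_cBracket hU hW hf, cDeriv_cBracket hV hW hf]
  have c : ∀ {A B : ∀ x : M, CTangent F x}, SmoothField A → SmoothField B →
      SmoothFun F fun y => cDeriv (fun y => cDeriv f y (A y)) y (B y) :=
    fun hA hB => (hf.cDeriv hA).cDeriv hB
  rw [cDeriv_sub (c hW hV) (c hV hW), cDeriv_sub (c hW hU) (c hU hW), cDeriv_sub (c hV hU) (c hU hV)]
  ring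

end Bracket

/-! ### Local frames -/

/-- A field that is constant in the chart is smooth over the chart domain, and multiplication by `χ`
extends it by zero. These fields supply the local frames. -/
theorem smoothField_smul_cChartSymm (x₀ : M) {χ : M → ℂ} (hχ : SmoothFun F χ)
    (hsupp : tsupport χ ⊆ (chartAt F x₀).source) (c : ℂ ⊗[ℝ] F) :
    SmoothField (fun y => χ y • cChartSymm x₀ y c) := by
  have hreal : ∀ v : F, ∀ y ∈ (chartAt F x₀).source, ContMDiffAt 𝓘(ℝ, F) 𝓘(ℝ, F).tangent ∞
      (fun y => (⟨y, (trivializationAt F (TangentSpace 𝓘(ℝ, F)) x₀).symmL ℝ y v⟩ :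
        TangentBundle 𝓘(ℝ, F) M)) y := by
    intro v y hy
    refine (Bundle.Trivialization.contMDiffAt_section_iff
      (trivializationAt F (TangentSpace 𝓘(ℝ, F)) x₀) hy).2 ?_
    refine (contMDiffAt_const (c := v)).congr_of_eventuallyEq ?_
    filter_upwards [(chartAt F x₀).open_source.mem_nhds hy] with z hz
    rw [Bundle.Trivialization.symmL_apply (hb := hz)]
    exact congrArg Prod.snd
      (Bundle.Trivialization.apply_mk_symm (trivializationAt F (TangentSpace 𝓘(ℝ, F)) x₀) hz v)
  have hglob : ∀ v : F, SmoothField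
      (fun y => χ y • ((1 : ℂ) ⊗ₜ[ℝ] (trivializationAt F (TangentSpace 𝓘(ℝ, F)) x₀).symmL ℝ y v :
        CTangent F y)) := by
    intro v
    -- Applied to the real and to the imaginary part of `χ`; all that is needed of them is that they
    -- vanish wherever `χ` does.
    have hglob' : ∀ g : M → ℝ, ContMDiff 𝓘(ℝ, F) 𝓘(ℝ, ℝ) ∞ g → (∀ y, χ y = 0 → g y = 0) →
        ContMDiff 𝓘(ℝ, F) 𝓘(ℝ, F).tangent ∞ (fun y =>
          (⟨y, g y • (trivializationAt F (TangentSpace 𝓘(ℝ, F)) x₀).symmL ℝ y v⟩ :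
            TangentBundle 𝓘(ℝ, F) M)) := by
      intro g hg h0 y
      by_cases hy : y ∈ tsupport χ
      · exact (hg y).smul_section (hreal v y (hsupp hy))
      · refine (Bundle.contMDiff_zeroSection ℝ (TangentSpace 𝓘(ℝ, F)) y).congr_of_eventuallyEq ?_
        filter_upwards [(isClosed_tsupport χ).isOpen_compl.mem_nhds hy] with z hz
        rw [h0 z (image_eq_zero_of_notMem_tsupport hz), zero_smul]
        rfl
    refine ⟨?_, ?_⟩
    · simpa only [rePart_smul, rePart_tmul, imPart_tmul, Complex.one_re, Complex.one_im, one_smul,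
        zero_smul, smul_zero, sub_zero] using hglob' _ hχ.re fun y hy => by rw [hy, Complex.zero_re]
    · simpa only [imPart_smul, rePart_tmul, imPart_tmul, Complex.one_re, Complex.one_im, one_smul,
        zero_smul, smul_zero, zero_add] using hglob' _ hχ.im fun y hy => by rw [hy, Complex.zero_im]
  induction c using TensorProduct.induction_on with
  | zero => simpa using smoothField_zero
  | add a b ha hb => simpa only [map_add, smul_add] using ha.add hb
  | tmul z v =>
    convert (hglob v).smul (smoothFun_const z) using 2 with y
    rw [smul_comm, TensorProduct.smul_tmul', smul_eq_mul, mul_one]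
    rfl

/-! ### Bundles of complex tangent vectors -/

variable {A : M → Type*} [∀ x, AddCommGroup (A x)] [∀ x, Module ℂ (A x)]

omit [IsManifold 𝓘(ℝ, F) ∞ M] in
theorem TangentSummand.incl_injective (S : TangentSummand F A) (x : M) :
    Function.Injective (S.incl x) :=
  Function.LeftInverse.injective (S.proj_incl x)

/-- A summand of the complexified tangent bundle that is constant in suitable charts is a vector
bundle. -/
theorem TangentSummand.isVectorBundle_of_chart [FiniteDimensional ℝ F] [T2Space M]
    (S : TangentSummand F A)
    (hK : ∀ x₀ : M, ∃ K : Submodule ℂ (ℂ ⊗[ℝ] F), ∀ᶠ y in nhds x₀, ∀ v : CTangent F y,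
      v ∈ LinearMap.range (S.incl y) ↔ cChart x₀ y v ∈ K) :
    IsVectorBundle F {V | S.SmoothSection V} where
  zero_mem := by
    have : S.toField (fun _ => 0) = fun _ => 0 := by ext x; simp [toField]
    change SmoothField _
    rw [this]; exact smoothField_zero
  add_mem s hs t ht := by
    have : S.toField (fun x => s x + t x) = fun x => S.toField s x + S.toField t x := by
      ext x; simp [toField]
    change SmoothField _
    rw [this]; exact SmoothField.add hs ht
  smul_mem f hf s hs := by
    have : S.toField (fun x => f x • s x) = fun x => f x • S.toField s x := by
      ext x; simp [toField]
    change SmoothField _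
    rw [this]; exact SmoothField.smul hf hs
  of_local s h := by
    refine smoothField_of_local fun x₀ => ?_
    obtain ⟨t, ht, U, hU, e⟩ := h x₀
    refine ⟨S.toField t, ht, ?_⟩
    filter_upwards [hU] with x hx
    rw [toField, e x hx, toField]
  exists_frame x₀ := by
    obtain ⟨K, hK⟩ := hK x₀
    obtain ⟨U₀, hU₀, hUK⟩ := hK.exists_mem
    have hsrc : (chartAt F x₀).source ∈ nhds x₀ := chart_source_mem_nhds F x₀
    obtain ⟨χ, hχ, h1, hsupp⟩ := exists_bump (F := F) x₀ (Filter.inter_mem hU₀ hsrc)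
    let b := Module.finBasis ℂ K
    -- The frame: a basis of the constant space `K`, transported by the chart and cut off. The
    -- projection only serves to regard its members as sections of `A`.
    let e : Fin (Module.finrank ℂ K) → ∀ y : M, A y := fun i y =>
      S.proj y (χ y • cChartSymm x₀ y (b i))
    -- On the support of `χ` the transported vector lies in the range of `incl`, so projecting it
    -- loses nothing; elsewhere both sides vanish.
    have he : ∀ i y, S.incl y (e i y) = χ y • cChartSymm x₀ y (b i : ℂ ⊗[ℝ] F) := by
      intro i y
      by_cases hy : y ∈ tsupport χ
      · have hm : χ y • cChartSymm x₀ y (b i : ℂ ⊗[ℝ] F) ∈ LinearMap.range (S.incl y) := by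
          refine Submodule.smul_mem _ _ ?_
          rw [hUK y (hsupp hy).1, cChart_cChartSymm (hsupp hy).2]
          exact (b i).2
        obtain ⟨w, hw⟩ := hm
        change S.incl y (S.proj y _) = _
        rw [← hw, S.proj_incl]
      · change S.incl y (S.proj y _) = _
        rw [image_eq_zero_of_notMem_tsupport hy]; simp
    -- The coordinates on `K` extend to the whole model space and are realised as differentials of
    -- functions `g i`. The coefficients of a section are then its derivatives of `g i`, which are
    -- visibly smooth.
    choose ℓ hℓ using fun i => LinearMap.exists_extend (b.coord i)
    choose g hg _ hgd using fun i => exists_chartFun (F := F) x₀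
      ((LinearMap.restrictScalars ℝ (ℓ i)) ∘ₗ
        (TensorProduct.mk ℝ ℂ F 1)).toContinuousLinearMap
    have hgl : ∀ i, ∀ᶠ y in nhds x₀, ∀ v : CTangent F y, cDeriv (g i) y v = ℓ i (cChart x₀ y v) := by
      intro i
      filter_upwards [hgd i] with y hy v
      rw [hy]
      generalize cChart x₀ y v = c
      induction c using TensorProduct.induction_on with
      | zero => simp
      | add a b ha hb => rw [map_add, map_add, ha, hb]
      | tmul z v =>
        rw [LinearMap.liftBaseChange_tmul]
        change z • ℓ i ((1 : ℂ) ⊗ₜ v) = _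
        rw [← map_smul, TensorProduct.smul_tmul', smul_eq_mul, mul_one]
    obtain ⟨U, hU, hUall⟩ := (h1.and ((Filter.eventually_all.2 hgl).and
      (Filter.inter_mem hU₀ hsrc : ∀ᶠ y in nhds x₀, y ∈ U₀ ∩ _))).exists_mem
    have hin : ∀ y ∈ U, ∀ i, cChart x₀ y (S.incl y (e i y)) = b i := by
      intro y hy i
      obtain ⟨h1, -, -, hs⟩ := hUall y hy
      rw [he, h1, one_smul, cChart_cChartSymm hs]
    have hexp : ∀ y ∈ U, ∀ w : A y, w = ∑ i, cDeriv (g i) y (S.incl y w) • e i y := by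
      intro y hy w
      obtain ⟨h1, h2, h3, hs⟩ := hUall y hy
      apply S.incl_injective
      rw [← cChartSymm_cChart hs (S.incl y w), ← cChartSymm_cChart hs (S.incl y (∑ i, _))]
      congr 1
      have hw : cChart x₀ y (S.incl y w) ∈ K := (hUK y h3 _).1 ⟨w, rfl⟩
      simp only [map_sum, map_smul, hin y hy]
      have := congrArg Subtype.val (b.sum_repr ⟨_, hw⟩)
      simp only [Submodule.coe_sum, Submodule.coe_smul] at this
      refine this.symm.trans (Finset.sum_congr rfl fun i _ => ?_)
      congr 1
      rw [cChartSymm_cChart hs, h2, ← b.coord_apply, ← hℓ i]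
      rfl
    refine ⟨_, e, U, hU, fun i => ?_, fun y hy => ⟨?_, ?_⟩, fun s hs => ?_⟩
    · have : S.toField (e i) = fun y => χ y • cChartSymm x₀ y (b i : ℂ ⊗[ℝ] F) := funext (he i)
      change SmoothField _
      rw [this]
      exact smoothField_smul_cChartSymm x₀ hχ (fun y hy => (hsupp hy).2) _
    · refine LinearIndependent.of_comp (cChart x₀ y ∘ₗ S.incl y) ?_
      have : (cChart x₀ y ∘ₗ S.incl y) ∘ (fun i => e i y) = K.subtype ∘ b :=
        funext (hin y hy)
      rw [this]
      exact b.linearIndependent.map' _ (Submodule.ker_subtype K)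
    · refine eq_top_iff.2 fun w _ => ?_
      rw [hexp y hy w]
      exact Submodule.sum_mem _ fun i _ => Submodule.smul_mem _ _
        (Submodule.subset_span ⟨i, rfl⟩)
    · exact ⟨fun i y => cDeriv (g i) y (S.incl y (s y)), fun i => (hg i).cDeriv hs,
        fun y hy => hexp y hy (s y)⟩

end Local

/-! ### Smooth bundles given by their sections: duals, products, tensorial functionals -/

section Bundles

variable {F : Type*} [NormedAddCommGroup F] [NormedSpace ℝ F]
  {M : Type*} [TopologicalSpace M] [ChartedSpace F M]
  {E : M → Type*} [∀ x, AddCommGroup (E x)] [∀ x, Module ℂ (E x)]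
  {E' : M → Type*} [∀ x, AddCommGroup (E' x)] [∀ x, Module ℂ (E' x)]

namespace IsVectorBundle

variable {Γ : Set (∀ x, E x)} (h : IsVectorBundle F Γ)

include h

theorem const_smul_mem (c : ℂ) {s : ∀ x, E x} (hs : s ∈ Γ) : (fun x => c • s x) ∈ Γ :=
  h.smul_mem _ (smoothFun_const c) s hs

theorem neg_mem {s : ∀ x, E x} (hs : s ∈ Γ) : (fun x => - s x) ∈ Γ := by
  simpa using h.const_smul_mem (-1) hs

theorem sum_mem {ι : Type*} (t : Finset ι) {s : ι → ∀ x, E x} (hs : ∀ i, s i ∈ Γ) :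
    (fun x => ∑ i ∈ t, s i x) ∈ Γ := by
  classical
  induction t using Finset.induction_on with
  | empty => simpa using h.zero_mem
  | insert i t hi ih =>
    simp only [Finset.sum_insert hi]
    exact h.add_mem _ (hs i) _ ih

theorem finiteDimensional (x : M) : FiniteDimensional ℂ (E x) := by
  obtain ⟨r, e, U, hU, -, hb, -⟩ := h.exists_frame x
  exact Module.Finite.of_basis
    (Module.Basis.mk (hb x (mem_of_mem_nhds hU)).1 (hb x (mem_of_mem_nhds hU)).2.ge)

theorem exists_section {x : M} (v : E x) : ∃ s ∈ Γ, s x = v := by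
  obtain ⟨r, e, U, hU, he, hb, -⟩ := h.exists_frame x
  have hv : v ∈ Submodule.span ℂ (Set.range (fun i => e i x)) := by
    rw [(hb x (mem_of_mem_nhds hU)).2]; trivial
  obtain ⟨c, hc⟩ := (Submodule.mem_span_range_iff_exists_fun ℂ).1 hv
  exact ⟨fun y => ∑ i, c i • e i y, h.sum_mem _ fun i => h.const_smul_mem (c i) (he i), hc⟩

/-- A functional on sections that is linear over the smooth functions is given by linear forms on
the fibres. -/
theorem exists_dual [IsManifold 𝓘(ℝ, F) ∞ M] [FiniteDimensional ℝ F] [T2Space M]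
    {L : (∀ x, E x) → M → ℂ}
    (hadd : ∀ s ∈ Γ, ∀ t ∈ Γ, ∀ x, L (fun y => s y + t y) x = L s x + L t x)
    (hsmul : ∀ f : M → ℂ, SmoothFun F f → ∀ s ∈ Γ, ∀ x, L (fun y => f y • s y) x = f x * L s x)
    (x : M) : ∃ ℓ : Module.Dual ℂ (E x), ∀ s ∈ Γ, ℓ (s x) = L s x := by
  classical
  obtain ⟨r, e, U, hU, he, hb, hf⟩ := h.exists_frame x
  let b := Module.Basis.mk (hb x (mem_of_mem_nhds hU)).1 (hb x (mem_of_mem_nhds hU)).2.ge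
  refine ⟨b.constr ℂ fun i => L (e i) x, fun s hs => ?_⟩
  obtain ⟨f, hfs, hfe⟩ := hf s hs
  obtain ⟨χ, hχ, h1, hsupp⟩ := exists_bump (F := F) x hU
  have hx : χ x = 1 := h1.self_of_nhds
  have hLsum : ∀ t : Finset (Fin r), L (fun y => ∑ i ∈ t, (χ y * f i y) • e i y) x
      = ∑ i ∈ t, f i x * L (e i) x := by
    intro t
    induction t using Finset.induction_on with
    | empty =>
      have := hsmul (fun _ => 0) (smoothFun_const 0) _ h.zero_mem x
      simpa using this
    | insert i t hi ih =>
      simp only [Finset.sum_insert hi]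
      have hm : ∀ i, (fun y => (χ y * f i y) • e i y) ∈ Γ := fun i =>
        h.smul_mem _ (hχ.mul (hfs i)) _ (he i)
      rw [hadd _ (hm i) _ (h.sum_mem t hm), ih, hsmul _ (hχ.mul (hfs i)) _ (he i), hx, one_mul]
  -- The expansion in the frame holds only on `U`. After multiplication by `χ` it holds everywhere,
  -- and `χ x = 1` makes this harmless at `x`.
  have hχs : (fun y => χ y • s y) = fun y => ∑ i, (χ y * f i y) • e i y := by
    funext y
    by_cases hy : y ∈ U
    · rw [hfe y hy, Finset.smul_sum]
      simp only [mul_smul]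
    · have : χ y = 0 := image_eq_zero_of_notMem_tsupport fun h => hy (hsupp h)
      simp [this]
  have h2 := hsmul χ hχ s hs x
  rw [hx, one_mul, hχs, hLsum] at h2
  rw [← h2, hfe x (mem_of_mem_nhds hU), map_sum]
  refine Finset.sum_congr rfl fun i _ => ?_
  have : b i = e i x := Module.Basis.mk_apply _ _ i
  rw [map_smul, ← this, b.constr_basis, smul_eq_mul]

/-- The dual bundle. -/
theorem dual [IsManifold 𝓘(ℝ, F) ∞ M] [FiniteDimensional ℝ F] [T2Space M] :
    IsVectorBundle F
      {α : ∀ x, Module.Dual ℂ (E x) | ∀ s ∈ Γ, SmoothFun F (fun x => α x (s x))} where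
  zero_mem s _ := by simpa using smoothFun_const 0
  add_mem α hα β hβ s hs := (hα s hs).add (hβ s hs)
  smul_mem f hf α hα s hs := hf.mul (hα s hs)
  of_local α hα s hs := by
    refine smoothFun_of_local fun x₀ => ?_
    obtain ⟨β, hβ, U, hU, e⟩ := hα x₀
    refine ⟨_, hβ s hs, ?_⟩
    filter_upwards [hU] with x hx
    rw [e x hx]
  exists_frame x₀ := by
    classical
    obtain ⟨r, e, U, hU, he, hb, hf⟩ := h.exists_frame x₀
    obtain ⟨χ, hχ, h1, hsupp⟩ := exists_bump (F := F) x₀ hU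
    let b : ∀ x : U, Module.Basis (Fin r) ℂ (E x) := fun x =>
      Module.Basis.mk (hb x x.2).1 (hb x x.2).2.ge
    have hbe : ∀ (x : U) i, b x i = e i x := fun x i => Module.Basis.mk_apply _ _ i
    -- The dual basis over `U`, cut off by `χ` and extended by zero; it is the dual basis where `χ`
    -- equals 1.
    let θ : Fin r → ∀ x, Module.Dual ℂ (E x) := fun i x =>
      if hx : x ∈ U then χ x • (b ⟨x, hx⟩).coord i else 0
    have hθ : ∀ i, ∀ s ∈ Γ, SmoothFun F (fun x => θ i x (s x)) := by
      intro i s hs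
      obtain ⟨f, hfs, hfe⟩ := hf s hs
      convert hχ.mul (hfs i) using 2 with x
      by_cases hx : x ∈ U
      · simp only [θ, dif_pos hx, LinearMap.smul_apply, smul_eq_mul]
        congr 1
        rw [hfe x hx, map_sum]
        simp only [map_smul, ← hbe ⟨x, hx⟩, Module.Basis.coord_apply, Module.Basis.repr_self]
        simp [Finsupp.single_apply]
      · have : χ x = 0 := image_eq_zero_of_notMem_tsupport fun h => hx (hsupp h)
        simp [θ, dif_neg hx, this]
    obtain ⟨U', hU', hU'a⟩ := (h1.and (show ∀ᶠ x in nhds x₀, x ∈ U from hU)).exists_mem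
    have hθU : ∀ x (hx : x ∈ U'), (fun i => θ i x) = (b ⟨x, (hU'a x hx).2⟩).dualBasis := by
      intro x hx
      funext i
      simp only [θ, dif_pos (hU'a x hx).2, (hU'a x hx).1, one_smul]
      rw [Module.Basis.coe_dualBasis]
    refine ⟨r, θ, U', hU', hθ, fun x hx => ?_, fun α hα =>
      ⟨fun i x => α x (e i x), fun i => hα _ (he i), fun x hx => ?_⟩⟩
    · rw [hθU x hx]
      exact ⟨Module.Basis.linearIndependent _, Module.Basis.span_eq _⟩
    · have h2 := (b ⟨x, (hU'a x hx).2⟩).sum_dual_apply_smul_coord (α x)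
      rw [← h2]
      refine Finset.sum_congr rfl fun i _ => ?_
      have := congrFun (hθU x hx) i
      simp only [Module.Basis.coe_dualBasis] at this
      rw [this, hbe ⟨x, (hU'a x hx).2⟩]

omit h in
theorem prod {Γ' : Set (∀ x, E' x)} (h : IsVectorBundle F Γ) (h' : IsVectorBundle F Γ') :
    IsVectorBundle F {φ : ∀ x, E x × E' x | (fun x => (φ x).1) ∈ Γ ∧ (fun x => (φ x).2) ∈ Γ'} where
  zero_mem := ⟨h.zero_mem, h'.zero_mem⟩
  add_mem s hs t ht := ⟨h.add_mem _ hs.1 _ ht.1, h'.add_mem _ hs.2 _ ht.2⟩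
  smul_mem f hf s hs := ⟨h.smul_mem f hf _ hs.1, h'.smul_mem f hf _ hs.2⟩
  of_local s hs := by
    constructor
    · refine h.of_local _ fun x₀ => ?_
      obtain ⟨t, ht, U, hU, e⟩ := hs x₀
      exact ⟨_, ht.1, U, hU, fun x hx => by rw [e x hx]⟩
    · refine h'.of_local _ fun x₀ => ?_
      obtain ⟨t, ht, U, hU, e⟩ := hs x₀
      exact ⟨_, ht.2, U, hU, fun x hx => by rw [e x hx]⟩
  exists_frame x₀ := by
    obtain ⟨r, e, U, hU, he, hb, hf⟩ := h.exists_frame x₀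
    obtain ⟨r', e', U', hU', he', hb', hf'⟩ := h'.exists_frame x₀
    let ε : Fin r ⊕ Fin r' → ∀ x, E x × E' x :=
      Sum.elim (fun i x => (e i x, 0)) (fun i x => (0, e' i x))
    let b : ∀ x, x ∈ U ∩ U' → Module.Basis (Fin r ⊕ Fin r') ℂ (E x × E' x) := fun x hx =>
      (Module.Basis.mk (hb x hx.1).1 (hb x hx.1).2.ge).prod
        (Module.Basis.mk (hb' x hx.2).1 (hb' x hx.2).2.ge)
    have hbε : ∀ x (hx : x ∈ U ∩ U'), (fun i => ε i x) = b x hx := by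
      intro x hx
      funext i
      rcases i with i | i <;> simp [ε, b]
    refine ⟨r + r', fun i => ε (finSumFinEquiv.symm i), U ∩ U', Filter.inter_mem hU hU',
      fun i => ?_, fun x hx => ?_, fun s hs => ?_⟩
    · rcases hi : finSumFinEquiv.symm i with j | j <;> simp only [hi, ε, Sum.elim_inl, Sum.elim_inr]
      · exact ⟨he j, h'.zero_mem⟩
      · exact ⟨h.zero_mem, he' j⟩
    · have : (fun i => ε (finSumFinEquiv.symm i) x) = (b x hx).reindex finSumFinEquiv := by
        funext i
        rw [Module.Basis.reindex_apply, ← hbε x hx]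
      rw [this]
      exact ⟨Module.Basis.linearIndependent _, Module.Basis.span_eq _⟩
    · obtain ⟨f, hfs, hfe⟩ := hf _ hs.1
      obtain ⟨f', hfs', hfe'⟩ := hf' _ hs.2
      refine ⟨fun i => Sum.elim f f' (finSumFinEquiv.symm i), fun i => ?_, fun x hx => ?_⟩
      · rcases hi : finSumFinEquiv.symm i with j | j <;> simp only [hi, Sum.elim_inl, Sum.elim_inr]
        · exact hfs j
        · exact hfs' j
      · rw [finSumFinEquiv.symm.sum_comp (fun i => Sum.elim f f' i x • ε i x), Fintype.sum_sum_type]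
        refine Prod.ext ?_ ?_
        · simp [ε, Prod.fst_sum, hfe x hx.1]
        · simp [ε, Prod.snd_sum, hfe' x hx.2]

end IsVectorBundle

namespace CourantData

variable {C : CourantData F E}

/-- The vector chosen by `epsilon` is unique: the pairing is nondegenerate and sections take every
value in a fibre. -/
theorem represent_eq (hb : IsVectorBundle F C.Γ)
    (hn : ∀ x (u : E x), (∀ v, C.pairing x u v = 0) → u = 0) {L : (∀ x, E x) → M → ℂ} {x : M}
    {v : E x} (hv : ∀ ψ ∈ C.Γ, C.pairing x v (ψ x) = L ψ x) : C.represent L x = v := by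
  have hspec : ∀ ψ ∈ C.Γ, C.pairing x (C.represent L x) (ψ x) = L ψ x :=
    Classical.epsilon_spec (p := fun v : E x => ∀ ψ ∈ C.Γ, C.pairing x v (ψ x) = L ψ x) ⟨v, hv⟩
  refine sub_eq_zero.1 (hn x _ fun w => ?_)
  obtain ⟨ψ, hψ, rfl⟩ := hb.exists_section w
  rw [map_sub, LinearMap.sub_apply, hspec ψ hψ, hv ψ hψ, sub_self]

/-- A functional linear over smooth functions is a linear form on each fibre, and a nondegenerate
pairing on a finite-dimensional fibre represents every linear form. Thus the chosen vector has the
required property. -/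
theorem pairing_represent [IsManifold 𝓘(ℝ, F) ∞ M] [FiniteDimensional ℝ F] [T2Space M]
    (hb : IsVectorBundle F C.Γ)
    (hn : ∀ x (u : E x), (∀ v, C.pairing x u v = 0) → u = 0) {L : (∀ x, E x) → M → ℂ}
    (hadd : ∀ s ∈ C.Γ, ∀ t ∈ C.Γ, ∀ x, L (fun y => s y + t y) x = L s x + L t x)
    (hsmul : ∀ f : M → ℂ, SmoothFun F f → ∀ s ∈ C.Γ, ∀ x, L (fun y => f y • s y) x = f x * L s x)
    {ψ : ∀ x, E x} (hψ : ψ ∈ C.Γ) (x : M) : C.pairing x (C.represent L x) (ψ x) = L ψ x := by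
  obtain ⟨ℓ, hℓ⟩ := hb.exists_dual hadd hsmul x
  have := hb.finiteDimensional x
  have hinj : Function.Injective (C.pairing x) := by
    rw [← LinearMap.ker_eq_bot, LinearMap.ker_eq_bot']
    exact fun u hu => hn x u fun v => by rw [hu]; rfl
  have hsurj : Function.Surjective (C.pairing x) :=
    (LinearMap.injective_iff_surjective_of_finrank_eq_finrank
      (Subspace.dual_finrank_eq (K := ℂ) (V := E x)).symm).1 hinj
  obtain ⟨v, hv⟩ := hsurj ℓ
  have hv' : ∀ ψ ∈ C.Γ, C.pairing x v (ψ x) = L ψ x := fun ψ hψ => by rw [hv, hℓ ψ hψ]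
  rw [represent_eq hb hn hv', hv' ψ hψ]

end CourantData

end Bundles

/-! ### Formal consequences of the axioms; transport along isomorphisms -/

section Courant

variable {F : Type*} [NormedAddCommGroup F] [NormedSpace ℝ F] [FiniteDimensional ℝ F]
  {M : Type*} [TopologicalSpace M] [T2Space M] [ChartedSpace F M] [IsManifold 𝓘(ℝ, F) ∞ M]
  {E : M → Type*} [∀ x, AddCommGroup (E x)] [∀ x, Module ℂ (E x)]
  {E' : M → Type*} [∀ x, AddCommGroup (E' x)] [∀ x, Module ℂ (E' x)]

/-! ### Consequences of the axioms of a Courant algebroid -/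

namespace IsCourantAlgebroid

variable {C : CourantData F E} (h : IsCourantAlgebroid C)

include h

omit [FiniteDimensional ℝ F] [T2Space M] in
theorem ip_comm (φ ψ : ∀ x, E x) (x : M) : C.ip φ ψ x = C.ip ψ φ x := h.pairing_symm _ _ _

omit [FiniteDimensional ℝ F] [T2Space M] in
theorem ext_ip {x : M} {u v : E x} (huv : ∀ ψ ∈ C.Γ, C.pairing x u (ψ x) = C.pairing x v (ψ x)) :
    u = v := by
  refine sub_eq_zero.1 (h.pairing_nondegenerate x _ fun w => ?_)
  obtain ⟨ψ, hψ, rfl⟩ := h.bundle.exists_section w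
  rw [map_sub, LinearMap.sub_apply, huv ψ hψ, sub_self]

theorem pairing_D (f : M → ℂ) {ψ : ∀ x, E x} (hψ : ψ ∈ C.Γ) (x : M) :
    C.pairing x (C.D f x) (ψ x) = C.act ψ f x :=
  C.pairing_represent h.bundle h.pairing_nondegenerate
    (fun s _ t _ x => by simp [CourantData.act]) (fun f _ s _ x => by simp [CourantData.act]) hψ x

omit [FiniteDimensional ℝ F] [T2Space M] in
theorem ip_add_add {φ ψ : ∀ x, E x} (x : M) :
    C.ip (fun y => φ y + ψ y) (fun y => φ y + ψ y) x
      = C.ip φ φ x + 2 * C.ip φ ψ x + C.ip ψ ψ x := by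
  have := h.pairing_symm x (ψ x) (φ x)
  simp only [CourantData.ip, map_add, LinearMap.add_apply, this]
  ring

omit [FiniteDimensional ℝ F] [T2Space M] in
theorem act_ip_add_add (χ : ∀ x, E x) {φ ψ : ∀ x, E x} (hφ : φ ∈ C.Γ) (hψ : ψ ∈ C.Γ) (x : M) :
    C.act χ (C.ip (fun y => φ y + ψ y) (fun y => φ y + ψ y)) x
      = C.act χ (C.ip φ φ) x + 2 * C.act χ (C.ip φ ψ) x + C.act χ (C.ip ψ ψ) x := by
  have h1 := h.pairing_smooth φ hφ φ hφ
  have h2 := h.pairing_smooth φ hφ ψ hψ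
  have h3 := h.pairing_smooth ψ hψ ψ hψ
  have e : C.ip (fun y => φ y + ψ y) (fun y => φ y + ψ y)
      = fun y => (C.ip φ φ y + 2 * C.ip φ ψ y) + C.ip ψ ψ y := funext fun y => h.ip_add_add y
  have h4 := (smoothFun_const (F := F) 2).mul h2
  rw [CourantData.act, e, cDeriv_add (h1.add h4) h3, cDeriv_add h1 h4, cDeriv_const_mul _ h2]
  rfl

/-- Polarisation of `φ ⋄ φ = 𝒟⟨φ, φ⟩/2`, paired with a test section. -/
theorem ip_bracket_add_swap {φ ψ χ : ∀ x, E x} (hφ : φ ∈ C.Γ) (hψ : ψ ∈ C.Γ) (hχ : χ ∈ C.Γ)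
    (x : M) :
    C.ip (C.bracket φ ψ) χ x + C.ip (C.bracket ψ φ) χ x = C.act χ (C.ip φ ψ) x := by
  have hs := h.bundle.add_mem φ hφ ψ hψ
  have key : ∀ θ ∈ C.Γ, C.pairing x (C.bracket θ θ x) (χ x)
      = (1 / 2 : ℂ) * C.act χ (C.ip θ θ) x := by
    intro θ hθ
    rw [h.bracket_self θ hθ, map_smul, LinearMap.smul_apply, h.pairing_D _ hχ, smul_eq_mul]
  have h1 := key _ hs
  rw [h.bracket_add_left φ hφ ψ hψ _ hs, h.bracket_add_right φ hφ φ hφ ψ hψ,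
    h.bracket_add_right ψ hψ φ hφ ψ hψ, h.act_ip_add_add χ hφ hψ] at h1
  simp only [map_add, LinearMap.add_apply, key φ hφ, key ψ hψ] at h1
  simp only [CourantData.ip] at h1 ⊢
  linear_combination h1

omit [FiniteDimensional ℝ F] [T2Space M] in
-- Polarisation of the invariance axiom.
theorem act_ip {φ ψ χ : ∀ x, E x} (hφ : φ ∈ C.Γ) (hψ : ψ ∈ C.Γ) (hχ : χ ∈ C.Γ) (x : M) :
    C.act φ (C.ip ψ χ) x = C.ip (C.bracket φ ψ) χ x + C.ip ψ (C.bracket φ χ) x := by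
  have h1 := h.ad_invariant φ hφ _ (h.bundle.add_mem ψ hψ χ hχ) x
  rw [h.act_ip_add_add φ hψ hχ, h.ad_invariant φ hφ ψ hψ, h.ad_invariant φ hφ χ hχ] at h1
  simp only [CourantData.ip] at h1 ⊢
  rw [h.bracket_add_right φ hφ ψ hψ χ hχ] at h1
  simp only [map_add, LinearMap.add_apply] at h1
  rw [h.pairing_symm x (ψ x) (C.bracket φ χ x)]
  linear_combination (1 / 2 : ℂ) * h1

/-- The bracket of orthogonal sections is skew-symmetric. -/
theorem bracket_swap {φ ψ : ∀ x, E x} (hφ : φ ∈ C.Γ) (hψ : ψ ∈ C.Γ) (h0 : ∀ x, C.ip φ ψ x = 0)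
    (x : M) : C.bracket φ ψ x = - C.bracket ψ φ x := by
  refine h.ext_ip fun χ hχ => ?_
  have h1 := h.ip_bracket_add_swap hφ hψ hχ x
  have e : C.ip φ ψ = fun _ => 0 := funext h0
  rw [CourantData.act, e, cDeriv_const] at h1
  simp only [CourantData.ip] at h1
  rw [map_neg, LinearMap.neg_apply]
  linear_combination h1

/-- The general rule has a further term `⟨φ, ψ⟩ 𝒟 f`, absent here by orthogonality. Skew-symmetry
reduces the rule to the Leibniz rule on the right. It is the source of tensoriality of the
connections of a splitting. -/
theorem bracket_smul_left_of_orthogonal {φ ψ : ∀ x, E x} (hφ : φ ∈ C.Γ) (hψ : ψ ∈ C.Γ)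
    (h0 : ∀ x, C.ip φ ψ x = 0) {f : M → ℂ} (hf : SmoothFun F f) (x : M) :
    C.bracket (fun y => f y • φ y) ψ x = f x • C.bracket φ ψ x - C.act ψ f x • φ x := by
  have h1 : ∀ x, C.ip (fun y => f y • φ y) ψ x = 0 := fun x => by
    have := h0 x
    simp only [CourantData.ip] at this ⊢
    rw [map_smul, LinearMap.smul_apply, this, smul_zero]
  rw [h.bracket_swap (h.bundle.smul_mem f hf φ hφ) hψ h1, h.leibniz ψ hψ φ hφ f hf,
    h.bracket_swap hφ hψ h0]
  module

omit [FiniteDimensional ℝ F] [T2Space M] in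
theorem zero_bracket {ψ : ∀ x, E x} (hψ : ψ ∈ C.Γ) (x : M) : C.bracket (fun _ => 0) ψ x = 0 := by
  simpa using h.bracket_smul_left 0 _ h.bundle.zero_mem ψ hψ x

omit [FiniteDimensional ℝ F] [T2Space M] in
theorem bracket_zero {φ : ∀ x, E x} (hφ : φ ∈ C.Γ) (x : M) : C.bracket φ (fun _ => 0) x = 0 := by
  simpa using h.bracket_smul_right 0 φ hφ _ h.bundle.zero_mem x

end IsCourantAlgebroid

/-- A Courant structure can be transported along an isomorphism. -/
theorem IsCourantAlgebroid.of_isomorphic {C : CourantData F E} {C' : CourantData F E'}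
    (h' : IsCourantAlgebroid C') (hi : CourantIsomorphic C C') : IsCourantAlgebroid C := by
  obtain ⟨Φ, hΓ, hp, ha, hb⟩ := hi
  have hip : ∀ φ ψ : ∀ x, E x, C'.ip (fun x => Φ x (φ x)) (fun x => Φ x (ψ x)) = C.ip φ ψ :=
    fun φ ψ => funext fun x => hp x _ _
  have hact : ∀ (φ : ∀ x, E x) f x, C'.act (fun x => Φ x (φ x)) f x = C.act φ f x :=
    fun φ f x => by simp only [CourantData.act, ha]
  have hbf : ∀ φ ∈ C.Γ, ∀ ψ ∈ C.Γ, (fun x => Φ x (C.bracket φ ψ x))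
      = C'.bracket (fun x => Φ x (φ x)) (fun x => Φ x (ψ x)) :=
    fun φ hφ ψ hψ => funext fun x => (hb φ hφ ψ hψ x).symm
  have hbm : ∀ φ ∈ C.Γ, ∀ ψ ∈ C.Γ, C.bracket φ ψ ∈ C.Γ := fun φ hφ ψ hψ => by
    rw [hΓ, hbf φ hφ ψ hψ]
    exact h'.bracket_mem _ ((hΓ φ).1 hφ) _ ((hΓ ψ).1 hψ)
  have hsymm : ∀ t : ∀ x, E' x, (fun x => (Φ x).symm (t x)) ∈ C.Γ ↔ t ∈ C'.Γ := fun t => by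
    rw [hΓ]; simp
  have bundle : IsVectorBundle F C.Γ :=
    { zero_mem := by rw [hΓ]; simpa using h'.bundle.zero_mem
      add_mem := fun s hs t ht => by
        rw [hΓ] at hs ht ⊢; simpa using h'.bundle.add_mem _ hs _ ht
      smul_mem := fun f hf s hs => by
        rw [hΓ] at hs ⊢; simpa using h'.bundle.smul_mem f hf _ hs
      of_local := fun s hs => by
        rw [hΓ]
        refine h'.bundle.of_local _ fun x₀ => ?_
        obtain ⟨t, ht, U, hU, e⟩ := hs x₀
        exact ⟨_, (hΓ t).1 ht, U, hU, fun x hx => by rw [e x hx]⟩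
      exists_frame := fun x₀ => by
        obtain ⟨r, e, U, hU, he, hb, hf⟩ := h'.bundle.exists_frame x₀
        refine ⟨r, fun i x => (Φ x).symm (e i x), U, hU, fun i => (hsymm _).2 (he i),
          fun x hx => ⟨?_, ?_⟩, fun s hs => ?_⟩
        · exact (hb x hx).1.map' (Φ x).symm.toLinearMap (LinearEquiv.ker _)
        · have := congrArg (Submodule.map (Φ x).symm.toLinearMap) (hb x hx).2
          rw [Submodule.map_span, ← Set.range_comp, Submodule.map_top, LinearEquiv.range] at this
          exact this
        · obtain ⟨f, hfs, hfe⟩ := hf _ ((hΓ s).1 hs)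
          refine ⟨f, hfs, fun x hx => ?_⟩
          rw [← (Φ x).symm_apply_apply (s x), hfe x hx]
          simp }
  have nondeg : ∀ x (u : E x), (∀ v, C.pairing x u v = 0) → u = 0 := fun x u hu => by
    have : Φ x u = 0 := h'.pairing_nondegenerate x _ fun v => by
      rw [← (Φ x).apply_symm_apply v, hp, hu]
    simpa using this
  -- `𝒟` is determined by the pairing and the anchor, both of which `Φ` preserves.
  have hD : ∀ f x, Φ x (C.D f x) = C'.D f x := fun f x => by
    rw [← LinearEquiv.eq_symm_apply]
    refine C.represent_eq bundle nondeg fun ψ hψ => ?_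
    rw [← hp, LinearEquiv.apply_symm_apply, h'.pairing_D f ((hΓ ψ).1 hψ), hact]
  exact
    { bundle := bundle
      pairing_symm := fun x u v => by rw [← hp, ← hp, h'.pairing_symm]
      pairing_nondegenerate := nondeg
      pairing_smooth := fun φ hφ ψ hψ => by
        rw [← hip]; exact h'.pairing_smooth _ ((hΓ φ).1 hφ) _ ((hΓ ψ).1 hψ)
      anchor_smooth := fun φ hφ => by
        simpa only [ha] using h'.anchor_smooth _ ((hΓ φ).1 hφ)
      bracket_mem := hbm
      bracket_add_left := fun φ₁ h₁ φ₂ h₂ ψ hψ x => by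
        apply (Φ x).injective
        rw [map_add, ← hb _ (bundle.add_mem _ h₁ _ h₂) _ hψ, ← hb _ h₁ _ hψ, ← hb _ h₂ _ hψ,
          ← h'.bracket_add_left _ ((hΓ _).1 h₁) _ ((hΓ _).1 h₂) _ ((hΓ _).1 hψ)]
        simp only [map_add]
      bracket_smul_left := fun c φ hφ ψ hψ x => by
        apply (Φ x).injective
        rw [map_smul, ← hb _ (bundle.const_smul_mem c hφ) _ hψ, ← hb _ hφ _ hψ,
          ← h'.bracket_smul_left c _ ((hΓ _).1 hφ) _ ((hΓ _).1 hψ)]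
        simp only [map_smul]
      bracket_add_right := fun φ hφ ψ₁ h₁ ψ₂ h₂ x => by
        apply (Φ x).injective
        rw [map_add, ← hb _ hφ _ (bundle.add_mem _ h₁ _ h₂), ← hb _ hφ _ h₁, ← hb _ hφ _ h₂,
          ← h'.bracket_add_right _ ((hΓ _).1 hφ) _ ((hΓ _).1 h₁) _ ((hΓ _).1 h₂)]
        simp only [map_add]
      bracket_smul_right := fun c φ hφ ψ hψ x => by
        apply (Φ x).injective
        rw [map_smul, ← hb _ hφ _ (bundle.const_smul_mem c hψ), ← hb _ hφ _ hψ,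
          ← h'.bracket_smul_right c _ ((hΓ _).1 hφ) _ ((hΓ _).1 hψ)]
        simp only [map_smul]
      jacobi := fun φ hφ φ₁ h₁ φ₂ h₂ x => by
        apply (Φ x).injective
        rw [map_add, ← hb _ hφ _ (hbm _ h₁ _ h₂), ← hb _ h₁ _ (hbm _ hφ _ h₂),
          ← hb _ (hbm _ hφ _ h₁) _ h₂, hbf _ h₁ _ h₂, hbf _ hφ _ h₂, hbf _ hφ _ h₁]
        exact h'.jacobi _ ((hΓ _).1 hφ) _ ((hΓ _).1 h₁) _ ((hΓ _).1 h₂) x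
      leibniz := fun φ hφ ψ hψ f hf x => by
        apply (Φ x).injective
        rw [map_add, map_smul, map_smul, ← hb _ hφ _ (bundle.smul_mem f hf _ hψ), ← hb _ hφ _ hψ,
          ← hact, ← h'.leibniz _ ((hΓ _).1 hφ) _ ((hΓ _).1 hψ) f hf]
        simp only [map_smul]
      bracket_self := fun φ hφ x => by
        apply (Φ x).injective
        rw [map_smul, hD, ← hb _ hφ _ hφ, h'.bracket_self _ ((hΓ _).1 hφ), hip]
      ad_invariant := fun φ hφ ψ hψ x => by
        have := h'.ad_invariant _ ((hΓ _).1 hφ) _ ((hΓ _).1 hψ) x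
        rw [hip, hact, ← hbf _ hφ _ hψ, hip] at this
        exact this }

end Courant

/-! ### Matched sums, and the matched pair identities as components of Jacobi -/

section Matched

variable {F : Type*} [NormedAddCommGroup F] [NormedSpace ℝ F] [FiniteDimensional ℝ F]
  {M : Type*} [TopologicalSpace M] [T2Space M] [ChartedSpace F M] [IsManifold 𝓘(ℝ, F) ∞ M]
  {E : M → Type*} [∀ x, AddCommGroup (E x)] [∀ x, Module ℂ (E x)]
  {E' : M → Type*} [∀ x, AddCommGroup (E' x)] [∀ x, Module ℂ (E' x)]
  {G : M → Type*} [∀ x, AddCommGroup (G x)] [∀ x, Module ℂ (G x)]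

/-! ### Connections -/

namespace IsConnection

variable {C : CourantData F E} {C' : CourantData F E'}
  {n : (∀ x, E x) → (∀ x, E' x) → (∀ x, E' x)} (hn : IsConnection C C' n)

include hn

omit [FiniteDimensional ℝ F] [T2Space M] [IsManifold 𝓘(ℝ, F) ∞ M]

theorem const_smul_left (c : ℂ) {a : ∀ x, E x} {v : ∀ x, E' x} (ha : a ∈ C.Γ) (hv : v ∈ C'.Γ)
    (x : M) : n (fun y => c • a y) v x = c • n a v x :=
  hn.smul_left (fun _ => c) (smoothFun_const c) a ha v hv x

theorem const_smul_right (c : ℂ) {a : ∀ x, E x} {v : ∀ x, E' x} (ha : a ∈ C.Γ) (hv : v ∈ C'.Γ)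
    (x : M) : n a (fun y => c • v y) x = c • n a v x := by
  rw [hn.leibniz (fun _ => c) (smoothFun_const c) a ha v hv, CourantData.act, cDeriv_const,
    zero_smul, zero_add]

theorem neg_left {a : ∀ x, E x} {v : ∀ x, E' x} (ha : a ∈ C.Γ) (hv : v ∈ C'.Γ)
    (x : M) : n (fun y => - a y) v x = - n a v x := by
  simpa using hn.const_smul_left (-1) ha hv x

theorem zero_left {v : ∀ x, E' x} (hz : (fun _ => 0) ∈ C.Γ) (hv : v ∈ C'.Γ) (x : M) :
    n (fun _ => 0) v x = 0 := by
  simpa using hn.const_smul_left 0 hz hv x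

theorem zero_right {a : ∀ x, E x} (ha : a ∈ C.Γ) (hz : (fun _ => 0) ∈ C'.Γ) (x : M) :
    n a (fun _ => 0) x = 0 := by
  simpa using hn.const_smul_right 0 ha hz x

end IsConnection

/-- The sum `Ω(v, w) + 𝒟 ⟨v, w⟩ / 2`. -/
noncomputable def mixedPart (C : CourantData F E) (C' : CourantData F E')
    (n : (∀ x, E x) → (∀ x, E' x) → (∀ x, E' x)) (v w : ∀ x, E' x) : ∀ x, E x :=
  fun x => skewPart C C' n v w x + (1 / 2 : ℂ) • C.D (C'.ip v w) x

section Mixed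

variable {C : CourantData F E} {C' : CourantData F E'}
  {n : (∀ x, E x) → (∀ x, E' x) → (∀ x, E' x)}

theorem pairing_skewPart (h : IsCourantAlgebroid C)
    (hn : IsConnection C C' n) {v w : ∀ x, E' x} (hv : v ∈ C'.Γ) (hw : w ∈ C'.Γ) {c : ∀ x, E x}
    (hc : c ∈ C.Γ) (x : M) : C.pairing x (skewPart C C' n v w x) (c x)
      = (1 / 2 : ℂ) * (C'.ip (n c v) w x - C'.ip v (n c w) x) :=
  C.pairing_represent h.bundle h.pairing_nondegenerate
    (fun s hs t ht x => by
      simp only [CourantData.ip, hn.add_left s hs t ht v hv, hn.add_left s hs t ht w hw, map_add,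
        LinearMap.add_apply]
      ring)
    (fun f hf s hs x => by
      simp only [CourantData.ip, hn.smul_left f hf s hs v hv, hn.smul_left f hf s hs w hw,
        map_smul, LinearMap.smul_apply, smul_eq_mul]
      ring) hc x

/-- `Ω` contributes half the difference of `⟨∇_c v, w⟩` and `⟨v, ∇_c w⟩`; by metricity the `𝒟` term
contributes half their sum. The mixed part of the bracket is therefore an adjoint of the connection.
-/
theorem pairing_mixedPart (h : IsCourantAlgebroid C)
    (hn : IsConnection C C' n) (hm : IsMetric C C' n) {v w : ∀ x, E' x} (hv : v ∈ C'.Γ)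
    (hw : w ∈ C'.Γ) {c : ∀ x, E x} (hc : c ∈ C.Γ) (x : M) :
    C.pairing x (mixedPart C C' n v w x) (c x) = C'.ip (n c v) w x := by
  rw [mixedPart, map_add, LinearMap.add_apply, pairing_skewPart h hn hv hw hc, map_smul,
    LinearMap.smul_apply, h.pairing_D _ hc, hm c hc v hv w hw, smul_eq_mul]
  ring

theorem mixedPart_zero_left (h : IsCourantAlgebroid C) (h' : IsCourantAlgebroid C')
    (hn : IsConnection C C' n) (hm : IsMetric C C' n) {w : ∀ x, E' x}
    (hw : w ∈ C'.Γ) (x : M) : mixedPart C C' n (fun _ => 0) w x = 0 :=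
  h.ext_ip fun c hc => by
    rw [pairing_mixedPart h hn hm h'.bundle.zero_mem hw hc, CourantData.ip,
      hn.zero_right hc h'.bundle.zero_mem]
    simp

theorem mixedPart_zero_right (h : IsCourantAlgebroid C) (h' : IsCourantAlgebroid C')
    (hn : IsConnection C C' n) (hm : IsMetric C C' n) {v : ∀ x, E' x}
    (hv : v ∈ C'.Γ) (x : M) : mixedPart C C' n v (fun _ => 0) x = 0 :=
  h.ext_ip fun c hc => by
    rw [pairing_mixedPart h hn hm hv h'.bundle.zero_mem hc, CourantData.ip]
    simp

theorem mixedPart_neg_right (h : IsCourantAlgebroid C) (h' : IsCourantAlgebroid C')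
    (hn : IsConnection C C' n) (hm : IsMetric C C' n) {v w : ∀ x, E' x}
    (hv : v ∈ C'.Γ) (hw : w ∈ C'.Γ) (x : M) :
    mixedPart C C' n v (fun y => - w y) x = - mixedPart C C' n v w x :=
  h.ext_ip fun c hc => by
    rw [map_neg, LinearMap.neg_apply, pairing_mixedPart h hn hm hv (h'.bundle.neg_mem hw) hc,
      pairing_mixedPart h hn hm hv hw hc]
    simp [CourantData.ip]

theorem skewPart_swap (h : IsCourantAlgebroid C) (h' : IsCourantAlgebroid C')
    (hn : IsConnection C C' n) {v w : ∀ x, E' x} (hv : v ∈ C'.Γ)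
    (hw : w ∈ C'.Γ) (x : M) : skewPart C C' n v w x = - skewPart C C' n w v x :=
  h.ext_ip fun c hc => by
    rw [map_neg, LinearMap.neg_apply, pairing_skewPart h hn hv hw hc,
      pairing_skewPart h hn hw hv hc, h'.ip_comm (n c w), h'.ip_comm (n c v)]
    ring

end Mixed

/-! ### A matched sum that is a Courant algebroid comes from a matched pair -/

omit [FiniteDimensional ℝ F] [T2Space M] [IsManifold 𝓘(ℝ, F) ∞ M] in
-- The construction is symmetric in the two algebroids, so each identity has to be derived for one
-- of them only.
theorem matchedSum_isomorphic_swap (C₁ : CourantData F E) (C₂ : CourantData F E')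
    (r : (∀ x, E x) → (∀ x, E' x) → (∀ x, E' x))
    (l : (∀ x, E' x) → (∀ x, E x) → (∀ x, E x)) :
    CourantIsomorphic (matchedSum C₂ C₁ l r) (matchedSum C₁ C₂ r l) :=
  ⟨fun x => LinearEquiv.prodComm ℂ (E' x) (E x), fun _ => and_comm,
    fun _ _ _ => add_comm _ _, fun _ _ => add_comm _ _, fun _ _ _ _ _ => rfl⟩

section FromSum

variable {C₁ : CourantData F E} {C₂ : CourantData F E'}
  {r : (∀ x, E x) → (∀ x, E' x) → (∀ x, E' x)} {l : (∀ x, E' x) → (∀ x, E x) → (∀ x, E x)}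

omit [FiniteDimensional ℝ F] [T2Space M] [IsManifold 𝓘(ℝ, F) ∞ M] in
theorem matchedSum_bracket (φ ψ : ∀ x, E x × E' x) (x : M) :
    (matchedSum C₁ C₂ r l).bracket φ ψ x
      = (C₁.bracket (fun y => (φ y).1) (fun y => (ψ y).1) x
          + l (fun y => (φ y).2) (fun y => (ψ y).1) x - l (fun y => (ψ y).2) (fun y => (φ y).1) x
          + mixedPart C₁ C₂ r (fun y => (φ y).2) (fun y => (ψ y).2) x,
        C₂.bracket (fun y => (φ y).2) (fun y => (ψ y).2) x
          + r (fun y => (φ y).1) (fun y => (ψ y).2) x - r (fun y => (ψ y).1) (fun y => (φ y).2) x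
          + mixedPart C₂ C₁ l (fun y => (φ y).1) (fun y => (ψ y).1) x) := by
  simp only [matchedSum, mixedPart, add_assoc]

variable (h₁ : IsCourantAlgebroid C₁) (h₂ : IsCourantAlgebroid C₂)
  (hr : IsConnection C₁ C₂ r) (hl : IsConnection C₂ C₁ l)
  (mr : IsMetric C₁ C₂ r) (ml : IsMetric C₂ C₁ l)
  (hS : IsCourantAlgebroid (matchedSum C₁ C₂ r l))

include h₁ h₂ hr hl mr ml

omit ml in
-- This and the next three formulas cover the brackets with one argument inside a summand, which are
-- the ones that occur in the Jacobi identities below.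
theorem matchedSum_bracket_left {a b : ∀ x, E x} {β : ∀ x, E' x} (hb : b ∈ C₁.Γ)
    (hβ : β ∈ C₂.Γ) : (matchedSum C₁ C₂ r l).bracket (fun y => (a y, 0)) (fun y => (b y, β y))
      = fun x => (C₁.bracket a b x - l β a x, r a β x + mixedPart C₂ C₁ l a b x) := by
  funext x
  rw [matchedSum_bracket]
  simp only [h₂.zero_bracket hβ, hl.zero_left h₂.bundle.zero_mem hb,
    hr.zero_right hb h₂.bundle.zero_mem, mixedPart_zero_left h₁ h₂ hr mr hβ]
  simp

omit mr in
theorem matchedSum_bracket_right {b : ∀ x, E x} {α β : ∀ x, E' x} (hb : b ∈ C₁.Γ)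
    (hβ : β ∈ C₂.Γ) : (matchedSum C₁ C₂ r l).bracket (fun y => (0, α y)) (fun y => (b y, β y))
      = fun x => (l α b x + mixedPart C₁ C₂ r α β x, C₂.bracket α β x - r b α x) := by
  funext x
  rw [matchedSum_bracket]
  simp only [h₁.zero_bracket hb, hr.zero_left h₁.bundle.zero_mem hβ,
    hl.zero_right hβ h₁.bundle.zero_mem, mixedPart_zero_left h₂ h₁ hl ml hb]
  simp

omit ml in
theorem matchedSum_bracket_of_left {a b : ∀ x, E x} {α : ∀ x, E' x} (ha : a ∈ C₁.Γ)
    (hα : α ∈ C₂.Γ) :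
    (matchedSum C₁ C₂ r l).bracket (fun y => (a y, α y)) (fun y => (b y, 0))
      = fun x => (C₁.bracket a b x + l α b x, - r b α x + mixedPart C₂ C₁ l a b x) := by
  funext x
  rw [matchedSum_bracket]
  simp only [h₂.bracket_zero hα, hl.zero_left h₂.bundle.zero_mem ha,
    hr.zero_right ha h₂.bundle.zero_mem, mixedPart_zero_right h₁ h₂ hr mr hα]
  simp

omit mr in
theorem matchedSum_bracket_of_right {a : ∀ x, E x} {α β : ∀ x, E' x} (ha : a ∈ C₁.Γ)
    (hα : α ∈ C₂.Γ) :
    (matchedSum C₁ C₂ r l).bracket (fun y => (a y, α y)) (fun y => (0, β y))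
      = fun x => (- l β a x + mixedPart C₁ C₂ r α β x, C₂.bracket α β x + r a β x) := by
  funext x
  rw [matchedSum_bracket]
  simp only [h₁.bracket_zero ha, hr.zero_left h₁.bundle.zero_mem hα,
    hl.zero_right hα h₁.bundle.zero_mem, mixedPart_zero_right h₂ h₁ hl ml ha]
  simp

include hS

omit ml in
-- Smoothness comes from closure of the sum under its bracket: the mixed part is the second
-- component of `(a, 0) ⋄ (b, 0)`.
theorem mixedPart_mem {a b : ∀ x, E x} (ha : a ∈ C₁.Γ) (hb : b ∈ C₁.Γ) :
    mixedPart C₂ C₁ l a b ∈ C₂.Γ := by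
  have h := (hS.bracket_mem (fun y => (a y, 0)) ⟨ha, h₂.bundle.zero_mem⟩
    (fun y => (b y, 0)) ⟨hb, h₂.bundle.zero_mem⟩).2
  rw [matchedSum_bracket_left h₁ h₂ hr hl mr hb h₂.bundle.zero_mem] at h
  simpa only [hr.zero_right ha h₂.bundle.zero_mem, zero_add] using h

/-- The first component of the Jacobi identity for `α`, `a₁`, `a₂`. The right-hand side is the mixed
part of `α` with the second component `Ω(a₁, a₂) + 𝒟⟨a₁, a₂⟩/2` of `a₁ ⋄ a₂`. -/
theorem matchedSum_bracketCompatible : BracketCompatible C₂ C₁ l r := by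
  intro α hα a₁ ha₁ a₂ ha₂ B hB x
  obtain rfl : B = mixedPart C₂ C₁ l a₁ a₂ := funext hB
  have hw := mixedPart_mem h₁ h₂ hr hl mr hS ha₁ ha₂
  have z₁ := h₁.bundle.zero_mem
  have z₂ := h₂.bundle.zero_mem
  have J := congrArg Prod.fst (hS.jacobi (fun y => (0, α y)) ⟨z₁, hα⟩
    (fun y => (a₁ y, 0)) ⟨ha₁, z₂⟩ (fun y => (a₂ y, 0)) ⟨ha₂, z₂⟩ x)
  have m₁ := hl.mem α hα a₁ ha₁
  have m₂ := hl.mem α hα a₂ ha₂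
  have n₁ := hr.mem a₁ ha₁ α hα
  have n₂ := hr.mem a₂ ha₂ α hα
  have e0 : (matchedSum C₁ C₂ r l).bracket (fun y => (a₁ y, 0)) (fun y => (a₂ y, 0))
      = fun x => (C₁.bracket a₁ a₂ x, mixedPart C₂ C₁ l a₁ a₂ x) := by
    rw [matchedSum_bracket_left h₁ h₂ hr hl mr ha₂ z₂]
    simp only [hl.zero_left z₂ ha₁, hr.zero_right ha₁ z₂, sub_zero, zero_add]
  have e : ∀ b ∈ C₁.Γ, (matchedSum C₁ C₂ r l).bracket (fun y => (0, α y)) (fun y => (b y, 0))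
      = fun x => (l α b x, - r b α x) := by
    intro b hb
    rw [matchedSum_bracket_right h₁ h₂ hr hl ml hb z₂]
    simp only [mixedPart_zero_right h₁ h₂ hr mr hα, h₂.bracket_zero hα, add_zero, zero_sub]
  rw [e0, e a₁ ha₁, e a₂ ha₂, matchedSum_bracket_right h₁ h₂ hr hl ml
    (h₁.bracket_mem a₁ ha₁ a₂ ha₂) hw, matchedSum_bracket_left h₁ h₂ hr hl mr m₂
    (h₂.bundle.neg_mem n₂), matchedSum_bracket_of_left h₁ h₂ hr hl mr m₁
    (h₂.bundle.neg_mem n₁)] at J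
  simp only [Prod.fst_add, hl.neg_left n₁ ha₂, hl.neg_left n₂ ha₁] at J
  have J' := eq_sub_of_add_eq J
  rw [J']
  simp only [mixedPart]
  abel

omit ml in
-- In the first component of the Jacobi identity for `a₁`, `a₂`, `a₃` the terms with brackets of
-- `C₁` cancel by the Jacobi identity there. What is left are derivatives along mixed parts.
theorem matchedSum_cyclic
    (hD : ∀ f : M → ℂ, SmoothFun F f → ∀ b ∈ C₁.Γ, ∀ x, l (C₂.D f) b x = 0)
    (hDm : ∀ f : M → ℂ, SmoothFun F f → C₂.D f ∈ C₂.Γ)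
    {a₁ a₂ a₃ : ∀ x, E x} (ha₁ : a₁ ∈ C₁.Γ) (ha₂ : a₂ ∈ C₁.Γ) (ha₃ : a₃ ∈ C₁.Γ) (x : M) :
    l (skewPart C₂ C₁ l a₁ a₂) a₃ x + l (skewPart C₂ C₁ l a₂ a₃) a₁ x
      + l (skewPart C₂ C₁ l a₃ a₁) a₂ x = 0 := by
  have z₁ := h₁.bundle.zero_mem
  have z₂ := h₂.bundle.zero_mem
  have J := congrArg Prod.fst (hS.jacobi (fun y => (a₁ y, 0)) ⟨ha₁, z₂⟩
    (fun y => (a₂ y, 0)) ⟨ha₂, z₂⟩ (fun y => (a₃ y, 0)) ⟨ha₃, z₂⟩ x)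
  have e : ∀ a ∈ C₁.Γ, ∀ b ∈ C₁.Γ,
      (matchedSum C₁ C₂ r l).bracket (fun y => (a y, 0)) (fun y => (b y, 0))
      = fun x => (C₁.bracket a b x, mixedPart C₂ C₁ l a b x) := by
    intro a ha b hb
    rw [matchedSum_bracket_left h₁ h₂ hr hl mr hb z₂]
    simp only [hl.zero_left z₂ ha, hr.zero_right ha z₂, sub_zero, zero_add]
  have hm : ∀ {a b : ∀ x, E x}, a ∈ C₁.Γ → b ∈ C₁.Γ → mixedPart C₂ C₁ l a b ∈ C₂.Γ :=
    fun ha hb => mixedPart_mem h₁ h₂ hr hl mr hS ha hb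
  -- The mixed part may be replaced by its skew part, since the difference is a multiple of some `𝒟
  -- f`, along which `l` vanishes.
  have hs : ∀ {a b : ∀ x, E x}, a ∈ C₁.Γ → b ∈ C₁.Γ → ∀ c ∈ C₁.Γ,
      skewPart C₂ C₁ l a b ∈ C₂.Γ ∧ l (skewPart C₂ C₁ l a b) c x = l (mixedPart C₂ C₁ l a b) c x := by
    intro a b ha hb c hc
    have hf := h₁.pairing_smooth a ha b hb
    have hd := h₂.bundle.const_smul_mem (-(1 / 2) : ℂ) (hDm _ hf)
    have e : skewPart C₂ C₁ l a b
        = fun y => mixedPart C₂ C₁ l a b y + (-(1 / 2) : ℂ) • C₂.D (C₁.ip a b) y := by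
      funext y; simp only [mixedPart]; module
    refine ⟨by rw [e]; exact h₂.bundle.add_mem _ (hm ha hb) _ hd, ?_⟩
    rw [e, hl.add_left _ (hm ha hb) _ hd c hc, hl.const_smul_left _ (hDm _ hf) hc, hD _ hf c hc,
      smul_zero, add_zero]
  rw [e a₁ ha₁ a₂ ha₂, e a₁ ha₁ a₃ ha₃, e a₂ ha₂ a₃ ha₃,
    matchedSum_bracket_left h₁ h₂ hr hl mr (h₁.bracket_mem _ ha₂ _ ha₃) (hm ha₂ ha₃),
    matchedSum_bracket_left h₁ h₂ hr hl mr (h₁.bracket_mem _ ha₁ _ ha₃) (hm ha₁ ha₃),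
    matchedSum_bracket_of_left h₁ h₂ hr hl mr (h₁.bracket_mem _ ha₁ _ ha₂) (hm ha₁ ha₂)]
    at J
  simp only [Prod.fst_add, h₁.jacobi a₁ ha₁ a₂ ha₂ a₃ ha₃] at J
  have e13 : skewPart C₂ C₁ l a₃ a₁ = fun y => - skewPart C₂ C₁ l a₁ a₃ y :=
    funext fun y => skewPart_swap h₂ h₁ hl ha₃ ha₁ y
  rw [e13, hl.neg_left (hs ha₁ ha₃ a₂ ha₂).1 ha₂, (hs ha₁ ha₃ a₂ ha₂).2, (hs ha₁ ha₂ a₃ ha₃).2,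
    (hs ha₂ ha₃ a₁ ha₁).2]
  have J' := sub_eq_zero.2 J.symm
  rw [← J']
  abel

/-- The second component of the Jacobi identity for `a`, `b`, `α`, paired with `β`. The curvature of
`r` appears directly; that of `l` comes from moving `l` to the other side of the pairing. -/
theorem matchedSum_curvature {a b : ∀ x, E x} {α β : ∀ x, E' x} (ha : a ∈ C₁.Γ) (hb : b ∈ C₁.Γ)
    (hα : α ∈ C₂.Γ) (hβ : β ∈ C₂.Γ) (x : M) :
    C₂.ip (curvature C₁ r a b α) β x + C₁.ip (curvature C₂ l α β a) b x = 0 := by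
  have z₁ := h₁.bundle.zero_mem
  have z₂ := h₂.bundle.zero_mem
  have hw := mixedPart_mem h₁ h₂ hr hl mr hS ha hb
  have J := congrArg Prod.snd (hS.jacobi (fun y => (a y, 0)) ⟨ha, z₂⟩
    (fun y => (b y, 0)) ⟨hb, z₂⟩ (fun y => (0, α y)) ⟨z₁, hα⟩ x)
  have e0 : (matchedSum C₁ C₂ r l).bracket (fun y => (a y, 0)) (fun y => (b y, 0))
      = fun x => (C₁.bracket a b x, mixedPart C₂ C₁ l a b x) := by
    rw [matchedSum_bracket_left h₁ h₂ hr hl mr hb z₂]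
    simp only [hl.zero_left z₂ ha, hr.zero_right ha z₂, sub_zero, zero_add]
  have e : ∀ c ∈ C₁.Γ, (matchedSum C₁ C₂ r l).bracket (fun y => (c y, 0)) (fun y => (0, α y))
      = fun x => (- l α c x, r c α x) := by
    intro c hc
    rw [matchedSum_bracket_left h₁ h₂ hr hl mr z₁ hα]
    simp only [mixedPart_zero_right h₂ h₁ hl ml hc, h₁.bracket_zero hc, add_zero, zero_sub]
  have ma := hl.mem α hα a ha
  have mb := hl.mem α hα b hb
  have na := hl.mem β hβ a ha
  have nb := hl.mem β hβ b hb
  rw [e0, e a ha, e b hb, matchedSum_bracket_left h₁ h₂ hr hl mr (h₁.bundle.neg_mem mb)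
    (hr.mem b hb α hα), matchedSum_bracket_left h₁ h₂ hr hl mr (h₁.bundle.neg_mem ma)
    (hr.mem a ha α hα), matchedSum_bracket_of_right h₁ h₂ hr hl ml (h₁.bracket_mem a ha b hb)
    hw] at J
  simp only [Prod.snd_add, mixedPart_neg_right h₂ h₁ hl ml ha mb,
    mixedPart_neg_right h₂ h₁ hl ml hb ma] at J
  have P := congrArg (fun v => C₂.pairing x v (β x)) J
  simp only [map_add, map_neg, LinearMap.add_apply, LinearMap.neg_apply,
    pairing_mixedPart h₂ hl ml ha mb hβ, pairing_mixedPart h₂ hl ml hb ma hβ] at P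
  -- With `w` the mixed part of `a` and `b`, these two identities rewrite `⟨w ⋄ α, β⟩` as `β⟨w, α⟩ -
  -- α⟨w, β⟩ + ⟨w, α ⋄ β⟩`. Each pairing with `w` is a value of `l`, and metricity expands the two
  -- derivatives into second covariant derivatives.
  have w1 := h₂.ip_bracket_add_swap hw hα hβ x
  have w2 := h₂.act_ip hα hw hβ x
  have f1 : C₂.ip (mixedPart C₂ C₁ l a b) β = C₁.ip (l β a) b :=
    funext fun y => pairing_mixedPart h₂ hl ml ha hb hβ y
  have f2 : C₂.ip (mixedPart C₂ C₁ l a b) α = C₁.ip (l α a) b :=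
    funext fun y => pairing_mixedPart h₂ hl ml ha hb hα y
  have f3 : C₂.ip (mixedPart C₂ C₁ l a b) (C₂.bracket α β) x = C₁.ip (l (C₂.bracket α β) a) b x :=
    pairing_mixedPart h₂ hl ml ha hb (h₂.bracket_mem α hα β hβ) x
  rw [f2, ml β hβ _ ma b hb] at w1
  rw [f1, ml α hα _ na b hb, f3] at w2
  have c1 := h₁.ip_comm (l β b) (l α a) x
  simp only [CourantData.ip, curvature, map_sub, LinearMap.sub_apply] at P w1 w2 c1 ⊢
  linear_combination P + w1 + w2 - c1

/-- Two Courant algebroids with metric connections form a matched pair if their matched sum is a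
Courant algebroid. -/
theorem IsMatchedPair.of_matchedSum
    (hDr : ∀ f : M → ℂ, SmoothFun F f → ∀ β ∈ C₂.Γ, ∀ x, r (C₁.D f) β x = 0)
    (hDl : ∀ f : M → ℂ, SmoothFun F f → ∀ b ∈ C₁.Γ, ∀ x, l (C₂.D f) b x = 0)
    (hDm₁ : ∀ f : M → ℂ, SmoothFun F f → C₁.D f ∈ C₁.Γ)
    (hDm₂ : ∀ f : M → ℂ, SmoothFun F f → C₂.D f ∈ C₂.Γ) : IsMatchedPair C₁ C₂ r l := by
  have hS' := hS.of_isomorphic (matchedSum_isomorphic_swap C₁ C₂ r l)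
  exact
    { courant₁ := h₁
      courant₂ := h₂
      connection_r := hr
      connection_l := hl
      metric_r := mr
      metric_l := ml
      r_D := hDr
      l_D := hDl
      bracket_l := matchedSum_bracketCompatible h₁ h₂ hr hl mr ml hS
      bracket_r := matchedSum_bracketCompatible h₂ h₁ hl hr ml mr hS'
      curvature := fun a ha b hb α hα β hβ x =>
        matchedSum_curvature h₁ h₂ hr hl mr ml hS ha hb hα hβ x
      cyclic_l := fun a₁ ha₁ a₂ ha₂ a₃ ha₃ x =>
        matchedSum_cyclic h₁ h₂ hr hl mr hS hDl hDm₂ ha₁ ha₂ ha₃ x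
      cyclic_r := fun a₁ ha₁ a₂ ha₂ a₃ ha₃ x =>
        matchedSum_cyclic h₂ h₁ hl hr ml hS' hDr hDm₁ ha₁ ha₂ ha₃ x }

end FromSum

end Matched

/-! ### Orthogonal splittings of a Courant algebroid -/

section Splitting

variable {F : Type*} [NormedAddCommGroup F] [NormedSpace ℝ F] [FiniteDimensional ℝ F]
  {M : Type*} [TopologicalSpace M] [T2Space M] [ChartedSpace F M] [IsManifold 𝓘(ℝ, F) ∞ M]
  {E : M → Type*} [∀ x, AddCommGroup (E x)] [∀ x, Module ℂ (E x)]
  {E' : M → Type*} [∀ x, AddCommGroup (E' x)] [∀ x, Module ℂ (E' x)]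
  {G : M → Type*} [∀ x, AddCommGroup (G x)] [∀ x, Module ℂ (G x)]

/-- An orthogonal splitting `Φ : E ⊕ E' ≃ G` of the bundle underlying `C`, such that the brackets of
`C₁` and `C₂` are the projections of the bracket of `C`, and `r` and `l` are the projections of the
brackets of sections of different summands. -/
structure IsSplitting (C : CourantData F G) (C₁ : CourantData F E) (C₂ : CourantData F E')
    (r : (∀ x, E x) → (∀ x, E' x) → (∀ x, E' x)) (l : (∀ x, E' x) → (∀ x, E x) → (∀ x, E x))
    (Φ : ∀ x, (E x × E' x) ≃ₗ[ℂ] G x) : Prop where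
  mem_iff : ∀ φ : ∀ x, E x × E' x,
    ((fun x => (φ x).1) ∈ C₁.Γ ∧ (fun x => (φ x).2) ∈ C₂.Γ) ↔ (fun x => Φ x (φ x)) ∈ C.Γ
  pairing : ∀ x (u v : E x × E' x),
    C.pairing x (Φ x u) (Φ x v) = C₁.pairing x u.1 v.1 + C₂.pairing x u.2 v.2
  anchor : ∀ x (u : E x × E' x), C.anchor x (Φ x u) = C₁.anchor x u.1 + C₂.anchor x u.2
  bracket_left : ∀ a ∈ C₁.Γ, ∀ b ∈ C₁.Γ, ∀ x, ((Φ x).symm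
    (C.bracket (fun y => Φ y (a y, 0)) (fun y => Φ y (b y, 0)) x)).1 = C₁.bracket a b x
  bracket_right : ∀ α ∈ C₂.Γ, ∀ β ∈ C₂.Γ, ∀ x, ((Φ x).symm
    (C.bracket (fun y => Φ y (0, α y)) (fun y => Φ y (0, β y)) x)).2 = C₂.bracket α β x
  connection_right : ∀ a ∈ C₁.Γ, ∀ β ∈ C₂.Γ, ∀ x, ((Φ x).symm
    (C.bracket (fun y => Φ y (a y, 0)) (fun y => Φ y (0, β y)) x)).2 = r a β x
  connection_left : ∀ α ∈ C₂.Γ, ∀ b ∈ C₁.Γ, ∀ x, ((Φ x).symm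
    (C.bracket (fun y => Φ y (0, α y)) (fun y => Φ y (b y, 0)) x)).1 = l α b x

namespace IsSplitting

variable {C : CourantData F G} {C₁ : CourantData F E} {C₂ : CourantData F E'}
  {r : (∀ x, E x) → (∀ x, E' x) → (∀ x, E' x)} {l : (∀ x, E' x) → (∀ x, E x) → (∀ x, E x)}
  {Φ : ∀ x, (E x × E' x) ≃ₗ[ℂ] G x}

omit [FiniteDimensional ℝ F] [T2Space M] [IsManifold 𝓘(ℝ, F) ∞ M] in
theorem swap (s : IsSplitting C C₁ C₂ r l Φ) :
    IsSplitting C C₂ C₁ l r (fun x => (LinearEquiv.prodComm ℂ (E' x) (E x)).trans (Φ x)) where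
  mem_iff φ := and_comm.trans (s.mem_iff fun x => (φ x).swap)
  pairing x u v := (s.pairing x u.swap v.swap).trans (add_comm _ _)
  anchor x u := (s.anchor x u.swap).trans (add_comm _ _)
  bracket_left := s.bracket_right
  bracket_right := s.bracket_left
  connection_right := s.connection_left
  connection_left := s.connection_right

variable (s : IsSplitting C C₁ C₂ r l Φ) (h : IsCourantAlgebroid C) (h₁ : IsCourantAlgebroid C₁)
  (h₂ : IsCourantAlgebroid C₂)

include s

omit [FiniteDimensional ℝ F] [T2Space M] in
include h₂ in
theorem incl_left_mem {a : ∀ x, E x} (ha : a ∈ C₁.Γ) : (fun x => Φ x (a x, 0)) ∈ C.Γ :=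
  (s.mem_iff fun x => (a x, 0)).1 ⟨ha, h₂.bundle.zero_mem⟩

omit [FiniteDimensional ℝ F] [T2Space M] in
include h₁ in
theorem incl_right_mem {α : ∀ x, E' x} (hα : α ∈ C₂.Γ) : (fun x => Φ x (0, α x)) ∈ C.Γ :=
  (s.mem_iff fun x => (0, α x)).1 ⟨h₁.bundle.zero_mem, hα⟩

omit [FiniteDimensional ℝ F] [T2Space M] [IsManifold 𝓘(ℝ, F) ∞ M] in
theorem orthogonal (a : ∀ x, E x) (α : ∀ x, E' x) (x : M) :
    C.ip (fun x => Φ x (a x, 0)) (fun x => Φ x (0, α x)) x = 0 := by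
  rw [CourantData.ip, s.pairing]; simp

omit [FiniteDimensional ℝ F] [T2Space M] [IsManifold 𝓘(ℝ, F) ∞ M] in
theorem orthogonal' (a : ∀ x, E x) (α : ∀ x, E' x) (x : M) :
    C.ip (fun x => Φ x (0, α x)) (fun x => Φ x (a x, 0)) x = 0 := by
  rw [CourantData.ip, s.pairing]; simp

omit [FiniteDimensional ℝ F] [T2Space M] [IsManifold 𝓘(ℝ, F) ∞ M] in
theorem pairing_fst (x : M) (v : G x) (c : E x) :
    C₁.pairing x ((Φ x).symm v).1 c = C.pairing x v (Φ x (c, 0)) := by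
  conv_rhs => rw [← (Φ x).apply_symm_apply v, s.pairing]
  simp

omit [FiniteDimensional ℝ F] [T2Space M] [IsManifold 𝓘(ℝ, F) ∞ M] in
theorem pairing_snd (x : M) (v : G x) (γ : E' x) :
    C₂.pairing x ((Φ x).symm v).2 γ = C.pairing x v (Φ x (0, γ)) := by
  conv_rhs => rw [← (Φ x).apply_symm_apply v, s.pairing]
  simp

omit [FiniteDimensional ℝ F] [T2Space M] [IsManifold 𝓘(ℝ, F) ∞ M] in
theorem act_incl_left (a : ∀ x, E x) (f : M → ℂ) (x : M) :
    C.act (fun x => Φ x (a x, 0)) f x = C₁.act a f x := by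
  rw [CourantData.act, s.anchor, map_zero, add_zero, CourantData.act]

include h h₁ h₂

/-- The connection is a projected bracket, so its axioms are projected bracket axioms. The one that
is not immediate is tensoriality in the direction: the bracket of `f a` and `v` has an extra
multiple of `a`, which lies in the summand that is projected away. -/
theorem isConnection : IsConnection C₁ C₂ r where
  mem a ha β hβ := by
    have hb := h.bracket_mem _ (s.incl_left_mem h₂ ha) _ (s.incl_right_mem h₁ hβ)
    have := ((s.mem_iff fun x => (Φ x).symm (C.bracket (fun y => Φ y (a y, 0))
      (fun y => Φ y (0, β y)) x)).2 (by simpa using hb)).2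
    simpa only [s.connection_right a ha β hβ] using this
  add_left a ha b hb v hv x := by
    have e : (fun y => Φ y (a y + b y, 0)) = fun y => Φ y (a y, 0) + Φ y (b y, 0) := by
      funext y; rw [← map_add]; simp
    rw [← s.connection_right _ (h₁.bundle.add_mem a ha b hb) v hv, e,
      h.bracket_add_left _ (s.incl_left_mem h₂ ha) _ (s.incl_left_mem h₂ hb) _
      (s.incl_right_mem h₁ hv), map_add, Prod.snd_add, s.connection_right a ha v hv,
      s.connection_right b hb v hv]
  add_right a ha v hv w hw x := by
    have e : (fun y => Φ y (0, v y + w y)) = fun y => Φ y (0, v y) + Φ y (0, w y) := by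
      funext y; rw [← map_add]; simp
    rw [← s.connection_right a ha _ (h₂.bundle.add_mem v hv w hw), e,
      h.bracket_add_right _ (s.incl_left_mem h₂ ha) _ (s.incl_right_mem h₁ hv) _
      (s.incl_right_mem h₁ hw), map_add, Prod.snd_add, s.connection_right a ha v hv,
      s.connection_right a ha w hw]
  smul_left f hf a ha v hv x := by
    have e : (fun y => Φ y (f y • a y, 0)) = fun y => f y • Φ y (a y, 0) := by
      funext y; rw [← map_smul]; simp
    rw [← s.connection_right _ (h₁.bundle.smul_mem f hf a ha) v hv, e,
      h.bracket_smul_left_of_orthogonal (s.incl_left_mem h₂ ha) (s.incl_right_mem h₁ hv)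
      (s.orthogonal a v) hf, map_sub, map_smul, map_smul, LinearEquiv.symm_apply_apply,
      Prod.snd_sub, Prod.smul_snd, Prod.smul_snd, s.connection_right a ha v hv]
    simp
  leibniz f hf a ha v hv x := by
    have e : (fun y => Φ y (0, f y • v y)) = fun y => f y • Φ y (0, v y) := by
      funext y; rw [← map_smul]; simp
    rw [← s.connection_right a ha _ (h₂.bundle.smul_mem f hf v hv), e,
      h.leibniz _ (s.incl_left_mem h₂ ha) _ (s.incl_right_mem h₁ hv) f hf, s.act_incl_left,
      map_add, map_smul, map_smul, LinearEquiv.symm_apply_apply,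
      Prod.snd_add, Prod.smul_snd, Prod.smul_snd, s.connection_right a ha v hv]

omit [FiniteDimensional ℝ F] [T2Space M] in
-- Invariance of the large pairing, for an `a` from one summand and two sections of the other.
theorem isMetric : IsMetric C₁ C₂ r := by
  intro a ha v hv w hw x
  have e : C₂.ip v w = C.ip (fun x => Φ x (0, v x)) (fun x => Φ x (0, w x)) := by
    funext y; rw [CourantData.ip, CourantData.ip, s.pairing]; simp
  rw [e, ← s.act_incl_left, h.act_ip (s.incl_left_mem h₂ ha) (s.incl_right_mem h₁ hv)
    (s.incl_right_mem h₁ hw), h₂.ip_comm v, h.ip_comm (fun x => Φ x (0, v x))]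
  simp only [CourantData.ip, ← s.connection_right a ha v hv, ← s.connection_right a ha w hw,
    s.pairing_snd]

/-- Splitting both arguments yields four brackets. Three are covered by the definition of a
splitting, two of them after orthogonality has been used to reverse one mixed bracket. The fourth,
of two sections of the second summand, is determined by duality. -/
theorem fst_bracket {φ ψ : ∀ x, E x × E' x}
    (hφ : (fun x => (φ x).1) ∈ C₁.Γ ∧ (fun x => (φ x).2) ∈ C₂.Γ)
    (hψ : (fun x => (ψ x).1) ∈ C₁.Γ ∧ (fun x => (ψ x).2) ∈ C₂.Γ) (x : M) :
    ((Φ x).symm (C.bracket (fun y => Φ y (φ y)) (fun y => Φ y (ψ y)) x)).1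
      = C₁.bracket (fun y => (φ y).1) (fun y => (ψ y).1) x
          + l (fun y => (φ y).2) (fun y => (ψ y).1) x - l (fun y => (ψ y).2) (fun y => (φ y).1) x
          + mixedPart C₁ C₂ r (fun y => (φ y).2) (fun y => (ψ y).2) x := by
  obtain ⟨ha, hα⟩ := hφ
  obtain ⟨hb, hβ⟩ := hψ
  have e : ∀ φ : ∀ x, E x × E' x,
      (fun y => Φ y (φ y)) = fun y => Φ y ((φ y).1, 0) + Φ y (0, (φ y).2) := fun φ => by
    funext y; rw [← map_add]; simp
  have ia := s.incl_left_mem h₂ ha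
  have iα := s.incl_right_mem h₁ hα
  have ib := s.incl_left_mem h₂ hb
  have iβ := s.incl_right_mem h₁ hβ
  have hm : ((Φ x).symm (C.bracket (fun y => Φ y (0, (φ y).2)) (fun y => Φ y (0, (ψ y).2)) x)).1
      = mixedPart C₁ C₂ r (fun y => (φ y).2) (fun y => (ψ y).2) x := by
    refine h₁.ext_ip fun c hc => ?_
    have ic := s.incl_left_mem h₂ hc
    rw [pairing_mixedPart h₁ (s.isConnection h h₁ h₂) (s.isMetric h h₁ h₂) hα hβ hc,
      s.pairing_fst]
    -- As `⟨β, c⟩ = 0`, invariance gives `⟨α ⋄ β, c⟩ = -⟨β, α ⋄ c⟩`. Orthogonality of `α` and `c`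
    -- reverses `α ⋄ c`, which leaves the pairing of `∇_c α` with `β`.
    have h1 := h.act_ip iα iβ ic x
    have h2 : C.ip (fun y => Φ y (0, (ψ y).2)) (fun y => Φ y (c y, 0)) = fun _ => 0 :=
      funext (s.orthogonal' c _)
    rw [CourantData.act, h2, cDeriv_const] at h1
    have h3 := h.bracket_swap iα ic (s.orthogonal' c _) x
    simp only [CourantData.ip, h3, map_neg] at h1
    simp only [CourantData.ip, ← s.connection_right c hc _ hα, s.pairing_snd]
    rw [h.pairing_symm x (Φ x (0, (ψ x).2))] at h1
    linear_combination -h1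
  rw [e φ, e ψ, h.bracket_add_left _ ia _ iα _ (h.bundle.add_mem _ ib _ iβ),
    h.bracket_add_right _ ia _ ib _ iβ, h.bracket_add_right _ iα _ ib _ iβ,
    h.bracket_swap ia iβ (s.orthogonal _ _)]
  simp only [map_add, map_neg, Prod.fst_add, Prod.fst_neg, hm, s.bracket_left _ ha _ hb,
    s.connection_left _ hα _ hb, s.connection_left _ hβ _ ha]
  abel

/-- The matched sum of the two parts of a splitting is isomorphic to the split Courant algebroid. -/
theorem isomorphic : CourantIsomorphic (matchedSum C₁ C₂ r l) C := by
  refine ⟨Φ, s.mem_iff, s.pairing, s.anchor, fun φ hφ ψ hψ x => ?_⟩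
  rw [← LinearEquiv.symm_apply_eq, matchedSum_bracket]
  refine Prod.ext (s.fst_bracket h h₁ h₂ hφ hψ x) ?_
  exact s.swap.fst_bracket h h₂ h₁ (φ := fun x => (φ x).swap) (ψ := fun x => (ψ x).swap)
    hφ.symm hψ.symm x

end IsSplitting

end Splitting

/-! ### Cartan calculus on an involutive subbundle and the twisted Dorfman bracket -/

section Twisted

set_option linter.unusedSectionVars false

variable {F : Type*} [NormedAddCommGroup F] [NormedSpace ℝ F]
  {M : Type*} [TopologicalSpace M] [ChartedSpace F M] [IsManifold 𝓘(ℝ, F) ∞ M]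
  {A : M → Type*} [∀ x, AddCommGroup (A x)] [∀ x, Module ℂ (A x)]

namespace TangentSummand

/-- A summand of the complexified tangent bundle is involutive if it is a smooth vector bundle whose
sections are closed under the Lie bracket. -/
structure IsInvolutive (S : TangentSummand F A) : Prop where
  bundle : IsVectorBundle F {V | S.SmoothSection V}
  incl_lie : ∀ V W, S.SmoothSection V → S.SmoothSection W → ∀ x,
    S.incl x (S.lie V W x) = cBracket (S.toField V) (S.toField W) x

namespace IsInvolutive

variable {S : TangentSummand F A} (hS : S.IsInvolutive) {U V W : ∀ x, A x}
  (hU : S.SmoothSection U) (hV : S.SmoothSection V) (hW : S.SmoothSection W)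

include hS

/-! ### The Lie bracket of sections -/

theorem toField_lie (hV : S.SmoothSection V) (hW : S.SmoothSection W) :
    S.toField (S.lie V W) = cBracket (S.toField V) (S.toField W) :=
  funext (hS.incl_lie V W hV hW)

theorem smul_mem {f : M → ℂ} (hf : SmoothFun F f) (hV : S.SmoothSection V) :
    S.SmoothSection (fun x => f x • V x) := hS.bundle.smul_mem f hf V hV

theorem ext_dual {x : M} {η θ : Module.Dual ℂ (A x)}
    (h : ∀ W, S.SmoothSection W → η (W x) = θ (W x)) : η = θ := by
  ext w
  obtain ⟨W, hW, rfl⟩ := hS.bundle.exists_section w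
  exact h W hW

/-- The form chosen by `epsilon` is unique because sections of `A` take every value in a fibre. -/
theorem formOf_eq {L : (∀ x, A x) → M → ℂ} {x : M} {η : Module.Dual ℂ (A x)}
    (h : ∀ W, S.SmoothSection W → η (W x) = L W x) : S.formOf L x = η := by
  have hspec : ∀ W, S.SmoothSection W → S.formOf L x (W x) = L W x :=
    Classical.epsilon_spec (p := fun η : Module.Dual ℂ (A x) =>
      ∀ W, S.SmoothSection W → η (W x) = L W x) ⟨η, h⟩
  exact hS.ext_dual fun W hW => by rw [hspec W hW, h W hW]

variable [FiniteDimensional ℝ F] [T2Space M]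

theorem formOf_apply {L : (∀ x, A x) → M → ℂ}
    (hadd : ∀ V W, S.SmoothSection V → S.SmoothSection W → ∀ x,
      L (fun y => V y + W y) x = L V x + L W x)
    (hsmul : ∀ f : M → ℂ, SmoothFun F f → ∀ V, S.SmoothSection V → ∀ x,
      L (fun y => f y • V y) x = f x * L V x)
    (hW : S.SmoothSection W) (x : M) : S.formOf L x (W x) = L W x := by
  obtain ⟨ℓ, hℓ⟩ := hS.bundle.exists_dual (fun s hs t ht => hadd s t hs ht) hsmul x
  rw [hS.formOf_eq (η := ℓ) hℓ, hℓ W hW]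

theorem lie_mem (hV : S.SmoothSection V) (hW : S.SmoothSection W) : S.SmoothSection (S.lie V W) := by
  have := FiniteDimensional.complete ℝ F
  rw [SmoothSection, hS.toField_lie hV hW]
  exact SmoothField.cBracket hV hW

theorem lie_add_right (hU : S.SmoothSection U) (hV : S.SmoothSection V) (hW : S.SmoothSection W)
    (x : M) : S.lie U (fun y => V y + W y) x = S.lie U V x + S.lie U W x := by
  have e : S.toField (fun y => V y + W y) = fun y => S.toField V y + S.toField W y := by
    funext y; simp [toField]
  rw [lie, e, cBracket_add_right hU hV hW, map_add, lie, lie]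

theorem lie_add_left (hU : S.SmoothSection U) (hV : S.SmoothSection V) (hW : S.SmoothSection W)
    (x : M) : S.lie (fun y => U y + V y) W x = S.lie U W x + S.lie V W x := by
  have e : S.toField (fun y => U y + V y) = fun y => S.toField U y + S.toField V y := by
    funext y; simp [toField]
  rw [lie, e, cBracket_add_left hU hV hW, map_add, lie, lie]

theorem lie_swap (hU : S.SmoothSection U) (hV : S.SmoothSection V) (x : M) :
    S.lie U V x = - S.lie V U x := by
  rw [lie, cBracket_swap hU hV, map_neg, lie]

theorem lie_self (hU : S.SmoothSection U) (x : M) : S.lie U U x = 0 := by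
  have h : (2 : ℂ) • S.lie U U x = 0 := by
    rw [two_smul, ← eq_neg_iff_add_eq_zero]; exact hS.lie_swap hU hU x
  exact (smul_eq_zero.1 h).resolve_left two_ne_zero

theorem lie_smul_right {f : M → ℂ} (hf : SmoothFun F f) (hU : S.SmoothSection U)
    (hV : S.SmoothSection V) (x : M) :
    S.lie U (fun y => f y • V y) x = cDeriv f x (S.incl x (U x)) • V x + f x • S.lie U V x := by
  have e : S.toField (fun y => f y • V y) = fun y => f y • S.toField V y := by
    funext y; simp [toField]
  rw [lie, e, cBracket_smul_right hf hU hV, map_add, map_smul, map_smul, lie]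
  simp only [toField, S.proj_incl]

theorem lie_smul_left {f : M → ℂ} (hf : SmoothFun F f) (hU : S.SmoothSection U)
    (hV : S.SmoothSection V) (x : M) :
    S.lie (fun y => f y • U y) V x = f x • S.lie U V x - cDeriv f x (S.incl x (V x)) • U x := by
  rw [hS.lie_swap (hS.smul_mem hf hU) hV, hS.lie_smul_right hf hV hU, hS.lie_swap hU hV]
  module

theorem lie_jacobi (hU : S.SmoothSection U) (hV : S.SmoothSection V) (hW : S.SmoothSection W)
    (x : M) : S.lie U (S.lie V W) x = S.lie V (S.lie U W) x + S.lie (S.lie U V) W x := by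
  rw [lie, hS.toField_lie hV hW, cBracket_jacobi hU hV hW, map_add, lie, lie,
    hS.toField_lie hU hV, hS.toField_lie hU hW]

theorem cDeriv_lie (hU : S.SmoothSection U) (hV : S.SmoothSection V) {f : M → ℂ}
    (hf : SmoothFun F f) (x : M) :
    cDeriv f x (S.incl x (S.lie U V x))
      = cDeriv (fun y => cDeriv f y (S.incl y (V y))) x (S.incl x (U x))
        - cDeriv (fun y => cDeriv f y (S.incl y (U y))) x (S.incl x (V x)) := by
  have := FiniteDimensional.complete ℝ F
  rw [hS.incl_lie U V hU hV, cDeriv_cBracket hU hV hf]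
  rfl

omit hS in
theorem smoothFun_cDeriv {f : M → ℂ} (hf : SmoothFun F f) (hV : S.SmoothSection V) :
    SmoothFun F (fun x => cDeriv f x (S.incl x (V x))) := hf.cDeriv hV

/-! ### Cartan calculus -/

variable {α β : ∀ x, Module.Dual ℂ (A x)}

/-- Replacing `W` by `f W` produces `(V f) β(W)` in both terms, and these cancel. The defining
functional is thus linear over functions, and a form representing it exists. -/
theorem lieDeriv_apply (hV : S.SmoothSection V) (hβ : S.SmoothDual β) (hW : S.SmoothSection W)
    (x : M) : S.lieDeriv V β x (W x)
      = cDeriv (fun y => β y (W y)) x (S.incl x (V x)) - β x (S.lie V W x) := by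
  refine hS.formOf_apply (L := fun W x =>
    cDeriv (fun y => β y (W y)) x (S.incl x (V x)) - β x (S.lie V W x))
    (fun W Z hW hZ x => ?_) (fun f hf W hW x => ?_) hW x
  · simp only [map_add]
    rw [cDeriv_add (hβ W hW) (hβ Z hZ), hS.lie_add_right hV hW hZ, map_add]
    ring
  · simp only [map_smul, smul_eq_mul]
    rw [cDeriv_mul hf (hβ W hW), hS.lie_smul_right hf hV hW, map_add, map_smul, map_smul]
    simp only [smul_eq_mul]
    ring

theorem contrD_apply (hV : S.SmoothSection V) (hα : S.SmoothDual α) (hW : S.SmoothSection W)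
    (x : M) : S.contrD V α x (W x)
      = cDeriv (fun y => α y (W y)) x (S.incl x (V x))
        - cDeriv (fun y => α y (V y)) x (S.incl x (W x)) - α x (S.lie V W x) := by
  refine hS.formOf_apply (L := fun W x => cDeriv (fun y => α y (W y)) x (S.incl x (V x))
    - cDeriv (fun y => α y (V y)) x (S.incl x (W x)) - α x (S.lie V W x))
    (fun W Z hW hZ x => ?_) (fun f hf W hW x => ?_) hW x
  · simp only [map_add]
    rw [cDeriv_add (hα W hW) (hα Z hZ), hS.lie_add_right hV hW hZ, map_add]
    ring
  · simp only [map_smul, smul_eq_mul]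
    rw [cDeriv_mul hf (hα W hW), hS.lie_smul_right hf hV hW, map_add, map_smul, map_smul]
    simp only [smul_eq_mul]
    ring

end IsInvolutive

/-- The one-form part `ℒ_X β - ι_Y d α + h(X, Y, ·)` of the twisted Dorfman bracket. -/
noncomputable def formBracket (S : TangentSummand F A) (h : ∀ x, (A x) [⋀^Fin 3]→ₗ[ℂ] ℂ)
    (X : ∀ x, A x) (α : ∀ x, Module.Dual ℂ (A x)) (Y : ∀ x, A x)
    (β : ∀ x, Module.Dual ℂ (A x)) (x : M) : Module.Dual ℂ (A x) :=
  S.lieDeriv X β x - S.contrD Y α x + contract (h x) (X x) (Y x)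

/-- A three-form on a summand is smooth if its values on smooth sections are smooth. -/
def SmoothForm (S : TangentSummand F A) (h : ∀ x, (A x) [⋀^Fin 3]→ₗ[ℂ] ℂ) : Prop :=
  ∀ U V W, S.SmoothSection U → S.SmoothSection V → S.SmoothSection W →
    SmoothFun F (fun x => h x ![U x, V x, W x])

/-- A three-form on an involutive summand is closed with respect to the differential of the summand,
regarded as a Lie algebroid. -/
def ClosedForm (S : TangentSummand F A) (h : ∀ x, (A x) [⋀^Fin 3]→ₗ[ℂ] ℂ) : Prop :=
  ∀ V₀ V₁ V₂ V₃, S.SmoothSection V₀ → S.SmoothSection V₁ → S.SmoothSection V₂ →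
    S.SmoothSection V₃ → ∀ x : M,
      cDeriv (fun y => h y ![V₁ y, V₂ y, V₃ y]) x (S.incl x (V₀ x))
        - cDeriv (fun y => h y ![V₀ y, V₂ y, V₃ y]) x (S.incl x (V₁ x))
        + cDeriv (fun y => h y ![V₀ y, V₁ y, V₃ y]) x (S.incl x (V₂ x))
        - cDeriv (fun y => h y ![V₀ y, V₁ y, V₂ y]) x (S.incl x (V₃ x))
        - h x ![S.lie V₀ V₁ x, V₂ x, V₃ x]
        + h x ![S.lie V₀ V₂ x, V₁ x, V₃ x]
        - h x ![S.lie V₀ V₃ x, V₁ x, V₂ x]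
        - h x ![S.lie V₁ V₂ x, V₀ x, V₃ x]
        + h x ![S.lie V₁ V₃ x, V₀ x, V₂ x]
        - h x ![S.lie V₂ V₃ x, V₀ x, V₁ x] = 0

end TangentSummand

section Alternating

variable {V : Type*} [AddCommGroup V] [Module ℂ V] (h : V [⋀^Fin 3]→ₗ[ℂ] ℂ)

theorem alternating_swap (a b c : V) : h ![a, b, c] = - h ![b, a, c] := by
  have := h.map_swap ![b, a, c] (i := 0) (j := 1) (by decide)
  rw [← this]
  congr 1
  ext i; fin_cases i <;> rfl

theorem alternating_swap' (a b c : V) : h ![a, b, c] = - h ![a, c, b] := by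
  have := h.map_swap ![a, c, b] (i := 1) (j := 2) (by decide)
  rw [← this]
  congr 1
  ext i; fin_cases i <;> rfl

theorem alternating_self (a b : V) : h ![a, a, b] = 0 :=
  h.map_eq_zero_of_eq ![a, a, b] (i := 0) (j := 1) rfl (by decide)

theorem alternating_self' (a b : V) : h ![a, b, b] = 0 :=
  h.map_eq_zero_of_eq ![a, b, b] (i := 1) (j := 2) rfl (by decide)

theorem alternating_add_third (a b c d : V) : h ![a, b, c + d] = h ![a, b, c] + h ![a, b, d] := by
  simp only [← contract_apply, map_add]

theorem alternating_smul_third (z : ℂ) (a b c : V) : h ![a, b, z • c] = z * h ![a, b, c] := by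
  simp only [← contract_apply, map_smul, smul_eq_mul]

theorem alternating_add_second (a b c d : V) : h ![a, b + c, d] = h ![a, b, d] + h ![a, c, d] := by
  rw [alternating_swap', alternating_add_third, alternating_swap' h a b, alternating_swap' h a c]
  ring

theorem alternating_smul_second (z : ℂ) (a b c : V) : h ![a, z • b, c] = z * h ![a, b, c] := by
  rw [alternating_swap', alternating_smul_third, alternating_swap' h a b]
  ring

theorem alternating_add_first (a b c d : V) : h ![a + b, c, d] = h ![a, c, d] + h ![b, c, d] := by
  rw [alternating_swap, alternating_add_second, alternating_swap h a c, alternating_swap h b c]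
  ring

theorem alternating_smul_first (z : ℂ) (a b c : V) : h ![z • a, b, c] = z * h ![a, b, c] := by
  rw [alternating_swap, alternating_smul_second, alternating_swap h a b]
  ring

end Alternating

namespace TangentSummand.IsInvolutive

variable [FiniteDimensional ℝ F] [T2Space M]
  {S : TangentSummand F A} (hS : S.IsInvolutive) {h : ∀ x, (A x) [⋀^Fin 3]→ₗ[ℂ] ℂ}
  {X Y Z W : ∀ x, A x} {α β γ : ∀ x, Module.Dual ℂ (A x)}

include hS

theorem formBracket_apply (hX : S.SmoothSection X) (hα : S.SmoothDual α) (hY : S.SmoothSection Y)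
    (hβ : S.SmoothDual β) (hW : S.SmoothSection W) (x : M) :
    S.formBracket h X α Y β x (W x)
      = cDeriv (fun y => β y (W y)) x (S.incl x (X x)) - β x (S.lie X W x)
        - cDeriv (fun y => α y (W y)) x (S.incl x (Y x))
        + cDeriv (fun y => α y (Y y)) x (S.incl x (W x)) + α x (S.lie Y W x)
        + h x ![X x, Y x, W x] := by
  rw [formBracket, LinearMap.add_apply, LinearMap.sub_apply, hS.lieDeriv_apply hX hβ hW,
    hS.contrD_apply hY hα hW, contract_apply]
  ring

theorem formBracket_mem (hh : S.SmoothForm h) (hX : S.SmoothSection X) (hα : S.SmoothDual α)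
    (hY : S.SmoothSection Y) (hβ : S.SmoothDual β) : S.SmoothDual (S.formBracket h X α Y β) := by
  intro W hW
  simp only [hS.formBracket_apply hX hα hY hβ hW]
  exact ((((((hβ W hW).cDeriv hX).sub (hβ _ (hS.lie_mem hX hW))).sub ((hα W hW).cDeriv hY)).add
    ((hα Y hY).cDeriv hW)).add (hα _ (hS.lie_mem hY hW))).add (hh X Y W hX hY hW)

theorem cDeriv_formBracket (hh : S.SmoothForm h) (hX : S.SmoothSection X) (hα : S.SmoothDual α)
    (hY : S.SmoothSection Y) (hβ : S.SmoothDual β) (hW : S.SmoothSection W) (x : M)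
    (v : CTangent F x) :
    cDeriv (fun y => S.formBracket h X α Y β y (W y)) x v
      = cDeriv (fun y => cDeriv (fun y => β y (W y)) y (S.incl y (X y))) x v
        - cDeriv (fun y => β y (S.lie X W y)) x v
        - cDeriv (fun y => cDeriv (fun y => α y (W y)) y (S.incl y (Y y))) x v
        + cDeriv (fun y => cDeriv (fun y => α y (Y y)) y (S.incl y (W y))) x v
        + cDeriv (fun y => α y (S.lie Y W y)) x v
        + cDeriv (fun y => h y ![X y, Y y, W y]) x v := by
  simp only [hS.formBracket_apply hX hα hY hβ hW]
  have h1 := smoothFun_cDeriv (hβ W hW) hX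
  have h2 := hβ _ (hS.lie_mem hX hW)
  have h3 := smoothFun_cDeriv (hα W hW) hY
  have h4 := smoothFun_cDeriv (hα Y hY) hW
  have h5 := hα _ (hS.lie_mem hY hW)
  rw [cDeriv_add ((((h1.sub h2).sub h3).add h4).add h5) (hh X Y W hX hY hW),
    cDeriv_add (((h1.sub h2).sub h3).add h4) h5, cDeriv_add ((h1.sub h2).sub h3) h4,
    cDeriv_sub (h1.sub h2) h3, cDeriv_sub h1 h2]

/-- The one-form part of the Jacobi identity of the twisted Dorfman bracket. -/
theorem formBracket_jacobi (hh : S.SmoothForm h) (hc : S.ClosedForm h) (hX : S.SmoothSection X)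
    (hα : S.SmoothDual α) (hY : S.SmoothSection Y) (hβ : S.SmoothDual β) (hZ : S.SmoothSection Z)
    (hγ : S.SmoothDual γ) (x : M) :
    S.formBracket h X α (S.lie Y Z) (S.formBracket h Y β Z γ) x
      = S.formBracket h Y β (S.lie X Z) (S.formBracket h X α Z γ) x
        + S.formBracket h (S.lie X Y) (S.formBracket h X α Y β) Z γ x := by
  refine hS.ext_dual fun W hW => ?_
  have hXY := hS.lie_mem hX hY
  have hXZ := hS.lie_mem hX hZ
  have hYZ := hS.lie_mem hY hZ
  have hXW := hS.lie_mem hX hW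
  have hYW := hS.lie_mem hY hW
  have hZW := hS.lie_mem hZ hW
  have mYZ := hS.formBracket_mem hh hY hβ hZ hγ
  have mXZ := hS.formBracket_mem hh hX hα hZ hγ
  have mXY := hS.formBracket_mem hh hX hα hY hβ
  rw [LinearMap.add_apply, hS.formBracket_apply hX hα hYZ mYZ hW,
    hS.formBracket_apply hY hβ hXZ mXZ hW, hS.formBracket_apply hXY mXY hZ hγ hW,
    hS.cDeriv_formBracket hh hY hβ hZ hγ hW, hS.cDeriv_formBracket hh hX hα hZ hγ hW,
    hS.cDeriv_formBracket hh hX hα hY hβ hW, hS.cDeriv_formBracket hh hX hα hY hβ hZ,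
    hS.formBracket_apply hY hβ hZ hγ hXW, hS.formBracket_apply hX hα hZ hγ hYW,
    hS.formBracket_apply hX hα hY hβ hZW,
    hS.cDeriv_lie hY hZ (hα W hW), hS.cDeriv_lie hX hW (hβ Z hZ), hS.cDeriv_lie hY hW (hα Z hZ),
    hS.cDeriv_lie hZ hW (hα Y hY), hS.cDeriv_lie hX hZ (hβ W hW), hS.cDeriv_lie hX hY (hγ W hW)]
  -- After expansion, second derivatives cancel by the commutator formula. Of the rest, each
  -- one-form contributes a Jacobi identity of vector fields, and the terms in `h` add up to `dh(X,
  -- Y, Z, W)`.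
  have jα := congrArg (α x) (hS.lie_jacobi hY hZ hW x)
  have jβ := congrArg (β x) (hS.lie_jacobi hX hZ hW x)
  have jγ := congrArg (γ x) (hS.lie_jacobi hX hY hW x)
  rw [map_add] at jα jβ jγ
  have jh := hc X Y Z W hX hY hZ hW x
  -- The remaining relations only move the bracketed vector field into the first slot of `h`, where
  -- the formula for `dh` has it.
  have s1 := alternating_swap' (h x) (Y x) (Z x) (S.lie X W x)
  have s1' := alternating_swap (h x) (Y x) (S.lie X W x) (Z x)
  have s2 := alternating_swap' (h x) (X x) (Z x) (S.lie Y W x)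
  have s2' := alternating_swap (h x) (X x) (S.lie Y W x) (Z x)
  have s3 := alternating_swap' (h x) (X x) (Y x) (S.lie Z W x)
  have s3' := alternating_swap (h x) (X x) (S.lie Z W x) (Y x)
  have s4 := alternating_swap (h x) (X x) (S.lie Y Z x) (W x)
  have s5 := alternating_swap (h x) (Y x) (S.lie X Z x) (W x)
  linear_combination jh - jα + jβ - jγ - s1 + s1' + s2 - s2' - s3 + s3' + s4 - s5

end TangentSummand.IsInvolutive

end Twisted

/-! ### The Courant algebroid on `A ⊕ A*` -/

section TwistedCourant

variable {F : Type*} [NormedAddCommGroup F] [NormedSpace ℝ F] [FiniteDimensional ℝ F]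
  {M : Type*} [TopologicalSpace M] [T2Space M] [ChartedSpace F M] [IsManifold 𝓘(ℝ, F) ∞ M]
  {A : M → Type*} [∀ x, AddCommGroup (A x)] [∀ x, Module ℂ (A x)]

namespace TangentSummand.IsInvolutive

variable {S : TangentSummand F A} (hS : S.IsInvolutive) {h : ∀ x, (A x) [⋀^Fin 3]→ₗ[ℂ] ℂ}

include hS

theorem twistedCourant_bundle : IsVectorBundle F (twistedCourant S h).Γ :=
  hS.bundle.prod hS.bundle.dual

omit hS [FiniteDimensional ℝ F] [T2Space M] in
theorem twistedCourant_nondegenerate (x : M) (u : A x × Module.Dual ℂ (A x))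
    (hu : ∀ v, (twistedCourant S h).pairing x u v = 0) : u = 0 := by
  have hu' : ∀ v : A x × Module.Dual ℂ (A x), u.2 v.1 + v.2 u.1 = 0 := hu
  refine Prod.ext ?_ ?_
  · refine (Module.forall_dual_apply_eq_zero_iff ℂ _).1 fun f => ?_
    simpa using hu' (0, f)
  · ext v
    simpa using hu' (v, 0)

/-- The pairing of `0 ⊕ df` with a section is `df` of its tangent part. In particular `𝒟 f` has no
tangent part. -/
theorem twistedCourant_D (f : M → ℂ) (x : M) :
    (twistedCourant S h).D f x = (0, cDeriv f x ∘ₗ S.incl x) := by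
  refine CourantData.represent_eq hS.twistedCourant_bundle twistedCourant_nondegenerate
    fun ψ _ => ?_
  change (cDeriv f x ∘ₗ S.incl x) (ψ x).1 + (ψ x).2 0 = _
  rw [map_zero, add_zero]
  rfl

theorem twistedCourant_D_mem {f : M → ℂ} (hf : SmoothFun F f) :
    (twistedCourant S h).D f ∈ (twistedCourant S h).Γ := by
  have e : (twistedCourant S h).D f = fun x => (0, cDeriv f x ∘ₗ S.incl x) :=
    funext (hS.twistedCourant_D f)
  rw [e]
  exact ⟨hS.bundle.zero_mem, fun V hV => smoothFun_cDeriv hf hV⟩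

/-- Closedness of the twist enters the Jacobi identity alone. In the other axioms `h` either matches
on the two sides by linearity or drops out because an argument is repeated. -/
theorem isCourantAlgebroid (hh : S.SmoothForm h) (hc : S.ClosedForm h) :
    IsCourantAlgebroid (twistedCourant S h) where
  bundle := hS.twistedCourant_bundle
  pairing_symm x u v := add_comm _ _
  pairing_nondegenerate := twistedCourant_nondegenerate
  pairing_smooth φ hφ ψ hψ := (hφ.2 _ hψ.1).add (hψ.2 _ hφ.1)
  anchor_smooth φ hφ := hφ.1
  bracket_mem φ hφ ψ hψ :=
    ⟨hS.lie_mem hφ.1 hψ.1, hS.formBracket_mem hh hφ.1 hφ.2 hψ.1 hψ.2⟩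
  bracket_add_left φ₁ h₁ φ₂ h₂ ψ hψ x := by
    have hs := hS.twistedCourant_bundle.add_mem (Γ := (twistedCourant S h).Γ) _ h₁ _ h₂
    refine Prod.ext (hS.lie_add_left h₁.1 h₂.1 hψ.1 x) (hS.ext_dual fun W hW => ?_)
    refine (hS.formBracket_apply hs.1 hs.2 hψ.1 hψ.2 hW x).trans ?_
    refine Eq.trans ?_ (congrArg₂ (· + ·)
      (hS.formBracket_apply h₁.1 h₁.2 hψ.1 hψ.2 hW x)
      (hS.formBracket_apply h₂.1 h₂.2 hψ.1 hψ.2 hW x)).symm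
    simp only [Prod.fst_add, Prod.snd_add, map_add, LinearMap.add_apply]
    rw [cDeriv_add (h₁.2 W hW) (h₂.2 W hW), cDeriv_add (h₁.2 _ hψ.1) (h₂.2 _ hψ.1),
      hS.lie_add_left h₁.1 h₂.1 hW, alternating_add_first, map_add]
    ring
  bracket_smul_left c φ hφ ψ hψ x := by
    have hs := hS.twistedCourant_bundle.const_smul_mem (Γ := (twistedCourant S h).Γ) c hφ
    refine Prod.ext ?_ (hS.ext_dual fun W hW => ?_)
    · have := hS.lie_smul_left (smoothFun_const c) hφ.1 hψ.1 x
      rw [cDeriv_const, zero_smul, sub_zero] at this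
      exact this
    refine (hS.formBracket_apply hs.1 hs.2 hψ.1 hψ.2 hW x).trans ?_
    refine Eq.trans ?_ (congrArg (c * ·) (hS.formBracket_apply hφ.1 hφ.2 hψ.1 hψ.2 hW x)).symm
    have := hS.lie_smul_left (smoothFun_const c) hφ.1 hW x
    rw [cDeriv_const, zero_smul, sub_zero] at this
    simp only [Prod.smul_fst, Prod.smul_snd, map_smul, LinearMap.smul_apply, smul_eq_mul, this]
    rw [cDeriv_const_mul c (hφ.2 W hW), cDeriv_const_mul c (hφ.2 _ hψ.1), alternating_smul_first]
    ring
  bracket_add_right φ hφ ψ₁ h₁ ψ₂ h₂ x := by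
    have hs := hS.twistedCourant_bundle.add_mem (Γ := (twistedCourant S h).Γ) _ h₁ _ h₂
    refine Prod.ext (hS.lie_add_right hφ.1 h₁.1 h₂.1 x) (hS.ext_dual fun W hW => ?_)
    refine (hS.formBracket_apply hφ.1 hφ.2 hs.1 hs.2 hW x).trans ?_
    refine Eq.trans ?_ (congrArg₂ (· + ·)
      (hS.formBracket_apply hφ.1 hφ.2 h₁.1 h₁.2 hW x)
      (hS.formBracket_apply hφ.1 hφ.2 h₂.1 h₂.2 hW x)).symm
    simp only [Prod.fst_add, Prod.snd_add, map_add, LinearMap.add_apply]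
    rw [cDeriv_add (h₁.2 W hW) (h₂.2 W hW), cDeriv_add (hφ.2 _ h₁.1) (hφ.2 _ h₂.1),
      hS.lie_add_left h₁.1 h₂.1 hW, alternating_add_second, map_add]
    ring
  bracket_smul_right c φ hφ ψ hψ x := by
    have hs := hS.twistedCourant_bundle.const_smul_mem (Γ := (twistedCourant S h).Γ) c hψ
    refine Prod.ext ?_ (hS.ext_dual fun W hW => ?_)
    · have := hS.lie_smul_right (smoothFun_const c) hφ.1 hψ.1 x
      rw [cDeriv_const, zero_smul, zero_add] at this
      exact this
    refine (hS.formBracket_apply hφ.1 hφ.2 hs.1 hs.2 hW x).trans ?_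
    refine Eq.trans ?_ (congrArg (c * ·) (hS.formBracket_apply hφ.1 hφ.2 hψ.1 hψ.2 hW x)).symm
    have := hS.lie_smul_left (smoothFun_const c) hψ.1 hW x
    rw [cDeriv_const, zero_smul, sub_zero] at this
    simp only [Prod.smul_fst, Prod.smul_snd, map_smul, LinearMap.smul_apply, smul_eq_mul, this]
    rw [cDeriv_const_mul c (hψ.2 W hW), cDeriv_const_mul c (hφ.2 _ hψ.1), alternating_smul_second]
    ring
  jacobi φ hφ φ₁ h₁ φ₂ h₂ x := Prod.ext (hS.lie_jacobi hφ.1 h₁.1 h₂.1 x)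
    (hS.formBracket_jacobi hh hc hφ.1 hφ.2 h₁.1 h₁.2 h₂.1 h₂.2 x)
  leibniz φ hφ ψ hψ f hf x := by
    have hs := hS.twistedCourant_bundle.smul_mem (Γ := (twistedCourant S h).Γ) f hf _ hψ
    refine Prod.ext (hS.lie_smul_right hf hφ.1 hψ.1 x) (hS.ext_dual fun W hW => ?_)
    refine (hS.formBracket_apply hφ.1 hφ.2 hs.1 hs.2 hW x).trans ?_
    refine Eq.trans ?_ (congrArg (cDeriv f x (S.incl x (φ x).1) * (ψ x).2 (W x) + f x * ·)
      (hS.formBracket_apply hφ.1 hφ.2 hψ.1 hψ.2 hW x)).symm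
    simp only [Prod.smul_fst, Prod.smul_snd, map_smul, LinearMap.smul_apply, smul_eq_mul]
    rw [cDeriv_mul hf (hψ.2 W hW), cDeriv_mul hf (hφ.2 _ hψ.1), hS.lie_smul_left hf hψ.1 hW,
      alternating_smul_second, map_sub, map_smul, map_smul]
    simp only [smul_eq_mul]
    ring
  bracket_self φ hφ x := by
    rw [hS.twistedCourant_D]
    refine Prod.ext ?_ (hS.ext_dual fun W hW => ?_)
    · refine (hS.lie_self hφ.1 x).trans ?_
      simp
    refine (hS.formBracket_apply hφ.1 hφ.2 hφ.1 hφ.2 hW x).trans ?_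
    rw [alternating_self]
    change _ = (1 / 2 : ℂ) * cDeriv (fun y => (φ y).2 (φ y).1 + (φ y).2 (φ y).1) x (S.incl x (W x))
    rw [cDeriv_add (hφ.2 _ hφ.1) (hφ.2 _ hφ.1)]
    ring
  ad_invariant φ hφ ψ hψ x := by
    have e := hS.formBracket_apply (h := h) hφ.1 hφ.2 hψ.1 hψ.2 hψ.1 x
    change cDeriv (fun y => (ψ y).2 (ψ y).1 + (ψ y).2 (ψ y).1) x (S.incl x (φ x).1)
      = 2 * (S.formBracket h _ _ _ _ x (ψ x).1 + (ψ x).2 (S.lie _ _ x))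
    rw [e, cDeriv_add (hψ.2 _ hψ.1) (hψ.2 _ hψ.1), hS.lie_self hψ.1, alternating_self', map_zero]
    ring

end TangentSummand.IsInvolutive

end TwistedCourant

/-! ### Complementary involutive subbundles split the twisted algebroid -/

section Complementary

variable {F : Type*} [NormedAddCommGroup F] [NormedSpace ℝ F]
  {M : Type*} [TopologicalSpace M] [ChartedSpace F M] [IsManifold 𝓘(ℝ, F) ∞ M]
  {A : M → Type*} [∀ x, AddCommGroup (A x)] [∀ x, Module ℂ (A x)]
  {B : M → Type*} [∀ x, AddCommGroup (B x)] [∀ x, Module ℂ (B x)]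

namespace TangentSummand

theorem wholeTangent_isInvolutive [FiniteDimensional ℝ F] [T2Space M] :
    (wholeTangent F M).IsInvolutive where
  bundle := (wholeTangent F M).isVectorBundle_of_chart fun _ =>
    ⟨⊤, Filter.Eventually.of_forall fun _ v => ⟨fun _ => trivial, fun _ => ⟨v, rfl⟩⟩⟩
  incl_lie _ _ _ _ _ := rfl

/-- Two smooth involutive summands with direct sum the complexified tangent bundle. -/
structure IsComplementary (S : TangentSummand F A) (T : TangentSummand F B) : Prop where
  left : S.IsInvolutive
  right : T.IsInvolutive
  proj_left : ∀ U, SmoothField U → S.SmoothSection (fun x => S.proj x (U x))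
  proj_right : ∀ U, SmoothField U → T.SmoothSection (fun x => T.proj x (U x))
  incl_proj : ∀ x v, S.incl x (S.proj x v) + T.incl x (T.proj x v) = v

/-- The isomorphism `(A ⊕ A*) ⊕ (B ⊕ B*) ≃ (A ⊕ B) ⊕ (A ⊕ B)*`. -/
noncomputable def splittingEquiv (S : TangentSummand F A) (T : TangentSummand F B)
    (hST : S.IsComplementary T) (x : M) :
    ((A x × Module.Dual ℂ (A x)) × (B x × Module.Dual ℂ (B x))) ≃ₗ[ℂ]
      (CTangent F x × Module.Dual ℂ (CTangent F x)) where
  toFun u := (S.incl x u.1.1 + T.incl x u.2.1, u.1.2 ∘ₗ S.proj x + u.2.2 ∘ₗ T.proj x)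
  map_add' u v := by
    refine Prod.ext ?_ ?_
    · simp only [Prod.fst_add, Prod.snd_add, map_add]; abel
    · simp only [Prod.fst_add, Prod.snd_add, LinearMap.add_comp]; abel
  map_smul' c u := by
    refine Prod.ext ?_ ?_
    · simp
    · simp [LinearMap.smul_comp]
  invFun v := ((S.proj x v.1, v.2 ∘ₗ S.incl x), (T.proj x v.1, v.2 ∘ₗ T.incl x))
  left_inv u := by
    have h1 : ∀ w, S.proj x (T.incl x w) = 0 := fun w => S.incl_injective x <| by
      have := hST.incl_proj x (T.incl x w)
      rw [T.proj_incl] at this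
      rw [map_zero]; exact left_eq_add.1 (by rw [add_comm, this])
    have h2 : ∀ w, T.proj x (S.incl x w) = 0 := fun w => T.incl_injective x <| by
      have := hST.incl_proj x (S.incl x w)
      rw [S.proj_incl] at this
      rw [map_zero]; exact left_eq_add.1 this.symm
    refine Prod.ext (Prod.ext ?_ ?_) (Prod.ext ?_ ?_)
    · simp [S.proj_incl, h1]
    · ext w; simp [S.proj_incl, h2]
    · simp [T.proj_incl, h2]
    · ext w; simp [T.proj_incl, h1]
  right_inv v := by
    refine Prod.ext (hST.incl_proj x v.1) ?_
    refine LinearMap.ext fun w => ?_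
    change v.2 (S.incl x (S.proj x w)) + v.2 (T.incl x (T.proj x w)) = v.2 w
    rw [← map_add, hST.incl_proj]

namespace IsComplementary

variable {S : TangentSummand F A} {T : TangentSummand F B} (hST : S.IsComplementary T)

include hST

theorem symm : T.IsComplementary S where
  left := hST.right
  right := hST.left
  proj_left := hST.proj_right
  proj_right := hST.proj_left
  incl_proj x v := by rw [add_comm, hST.incl_proj]

theorem proj_incl_right (x : M) (w : B x) : S.proj x (T.incl x w) = 0 := by
  have := congrArg (fun u => u.1.1) ((S.splittingEquiv T hST x).left_inv ((0, 0), (w, 0)))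
  simpa [splittingEquiv] using this

theorem proj_incl_left (x : M) (w : A x) : T.proj x (S.incl x w) = 0 :=
  hST.symm.proj_incl_right x w

theorem smoothDual_comp {α : ∀ x, Module.Dual ℂ (A x)} (hα : S.SmoothDual α) :
    (wholeTangent F M).SmoothDual (fun x => α x ∘ₗ S.proj x) :=
  fun V hV => hα _ (hST.proj_left V hV)

variable [FiniteDimensional ℝ F] [T2Space M] {H η : ThreeForm F M}
  {X : ∀ x, A x} {α : ∀ x, Module.Dual ℂ (A x)} {Y : ∀ x, A x} {β : ∀ x, Module.Dual ℂ (A x)}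
  {Z : ∀ x, B x} {γ : ∀ x, Module.Dual ℂ (B x)}

/-- In the formula for the bracket, the Lie brackets occur only inside forms composed with `S.proj`,
so only as `S.lie`. The formula becomes the one for `S`, term by term. -/
theorem formBracket_comp_incl {h : ∀ x, (A x) [⋀^Fin 3]→ₗ[ℂ] ℂ}
    (hh : ∀ x u v w, H x ![S.incl x u, S.incl x v, S.incl x w] = h x ![u, v, w])
    (hX : S.SmoothSection X) (hα : S.SmoothDual α) (hY : S.SmoothSection Y)
    (hβ : S.SmoothDual β) (x : M) :
    (wholeTangent F M).formBracket H (S.toField X) (fun y => α y ∘ₗ S.proj y) (S.toField Y)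
      (fun y => β y ∘ₗ S.proj y) x ∘ₗ S.incl x = S.formBracket h X α Y β x := by
  refine hST.left.ext_dual fun W hW => ?_
  have hX' : (wholeTangent F M).SmoothSection (S.toField X) := hX
  have hY' : (wholeTangent F M).SmoothSection (S.toField Y) := hY
  have hW' : (wholeTangent F M).SmoothSection (S.toField W) := hW
  rw [hST.left.formBracket_apply hX hα hY hβ hW]
  refine (wholeTangent_isInvolutive.formBracket_apply hX'
    (hST.smoothDual_comp hα) hY' (hST.smoothDual_comp hβ) hW' x).trans ?_
  simp only [toField, hh, LinearMap.comp_apply, S.proj_incl]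
  rfl

/-- On `B` every contribution of `α` vanishes: `α ∘ S.proj` is zero on sections of `B`, and `[Z, W]`
is again such a section because `T` is involutive. Left over are the Lie derivative of `γ` and the
twist. -/
theorem formBracket_comp_incl_right
    (hη : ∀ x u v w, H x ![S.incl x u, T.incl x v, T.incl x w]
      = η x ![S.incl x u, T.incl x v, T.incl x w])
    (hX : S.SmoothSection X) (hα : S.SmoothDual α) (hZ : T.SmoothSection Z)
    (hγ : T.SmoothDual γ) (x : M) :
    (wholeTangent F M).formBracket H (S.toField X) (fun y => α y ∘ₗ S.proj y) (T.toField Z)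
      (fun y => γ y ∘ₗ T.proj y) x ∘ₗ T.incl x
      = ((wholeTangent F M).lieDeriv (S.toField X) (fun y => γ y ∘ₗ T.proj y) x
        + contract (η x) (S.toField X x) (T.toField Z x)) ∘ₗ T.incl x := by
  refine hST.right.ext_dual fun W hW => ?_
  have hX' : (wholeTangent F M).SmoothSection (S.toField X) := hX
  have hZ' : (wholeTangent F M).SmoothSection (T.toField Z) := hZ
  have hW' : (wholeTangent F M).SmoothSection (T.toField W) := hW
  refine (wholeTangent_isInvolutive.formBracket_apply hX'
    (hST.smoothDual_comp hα) hZ' (hST.symm.smoothDual_comp hγ) hW' x).trans ?_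
  refine Eq.trans ?_ (congrArg₂ (· + ·) (wholeTangent_isInvolutive.lieDeriv_apply
    hX' (hST.symm.smoothDual_comp hγ) hW' x)
    (contract_apply (η x) _ _ (T.toField W x))).symm
  have e1 : (wholeTangent F M).lie (T.toField Z) (T.toField W) x = T.incl x (T.lie Z W x) :=
    (hST.right.incl_lie Z W hZ hW x).symm
  simp only [e1, LinearMap.comp_apply]
  simp only [toField, hη, hST.proj_incl_right, map_zero, cDeriv_const]
  ring

/-- The projected brackets involve `H` only on three vectors of one summand, or on one vector of one
and two of the other. This is why the four hypotheses suffice, each replacing `H` by the form used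
in the corresponding structure. -/
theorem isSplitting {H12 H21 : ThreeForm F M} {h : ∀ x, (A x) [⋀^Fin 3]→ₗ[ℂ] ℂ}
    {k : ∀ x, (B x) [⋀^Fin 3]→ₗ[ℂ] ℂ}
    (hh : ∀ x u v w, H x ![S.incl x u, S.incl x v, S.incl x w] = h x ![u, v, w])
    (hk : ∀ x u v w, H x ![T.incl x u, T.incl x v, T.incl x w] = k x ![u, v, w])
    (h12 : ∀ x u v w, H x ![S.incl x u, T.incl x v, T.incl x w]
      = H12 x ![S.incl x u, T.incl x v, T.incl x w])
    (h21 : ∀ x u v w, H x ![T.incl x u, S.incl x v, S.incl x w]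
      = H21 x ![T.incl x u, S.incl x v, S.incl x w]) :
    IsSplitting (twistedCourant (wholeTangent F M) H) (twistedCourant S h) (twistedCourant T k)
      (pairConnection S T H12) (pairConnection T S H21) (S.splittingEquiv T hST) := by
  -- Inside the large algebroid a form on one summand is extended by zero on the other.
  have el : ∀ a : ∀ x, A x × Module.Dual ℂ (A x),
      (fun y => S.splittingEquiv T hST y (a y, 0))
        = fun y => (S.toField (fun y => (a y).1) y, (a y).2 ∘ₗ S.proj y) := fun a => by
    funext y
    refine Prod.ext ?_ ?_
    · simp [splittingEquiv, toField]
    · ext v; simp [splittingEquiv]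
  have er : ∀ a : ∀ x, B x × Module.Dual ℂ (B x),
      (fun y => S.splittingEquiv T hST y (0, a y))
        = fun y => (T.toField (fun y => (a y).1) y, (a y).2 ∘ₗ T.proj y) := fun a => by
    funext y
    refine Prod.ext ?_ ?_
    · simp [splittingEquiv, toField]
    · ext v; simp [splittingEquiv]
  refine ⟨fun φ => ⟨fun hφ => ⟨?_, fun V hV => ?_⟩, fun hφ => ⟨⟨?_, fun V hV => ?_⟩,
    ⟨?_, fun V hV => ?_⟩⟩⟩, fun x u v => ?_, fun x u => rfl, fun a ha b hb x => ?_,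
    fun a ha b hb x => ?_, fun a ha b hb x => ?_, fun a ha b hb x => ?_⟩
  · exact SmoothField.add hφ.1.1 hφ.2.1
  · exact (hφ.1.2 _ (hST.proj_left V hV)).add (hφ.2.2 _ (hST.proj_right V hV))
  · have := hST.proj_left _ hφ.1
    simpa [toField, wholeTangent, splittingEquiv, S.proj_incl, hST.proj_incl_right] using this
  · have := hφ.2 _ hV
    simpa [toField, wholeTangent, splittingEquiv, S.proj_incl, hST.proj_incl_left] using this
  · have := hST.proj_right _ hφ.1
    simpa [toField, wholeTangent, splittingEquiv, T.proj_incl, hST.proj_incl_left] using this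
  · have := hφ.2 _ hV
    simpa [toField, wholeTangent, splittingEquiv, T.proj_incl, hST.proj_incl_right] using this
  · change (u.1.2 (S.proj x (S.incl x v.1.1 + T.incl x v.2.1))
        + u.2.2 (T.proj x (S.incl x v.1.1 + T.incl x v.2.1)))
      + (v.1.2 (S.proj x (S.incl x u.1.1 + T.incl x u.2.1))
        + v.2.2 (T.proj x (S.incl x u.1.1 + T.incl x u.2.1)))
      = (u.1.2 v.1.1 + v.1.2 u.1.1) + (u.2.2 v.2.1 + v.2.2 u.2.1)
    simp only [map_add, S.proj_incl, T.proj_incl, hST.proj_incl_left, hST.proj_incl_right,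
      map_zero]
    ring
  · rw [el, el]
    exact Prod.ext rfl (hST.formBracket_comp_incl hh ha.1 ha.2 hb.1 hb.2 x)
  · rw [er, er]
    exact Prod.ext rfl (hST.symm.formBracket_comp_incl hk ha.1 ha.2 hb.1 hb.2 x)
  · rw [el, er]
    exact Prod.ext rfl (hST.formBracket_comp_incl_right h12 ha.1 ha.2 hb.1 hb.2 x)
  · rw [el, er]
    exact Prod.ext rfl (hST.symm.formBracket_comp_incl_right h21 ha.1 ha.2 hb.1 hb.2 x)

end IsComplementary

end TangentSummand

end Complementary

/-! ### The almost complex structure in holomorphic charts -/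

section Complex

variable {V : Type*} [NormedAddCommGroup V] [NormedSpace ℂ V]
  {X : Type*} [TopologicalSpace X] [ChartedSpace V X]

/-! ### The almost complex structure in charts -/

variable (V) in
/-- The complex-linear extension of the multiplication by `i` of the real vector space `V`. -/
noncomputable def modelComplex : ℂ ⊗[ℝ] V →ₗ[ℂ] ℂ ⊗[ℝ] V :=
  ((LinearMap.lsmul ℂ V Complex.I).restrictScalars ℝ).baseChange ℂ

theorem liftBaseChange_modelComplex (L : V →ₗ[ℝ] ℂ) (c : ℂ ⊗[ℝ] V) :
    LinearMap.liftBaseChange ℂ L (modelComplex V c)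
      = LinearMap.liftBaseChange ℂ
        (L ∘ₗ (LinearMap.lsmul ℂ V Complex.I).restrictScalars ℝ) c := by
  induction c using TensorProduct.induction_on with
  | zero => simp
  | add a b ha hb => rw [map_add, map_add, map_add, ha, hb]
  | tmul z v => rfl

theorem liftBaseChange_sub_smul (L L' : V →ₗ[ℝ] ℂ) (ε : ℂ) (c : ℂ ⊗[ℝ] V) :
    LinearMap.liftBaseChange ℂ (L - ε • L') c
      = LinearMap.liftBaseChange ℂ L c - ε * LinearMap.liftBaseChange ℂ L' c := by
  induction c using TensorProduct.induction_on with
  | zero => simp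
  | add a b ha hb => simp only [map_add, ha, hb]; ring
  | tmul z v => simp

variable [IsManifold 𝓘(ℂ, V) ω X]

/-- The map is the derivative of a change of charts. That change is holomorphic, so its real
derivative is the restriction of a complex-linear map. -/
theorem continuousLinearMapAt_smul_I {x₀ y : X} (hy : y ∈ (chartAt V x₀).source) (w : V) :
    (trivializationAt V (TangentSpace 𝓘(ℝ, V)) x₀).continuousLinearMapAt ℝ y
        (Complex.I • w : V)
      = (Complex.I • (show V from
        (trivializationAt V (TangentSpace 𝓘(ℝ, V)) x₀).continuousLinearMapAt ℝ y w) : V) := by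
  rw [TangentBundle.continuousLinearMapAt_trivializationAt_eq_core hy,
    tangentBundleCore_coordChange_achart]
  have hd : DifferentiableAt ℂ (extChartAt 𝓘(ℝ, V) x₀ ∘ (extChartAt 𝓘(ℝ, V) y).symm)
      (extChartAt 𝓘(ℝ, V) y y) := by
    have h := (contDiffGroupoid ω 𝓘(ℂ, V)).compatible (chart_mem_atlas V y) (chart_mem_atlas V x₀)
    rw [contDiffGroupoid, mem_groupoid_of_pregroupoid] at h
    have h1 : ContDiffOn ℂ ω ((chartAt V y).symm.trans (chartAt V x₀))
        ((chartAt V y).symm.trans (chartAt V x₀)).source := by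
      simpa [contDiffPregroupoid] using h.1
    have hm : chartAt V y y ∈ ((chartAt V y).symm.trans (chartAt V x₀)).source := by
      simp [hy]
    have h2 := (h1.differentiableOn (by simp)).differentiableAt
      ((OpenPartialHomeomorph.open_source _).mem_nhds hm)
    simpa [extChartAt] using h2
  rw [modelWithCornersSelf_coe, Set.range_id, fderivWithin_univ, hd.fderiv_restrictScalars ℝ]
  exact (fderiv ℂ (extChartAt 𝓘(ℝ, V) x₀ ∘ (extChartAt 𝓘(ℝ, V) y).symm)
    (extChartAt 𝓘(ℝ, V) y y)).map_smul Complex.I w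

theorem cChart_almostComplexC {x₀ y : X} (hy : y ∈ (chartAt V x₀).source) (v : CTangent V y) :
    cChart x₀ y (almostComplexC V y v) = modelComplex V (cChart x₀ y v) := by
  induction v using TensorProduct.induction_on with
  | zero => simp
  | add a b ha hb => simp only [map_add, ha, hb]
  | tmul z v => exact congrArg (fun w => z ⊗ₜ[ℝ] w) (continuousLinearMapAt_smul_I hy v)

/-- In a trivialisation of the tangent bundle the almost complex structure is multiplication by the
constant `i`. -/
theorem SmoothField.almostComplexC {U : ∀ x : X, CTangent V x} (hU : SmoothField U) :
    SmoothField (fun x => almostComplexC V x (U x)) := by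
  have key : ∀ W : ∀ x : X, TangentSpace 𝓘(ℝ, V) x,
      ContMDiff 𝓘(ℝ, V) 𝓘(ℝ, V).tangent ∞ (fun x => (⟨x, W x⟩ : TangentBundle 𝓘(ℝ, V) X)) →
      ContMDiff 𝓘(ℝ, V) 𝓘(ℝ, V).tangent ∞
        (fun x => (⟨x, almostComplex V x (W x)⟩ : TangentBundle 𝓘(ℝ, V) X)) := by
    intro W hW x
    have hx : x ∈ (trivializationAt V (TangentSpace 𝓘(ℝ, V)) x).baseSet := mem_chart_source V x
    have h1 := (Bundle.Trivialization.contMDiffAt_section_iff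
      (trivializationAt V (TangentSpace 𝓘(ℝ, V)) x) hx).1 (hW x)
    refine (Bundle.Trivialization.contMDiffAt_section_iff
      (trivializationAt V (TangentSpace 𝓘(ℝ, V)) x) hx).2 ?_
    have h2 := (((ContinuousLinearMap.lsmul ℂ ℂ (E := V) Complex.I).restrictScalars
      ℝ).contMDiff.contMDiffAt).comp x h1
    refine h2.congr_of_eventuallyEq ?_
    filter_upwards [(chartAt V x).open_source.mem_nhds hx] with y hy
    have h3 := continuousLinearMapAt_smul_I hy (W y)
    have e := Bundle.Trivialization.coe_linearMapAt_of_mem (R := ℝ)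
      (trivializationAt V (TangentSpace 𝓘(ℝ, V)) x) (b := y) hy
    change (trivializationAt V (TangentSpace 𝓘(ℝ, V)) x).linearMapAt ℝ y _
      = Complex.I • (show V from (trivializationAt V (TangentSpace 𝓘(ℝ, V)) x).linearMapAt ℝ y _) at h3
    rw [e] at h3
    exact h3
  have hr : ∀ (x : X) (v : CTangent V x),
      rePart (CourantPair.almostComplexC V x v) = almostComplex V x (rePart v) ∧
      imPart (CourantPair.almostComplexC V x v) = almostComplex V x (imPart v) := by
    intro x v
    induction v using TensorProduct.induction_on with
    | zero => simp
    | add a b ha hb => simp only [map_add, ha.1, hb.1, ha.2, hb.2, and_self]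
    | tmul z v =>
      rw [CourantPair.almostComplexC, LinearMap.baseChange_tmul]
      simp
  refine ⟨?_, ?_⟩
  · simpa only [(hr _ _).1] using key _ hU.1
  · simpa only [(hr _ _).2] using key _ hU.2

/-! ### Involutivity -/

section Involutive

variable [FiniteDimensional ℂ V] [T2Space X]

/-- The eigenvectors of the almost complex structure are closed under the Lie bracket. -/
theorem almostComplexC_cBracket {ε : ℂ} (hε : ε * ε = -1) {U W : ∀ x : X, CTangent V x}
    (hU : SmoothField U) (hW : SmoothField W) (eU : ∀ x, almostComplexC V x (U x) = ε • U x)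
    (eW : ∀ x, almostComplexC V x (W x) = ε • W x) (x : X) :
    almostComplexC V x (cBracket U W x) = ε • cBracket U W x := by
  have : FiniteDimensional ℝ V := FiniteDimensional.complexToReal V
  have := FiniteDimensional.complete ℝ V
  have hε0 : ε ≠ 0 := by rintro rfl; norm_num at hε
  have hx : x ∈ (chartAt V x).source := mem_chart_source V x
  suffices h : modelComplex V (cChart x x (cBracket U W x)) = ε • cChart x x (cBracket U W x) by
    rw [← cChart_almostComplexC hx, ← map_smul] at h
    rw [← cChartSymm_cChart hx (almostComplexC V x _), h, cChartSymm_cChart hx]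
  refine sub_eq_zero.1 (tensor_eq_zero fun L => ?_)
  let J : V →ₗ[ℝ] V := (LinearMap.lsmul ℂ V Complex.I).restrictScalars ℝ
  -- The extension of `ℓ` kills all vectors with eigenvalue `ε`: from `ℓ ∘ J = -ε ℓ`, such a vector
  -- `c` satisfies `ε ℓ(c) = ℓ(J c) = -ε ℓ(c)`. Every functional whose vanishing on the bracket has
  -- to be shown is such an `ℓ`.
  let ℓ : V →ₗ[ℝ] ℂ := L ∘ₗ J - ε • L
  have hℓ : ∀ c, LinearMap.liftBaseChange ℂ ℓ c
      = LinearMap.liftBaseChange ℂ L (modelComplex V c) - ε * LinearMap.liftBaseChange ℂ L c := by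
    intro c
    rw [liftBaseChange_sub_smul, liftBaseChange_modelComplex]
  have hJ : ℓ ∘ₗ J = -(ε • ℓ) := by
    ext w
    have : L (Complex.I • Complex.I • w) = - L w := by
      rw [smul_smul, Complex.I_mul_I, neg_one_smul, map_neg]
    simp only [ℓ, J, LinearMap.sub_comp, LinearMap.sub_apply, LinearMap.comp_apply,
      LinearMap.smul_apply, LinearMap.neg_apply, LinearMap.coe_restrictScalars,
      LinearMap.lsmul_apply, this, smul_eq_mul]
    linear_combination (-L w) * hε
  have hker : ∀ c, modelComplex V c = ε • c → LinearMap.liftBaseChange ℂ ℓ c = 0 := by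
    intro c hc
    have h1 := liftBaseChange_modelComplex ℓ c
    have h2 := liftBaseChange_sub_smul 0 ℓ ε c
    rw [zero_sub, ← hJ, ← h1, hc, map_smul, smul_eq_mul] at h2
    have h3 : LinearMap.liftBaseChange ℂ (0 : V →ₗ[ℝ] ℂ) c = 0 := by simp
    rw [h3] at h2
    have h4 : ε * LinearMap.liftBaseChange ℂ ℓ c = 0 := by linear_combination h2 / 2
    exact (mul_eq_zero.1 h4).resolve_left hε0
  rw [map_sub, map_smul, smul_eq_mul, ← hℓ]
  -- With a function whose differential is `ℓ` near `x`, both `U f` and `W f` vanish near `x`, hence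
  -- so does `[U, W] f` at `x`.
  obtain ⟨f, hf, -, hd⟩ := exists_chartFun (F := V) x ℓ.toContinuousLinearMap
  have hd' : ∀ᶠ y in nhds x, ∀ v : CTangent V y,
      cDeriv f y v = LinearMap.liftBaseChange ℂ ℓ (cChart x y v) := hd
  have hz : ∀ Z : ∀ x : X, CTangent V x, (∀ x, almostComplexC V x (Z x) = ε • Z x) →
      ∀ᶠ y in nhds x, cDeriv f y (Z y) = 0 := by
    intro Z hZ
    filter_upwards [hd', (chartAt V x).open_source.mem_nhds hx] with y hy hys
    rw [hy]
    refine hker _ ?_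
    rw [← cChart_almostComplexC hys, hZ, map_smul]
  rw [← hd'.self_of_nhds, cDeriv_cBracket hU hW hf, cDeriv_congr (hz W eW), cDeriv_congr (hz U eU),
    cDeriv_const, cDeriv_const, sub_zero]

end Involutive

end Complex

/-! ### The eigenbundles as complementary involutive subbundles -/

section ComplexManifold

variable {V : Type*} [NormedAddCommGroup V] [NormedSpace ℂ V]
  {X : Type*} [TopologicalSpace X] [ChartedSpace V X]

/-! ### The summands `T^{1,0}` and `T^{0,1}` -/

theorem mem_T10 {x : X} {v : CTangent V x} :
    v ∈ T10 V x ↔ almostComplexC V x v = Complex.I • v := by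
  simp [T10, sub_eq_zero]

theorem mem_T01 {x : X} {v : CTangent V x} :
    v ∈ T01 V x ↔ almostComplexC V x v = -Complex.I • v := by
  simp [T01, add_eq_zero_iff_eq_neg]

theorem tangent10_incl_proj (x : X) (v : CTangent V x) :
    (tangent10 V X).incl x ((tangent10 V X).proj x v)
      = (1 / 2 : ℂ) • (v + (-Complex.I) • almostComplexC V x v) := by
  simp [tangent10, sub_eq_add_neg]

theorem tangent01_incl_proj (x : X) (v : CTangent V x) :
    (tangent01 V X).incl x ((tangent01 V X).proj x v)
      = (1 / 2 : ℂ) • (v + Complex.I • almostComplexC V x v) := by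
  simp [tangent01]

variable [IsManifold 𝓘(ℂ, V) ω X]

theorem SmoothField.add_smul_almostComplexC {U : ∀ x : X, CTangent V x} (hU : SmoothField U)
    (c d : ℂ) : SmoothField (fun x => c • (U x + d • CourantPair.almostComplexC V x (U x))) :=
  (hU.add (hU.almostComplexC.smul (smoothFun_const d))).smul (smoothFun_const c)

variable [FiniteDimensional ℂ V] [T2Space X]

/-- An eigenbundle of the almost complex structure is an involutive summand. -/
theorem isInvolutive_of_eigenspace {A : X → Type*} [∀ x, AddCommGroup (A x)]
    [∀ x, Module ℂ (A x)] (S : TangentSummand V A) {ε : ℂ} (hε : ε * ε = -1)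
    (hS : ∀ x (v : CTangent V x), v ∈ LinearMap.range (S.incl x) ↔ almostComplexC V x v = ε • v) :
    S.IsInvolutive where
  bundle := by
    have : FiniteDimensional ℝ V := FiniteDimensional.complexToReal V
    refine S.isVectorBundle_of_chart fun x₀ =>
      -- The same eigenspace in the model: the chart intertwines the two complex structures, so it
      -- serves as the constant space for every nearby point.
      ⟨LinearMap.ker (modelComplex V - ε • LinearMap.id), ?_⟩
    filter_upwards [chart_source_mem_nhds V x₀] with y hy v
    rw [hS, LinearMap.mem_ker, LinearMap.sub_apply, LinearMap.smul_apply, LinearMap.id_apply,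
      ← cChart_almostComplexC hy, ← map_smul, ← map_sub]
    refine ⟨fun h => by rw [h, sub_self, map_zero], fun h => ?_⟩
    rw [← sub_eq_zero, ← cChartSymm_cChart hy (_ - _), h, map_zero]
  incl_lie U W hU hW x := by
    have h := almostComplexC_cBracket hε hU hW (fun y => (hS y _).1 ⟨U y, rfl⟩)
      (fun y => (hS y _).1 ⟨W y, rfl⟩) x
    obtain ⟨w, hw⟩ := (hS x _).2 h
    rw [TangentSummand.lie, ← hw, S.proj_incl]

theorem tangent10_isComplementary : (tangent10 V X).IsComplementary (tangent01 V X) where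
  left := isInvolutive_of_eigenspace _ Complex.I_mul_I fun x v => by
    rw [← mem_T10]
    exact (SetLike.ext_iff.1 (Submodule.range_subtype (T10 V x)) v)
  right := isInvolutive_of_eigenspace _ (ε := -Complex.I) (by rw [neg_mul_neg, Complex.I_mul_I])
    fun x v => by
      rw [← mem_T01]
      exact (SetLike.ext_iff.1 (Submodule.range_subtype (T01 V x)) v)
  proj_left U hU := by
    have e : (tangent10 V X).toField (fun x => (tangent10 V X).proj x (U x)) = _ :=
      funext fun x => tangent10_incl_proj x (U x)
    rw [TangentSummand.SmoothSection, e]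
    exact hU.add_smul_almostComplexC _ _
  proj_right U hU := by
    have e : (tangent01 V X).toField (fun x => (tangent01 V X).proj x (U x)) = _ :=
      funext fun x => tangent01_incl_proj x (U x)
    rw [TangentSummand.SmoothSection, e]
    exact hU.add_smul_almostComplexC _ _
  incl_proj x v := by
    rw [tangent10_incl_proj, tangent01_incl_proj]
    module

end ComplexManifold

/-! ### Restriction of three-forms to a subbundle; connections along `𝒟 f` -/

section Forms

variable {F : Type*} [NormedAddCommGroup F] [NormedSpace ℝ F]
  {M : Type*} [TopologicalSpace M] [ChartedSpace F M] [IsManifold 𝓘(ℝ, F) ∞ M]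
  {A : M → Type*} [∀ x, AddCommGroup (A x)] [∀ x, Module ℂ (A x)]

/-! ### Restriction of three-forms to summands -/

theorem compLinearMap_apply_three {V W : Type*} [AddCommGroup V] [Module ℂ V] [AddCommGroup W]
    [Module ℂ W] (h : V [⋀^Fin 3]→ₗ[ℂ] ℂ) (f : W →ₗ[ℂ] V) (u v w : W) :
    h.compLinearMap f ![u, v, w] = h ![f u, f v, f w] := by
  rw [AlternatingMap.compLinearMap_apply]
  congr 1
  ext i; fin_cases i <;> rfl

theorem SmoothThreeForm.smoothForm {η : ThreeForm F M} (hη : SmoothThreeForm η)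
    (S : TangentSummand F A) : S.SmoothForm (fun x => (η x).compLinearMap (S.incl x)) := by
  intro U V W hU hV hW
  simp only [compLinearMap_apply_three]
  exact hη _ _ _ hU hV hW

/-- On sections of an involutive subbundle the invariant formula for `dH` only evaluates `H` on the
subbundle. It suffices that `H` is closed and that `η` agrees with it there; `η` itself may fail to
be closed. -/
theorem ClosedThreeForm.closedForm {H η : ThreeForm F M} (hH : ClosedThreeForm H)
    {S : TangentSummand F A} (hS : S.IsInvolutive)
    (hη : ∀ x u v w, H x ![S.incl x u, S.incl x v, S.incl x w]
      = η x ![S.incl x u, S.incl x v, S.incl x w]) :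
    S.ClosedForm (fun x => (η x).compLinearMap (S.incl x)) := by
  intro V₀ V₁ V₂ V₃ h₀ h₁ h₂ h₃ x
  simp only [compLinearMap_apply_three, ← hη]
  simp only [hS.incl_lie _ _ h₀ h₁, hS.incl_lie _ _ h₀ h₂, hS.incl_lie _ _ h₀ h₃,
    hS.incl_lie _ _ h₁ h₂, hS.incl_lie _ _ h₁ h₃, hS.incl_lie _ _ h₂ h₃]
  exact hH _ _ _ _ h₀ h₁ h₂ h₃ x

theorem smoothThreeForm_add {η θ : ThreeForm F M}
    (hη : SmoothThreeForm η) (hθ : SmoothThreeForm θ) :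
    SmoothThreeForm (fun x => η x + θ x) :=
  fun U V W hU hV hW => (hη U V W hU hV hW).add (hθ U V W hU hV hW)

/-- The connection depends on its direction through the tangent part only, and that of `𝒟 f` is
zero. -/
theorem pairConnection_D_left {B : M → Type*} [∀ x, AddCommGroup (B x)] [∀ x, Module ℂ (B x)]
    [FiniteDimensional ℝ F] [T2Space M] {S : TangentSummand F A} (hS : S.IsInvolutive)
    {T : TangentSummand F B} {h : ∀ x, (A x) [⋀^Fin 3]→ₗ[ℂ] ℂ} {C : CourantData F _}
    {η : ThreeForm F M}
    (hc : IsConnection (twistedCourant S h) C (pairConnection S T η)) (f : M → ℂ)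
    {b : ∀ x, B x × Module.Dual ℂ (B x)} (hb : b ∈ C.Γ) (x : M) :
    pairConnection S T η ((twistedCourant S h).D f) b x = 0 := by
  have e : pairConnection S T η ((twistedCourant S h).D f) b
      = pairConnection S T η (fun _ => 0) b := by
    have : (fun x => ((twistedCourant S h).D f x).1) = fun _ => 0 :=
      funext fun x => by rw [hS.twistedCourant_D]
    simp only [pairConnection, this]
    rfl
  rw [e, hc.zero_left hS.twistedCourant_bundle.zero_mem hb]

end Forms

/-! ### Which component of `H` survives on vectors of given types -/

section Types

variable {V : Type*} [NormedAddCommGroup V] [NormedSpace ℂ V]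
  {X : Type*} [TopologicalSpace X] [ChartedSpace V X]

/-! ### Components of three-forms -/

variable {H H30 H21 H12 H03 : ThreeForm V X} (t30 : IsOfType 3 0 H30) (t21 : IsOfType 2 1 H21)
  (t12 : IsOfType 1 2 H12) (t03 : IsOfType 0 3 H03)
  (hsum : ∀ x, H x = H30 x + H21 x + H12 x + H03 x) (x : X)

include t21 t12 t03 hsum in
-- In this and the next three lemmas, the finite set passed to `IsOfType` marks the slots filled
-- from `T10`. Counting them eliminates three of the four components.
theorem threeForm_apply_T10 (u v w : T10 V x) : H x ![u.1, v.1, w.1] = H30 x ![u.1, v.1, w.1] := by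
  have h1 : ∀ i ∈ (Finset.univ : Finset (Fin 3)), ![u.1, v.1, w.1] i ∈ T10 V x := fun i _ => by
    fin_cases i <;> simp
  have h2 : ∀ i ∉ (Finset.univ : Finset (Fin 3)), ![u.1, v.1, w.1] i ∈ T01 V x :=
    fun i hi => absurd (Finset.mem_univ i) hi
  rw [hsum]
  simp [t21 x _ _ h1 h2 (by decide), t12 x _ _ h1 h2 (by decide), t03 x _ _ h1 h2 (by decide)]

include t30 t21 t12 hsum in
theorem threeForm_apply_T01 (u v w : T01 V x) : H x ![u.1, v.1, w.1] = H03 x ![u.1, v.1, w.1] := by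
  have h1 : ∀ i ∈ (∅ : Finset (Fin 3)), ![u.1, v.1, w.1] i ∈ T10 V x :=
    fun i hi => absurd hi (Finset.notMem_empty i)
  have h2 : ∀ i ∉ (∅ : Finset (Fin 3)), ![u.1, v.1, w.1] i ∈ T01 V x := fun i _ => by
    fin_cases i <;> simp
  rw [hsum]
  simp [t30 x _ _ h1 h2 (by decide), t21 x _ _ h1 h2 (by decide), t12 x _ _ h1 h2 (by decide)]

include t30 t21 t03 hsum in
theorem threeForm_apply_T10_T01 (u : T10 V x) (v w : T01 V x) :
    H x ![u.1, v.1, w.1] = H12 x ![u.1, v.1, w.1] := by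
  have h1 : ∀ i ∈ ({0} : Finset (Fin 3)), ![u.1, v.1, w.1] i ∈ T10 V x := fun i hi => by
    fin_cases i <;> simp at hi ⊢
  have h2 : ∀ i ∉ ({0} : Finset (Fin 3)), ![u.1, v.1, w.1] i ∈ T01 V x := fun i hi => by
    fin_cases i <;> simp at hi ⊢
  rw [hsum]
  simp [t30 x _ _ h1 h2 (by decide), t21 x _ _ h1 h2 (by decide), t03 x _ _ h1 h2 (by decide)]

include t30 t12 t03 hsum in
theorem threeForm_apply_T01_T10 (u : T01 V x) (v w : T10 V x) :
    H x ![u.1, v.1, w.1] = H21 x ![u.1, v.1, w.1] := by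
  have h1 : ∀ i ∈ ({1, 2} : Finset (Fin 3)), ![u.1, v.1, w.1] i ∈ T10 V x := fun i hi => by
    fin_cases i <;> simp at hi ⊢
  have h2 : ∀ i ∉ ({1, 2} : Finset (Fin 3)), ![u.1, v.1, w.1] i ∈ T01 V x := fun i hi => by
    fin_cases i <;> simp at hi ⊢
  rw [hsum]
  simp [t30 x _ _ h1 h2 (by decide), t12 x _ _ h1 h2 (by decide), t03 x _ _ h1 h2 (by decide)]

end Types

end CourantPair

/-! ### The matched pair of a complex manifold -/

theorem mainTheorem5 {V : Type*} [NormedAddCommGroup V] [NormedSpace ℂ V] [FiniteDimensional ℂ V]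
    {X : Type*} [TopologicalSpace X] [T2Space X] [ChartedSpace V X]
    [IsManifold 𝓘(ℂ, V) ω X]
    (H H30 H21 H12 H03 : CourantPair.ThreeForm V X)
    (h30 : CourantPair.SmoothThreeForm H30) (t30 : CourantPair.IsOfType 3 0 H30)
    (h21 : CourantPair.SmoothThreeForm H21) (t21 : CourantPair.IsOfType 2 1 H21)
    (h12 : CourantPair.SmoothThreeForm H12) (t12 : CourantPair.IsOfType 1 2 H12)
    (h03 : CourantPair.SmoothThreeForm H03) (t03 : CourantPair.IsOfType 0 3 H03)
    (hsum : ∀ x, H x = H30 x + H21 x + H12 x + H03 x)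
    (hclosed : CourantPair.ClosedThreeForm H) :
    CourantPair.IsMatchedPair (CourantPair.courant10 H30) (CourantPair.courant01 H03)
        (CourantPair.rightConnection H12) (CourantPair.leftConnection H21) ∧
      CourantPair.IsCourantAlgebroid
        (CourantPair.matchedSum (CourantPair.courant10 H30) (CourantPair.courant01 H03)
          (CourantPair.rightConnection H12) (CourantPair.leftConnection H21)) ∧
      CourantPair.IsCourantAlgebroid (CourantPair.standardCourant H) ∧
      CourantPair.CourantIsomorphic
        (CourantPair.matchedSum (CourantPair.courant10 H30) (CourantPair.courant01 H03)
          (CourantPair.rightConnection H12) (CourantPair.leftConnection H21))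
        (CourantPair.standardCourant H) := by
  have : FiniteDimensional ℝ V := FiniteDimensional.complexToReal V
  have hST := CourantPair.tangent10_isComplementary (V := V) (X := X)
  have e30 := CourantPair.threeForm_apply_T10 t21 t12 t03 hsum
  have e03 := CourantPair.threeForm_apply_T01 t30 t21 t12 hsum
  have hH : CourantPair.SmoothThreeForm H := by
    rw [show H = fun x => H30 x + H21 x + H12 x + H03 x from funext hsum]
    exact CourantPair.smoothThreeForm_add
      (CourantPair.smoothThreeForm_add (CourantPair.smoothThreeForm_add h30 h21) h12) h03
  have h : CourantPair.IsCourantAlgebroid (CourantPair.standardCourant H) :=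
    CourantPair.TangentSummand.wholeTangent_isInvolutive.isCourantAlgebroid hH hclosed
  have h₁ : CourantPair.IsCourantAlgebroid (CourantPair.courant10 H30) :=
    hST.left.isCourantAlgebroid (h30.smoothForm _) (hclosed.closedForm hST.left e30)
  have h₂ : CourantPair.IsCourantAlgebroid (CourantPair.courant01 H03) :=
    hST.right.isCourantAlgebroid (h03.smoothForm _) (hclosed.closedForm hST.right e03)
  have s : CourantPair.IsSplitting (CourantPair.standardCourant H) (CourantPair.courant10 H30)
      (CourantPair.courant01 H03) (CourantPair.rightConnection H12)
      (CourantPair.leftConnection H21) _ :=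
    hST.isSplitting
      (fun x u v w => (e30 x u v w).trans (CourantPair.compLinearMap_apply_three (H30 x)
        ((CourantPair.tangent10 V X).incl x) u v w).symm)
      (fun x u v w => (e03 x u v w).trans (CourantPair.compLinearMap_apply_three (H03 x)
        ((CourantPair.tangent01 V X).incl x) u v w).symm)
      (CourantPair.threeForm_apply_T10_T01 t30 t21 t03 hsum)
      (CourantPair.threeForm_apply_T01_T10 t30 t12 t03 hsum)
  -- The matched sum is a Courant algebroid because it is isomorphic to the standard one; the
  -- matched pair identities are then extracted from it.
  have iso := s.isomorphic h h₁ h₂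
  have hS := h.of_isomorphic iso
  have hr := s.isConnection h h₁ h₂
  have hl := s.swap.isConnection h h₂ h₁
  exact ⟨CourantPair.IsMatchedPair.of_matchedSum h₁ h₂ hr hl (s.isMetric h h₁ h₂)
    (s.swap.isMetric h h₂ h₁) hS
    (fun f _ β hβ x => CourantPair.pairConnection_D_left hST.left hr f hβ x)
    (fun f _ b hb x => CourantPair.pairConnection_D_left hST.right hl f hb x)
    (fun f hf => hST.left.twistedCourant_D_mem hf)
    (fun f hf => hST.right.twistedCourant_D_mem hf), hS, h, iso⟩
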